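/- Let $G$ be a compact connected Lie group, $\theta$ an involutive automorphism of $G$, and $K$ a closed subgroup with $G_\theta^0\subset K\subset G_\theta$, where $G_\theta=\{g\in G\mid\theta(g)=g\}$ and $G_\theta^0$ is its identity component. Denote the induced involution of the Lie algebra $\mathfrak g$ of $G$ again by $\theta$, put $\mathfrak m=\{X\in\mathfrak g\mid\theta(X)=-X\}$, and let $\langle\ ,\ \rangle$ be an inner product on $\mathfrak g$ invariant under $\theta$ and $\mathrm{Ad}(G)$. Assume that the pair $(G,K)$ is irreducible, that is, $\mathfrak m\neq 0$ and $\mathrm{Ad}(K)$ acts irreducibly on $\mathfrak m$, and that it is Hermitian, that is, $\mathfrak m$ carries an orthogonal complex structure $J$ ($J^2=-1$) commuting with $\mathrm{Ad}(k)|_{\mathfrak m}$ for all $k\in K$. Let $\mathfrak a\subset\mathfrak m$ be a maximal abelian subspace and let $\alpha\in\mathfrak a\setminus\{0\}$ be a restricted root, that is, there is a nonzero $X\in\mathfrak g\otimes\mathbf C$ with $[H,X]=\sqrt{-1}\,\langle\alpha,H\rangle X$ for all $H\in\mathfrak a$. Then, for some $n\ge 0$, the Hermitian vector space $(\mathfrak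 m,J,\langle\ ,\ \rangle)$ is isometric to $\mathbf C^{n+1}$, and under any complex linear isometry $\mathfrak m\cong\mathbf C^{n+1}$ the image in $\mathbf CP^n$, under the projection $v\mapsto[v]$, of the orbit $\mathrm{Ad}(K)\alpha$ of the $s$-representation through $\alpha$ is a weakly reflective submanifold of $\mathbf CP^n$ with the Fubini--Study metric. Here a submanifold $M$ of a Riemannian manifold $\tilde M$ is called weakly reflective if for each $x\in M$ and each normal vector $\xi\in T_x^\perp M$ there exists an isometry $\sigma_\xi$ of $\tilde M$ with $\sigma_\xi(x)=x$, $(d\sigma_\xi)_x\xi=-\xi$ and $\sigma_\xi(M)=M$. -/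

import Mathlib

open scoped Manifold ContDiff TensorProduct

noncomputable section

/-! ### Weakly reflective submanifolds of Riemannian manifolds -/

section Riemannian

variable {E : Type*} [NormedAddCommGroup E] [NormedSpace ℝ E]
  {M : Type*} [TopologicalSpace M] [ChartedSpace E M]

/-- `S` is a (smooth, embedded, `d`-dimensional for some `d`) submanifold of `M`: around each of its
points there is a smooth chart of `M` in which `S` is a `d`-dimensional linear subspace. -/
def IsSubmanifold (E : Type*) [NormedAddCommGroup E] [NormedSpace ℝ E]
    {M : Type*} [TopologicalSpace M] [ChartedSpace E M] (S : Set M) : Prop :=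
  ∃ d : ℕ, ∀ p ∈ S, ∃ φ ∈ IsManifold.maximalAtlas 𝓘(ℝ, E) ∞ M, p ∈ φ.source ∧
    ∃ F : Submodule ℝ E, Module.finrank ℝ F = d ∧ ∀ q ∈ φ.source, q ∈ S ↔ φ q ∈ F

/-- The vectors at `p` tangent to `S`: the velocities `γ'(0)` of curves `γ` in `S` with
`γ(0) = p`. -/
def tangentVectors (S : Set M) (p : M) : Set (TangentSpace 𝓘(ℝ, E) p) :=
  {η | ∃ γ : ℝ → M, γ 0 = p ∧ (∀ᶠ t in nhds 0, γ t ∈ S) ∧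
    MDifferentiableAt 𝓘(ℝ, ℝ) 𝓘(ℝ, E) γ 0 ∧ (mfderiv 𝓘(ℝ, ℝ) 𝓘(ℝ, E) γ 0 (1 : ℝ) : E) = η}

/-- The vectors at `p` normal to `S` with respect to the Riemannian metric `g`. -/
def normalVectors (g : Bundle.RiemannianMetric (fun p : M => TangentSpace 𝓘(ℝ, E) p))
    (S : Set M) (p : M) : Set (TangentSpace 𝓘(ℝ, E) p) :=
  {ξ | ∀ η ∈ tangentVectors S p, g.inner p ξ η = 0}

/-- A diffeomorphism of `M` which preserves the Riemannian metric `g`. -/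
def IsRiemannianIsometry (g : Bundle.RiemannianMetric (fun p : M => TangentSpace 𝓘(ℝ, E) p))
    (σ : Diffeomorph 𝓘(ℝ, E) 𝓘(ℝ, E) M M ∞) : Prop :=
  ∀ (p : M) (ξ η : TangentSpace 𝓘(ℝ, E) p),
    g.inner (σ p) (mfderiv 𝓘(ℝ, E) 𝓘(ℝ, E) σ p ξ) (mfderiv 𝓘(ℝ, E) 𝓘(ℝ, E) σ p η) =
      g.inner p ξ η

/-- `S` is a weakly reflective submanifold of the Riemannian manifold `(M, g)`: for every normal
vector `ξ` at every `x ∈ S` there is an isometry `σ` of `M` with `σ(x) = x`, `dσₓ ξ = -ξ` and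
`σ(S) = S`. -/
def IsWeaklyReflective (g : Bundle.RiemannianMetric (fun p : M => TangentSpace 𝓘(ℝ, E) p))
    (S : Set M) : Prop :=
  IsSubmanifold E S ∧
    ∀ x ∈ S, ∀ ξ ∈ normalVectors g S x, ∃ σ : Diffeomorph 𝓘(ℝ, E) 𝓘(ℝ, E) M M ∞,
      IsRiemannianIsometry g σ ∧ σ x = x ∧
        (mfderiv 𝓘(ℝ, E) 𝓘(ℝ, E) σ x ξ : E) = -(ξ : E) ∧ σ '' S = S

end Riemannian

/-! ### Complex projective space with the Fubini–Study metric -/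

section CP

/-- Complex projective space `ℂPⁿ`: the space of complex lines in `ℂⁿ⁺¹`. -/
def CPn (n : ℕ) : Type :=
  Projectivization ℂ (EuclideanSpace ℂ (Fin (n + 1)))

namespace CPn
variable {n : ℕ}

/-- The projection `v ↦ [v]` from the nonzero vectors of `ℂⁿ⁺¹` to `ℂPⁿ`. -/
def proj (v : {v : EuclideanSpace ℂ (Fin (n + 1)) // v ≠ 0}) : CPn n :=
  Projectivization.mk ℂ v.1 v.2

/-- The quotient topology. -/
instance : TopologicalSpace (CPn n) := TopologicalSpace.coinduced proj inferInstance

theorem proj_surjective : Function.Surjective (proj (n := n)) := fun p =>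
  ⟨⟨p.rep, p.rep_nonzero⟩, Projectivization.mk_rep p⟩

theorem isQuotientMap_proj : Topology.IsQuotientMap (proj (n := n)) :=
  ⟨⟨rfl⟩, proj_surjective⟩

theorem proj_eq_iff {v w : {v : EuclideanSpace ℂ (Fin (n + 1)) // v ≠ 0}} :
    proj v = proj w ↔ ∃ c : ℂ, c • w.1 = v.1 :=
  Projectivization.mk_eq_mk_iff' ℂ _ _ v.2 w.2

/-- The affine vector `(1, u₁, …, uₙ)`. -/
def cone (u : EuclideanSpace ℂ (Fin n)) : EuclideanSpace ℂ (Fin (n + 1)) :=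
  WithLp.toLp 2 (Fin.cons 1 u)

theorem cone_zero (u : EuclideanSpace ℂ (Fin n)) : cone u 0 = 1 := rfl
theorem cone_succ (u : EuclideanSpace ℂ (Fin n)) (j : Fin n) : cone u j.succ = u j := rfl
theorem cone_ne_zero (u : EuclideanSpace ℂ (Fin n)) : cone u ≠ 0 := fun h => by
  simpa [cone_zero] using congrArg (fun w : EuclideanSpace ℂ (Fin (n + 1)) => w 0) h

/-- The affine coordinates `(w₁/w₀, …, wₙ/w₀)`. -/
def affine (w : EuclideanSpace ℂ (Fin (n + 1))) : EuclideanSpace ℂ (Fin n) :=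
  WithLp.toLp 2 fun j => w j.succ / w 0

theorem affine_cone (u : EuclideanSpace ℂ (Fin n)) : affine (cone u) = u := by
  ext j; simp [affine, cone_zero, cone_succ]

theorem cone_affine {w : EuclideanSpace ℂ (Fin (n + 1))} (h : w 0 ≠ 0) :
    w 0 • cone (affine w) = w := by
  ext j
  refine Fin.cases ?_ (fun i => ?_) j
  · simp [cone_zero]
  · simp only [PiLp.smul_apply, cone_succ, affine, smul_eq_mul]; field_simp

theorem affine_smul {c : ℂ} (hc : c ≠ 0) (w : EuclideanSpace ℂ (Fin (n + 1))) :
    affine (c • w) = affine w := by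
  ext j; simp [affine, mul_div_mul_left _ _ hc]

theorem contDiff_cone : ContDiff ℝ ∞ (cone (n := n)) := by
  rw [contDiff_piLp]
  intro j
  refine Fin.cases ?_ (fun i => ?_) j
  · simpa [cone_zero] using contDiff_const
  · simp only [cone_succ]; fun_prop

theorem contDiffOn_affine :
    ContDiffOn ℝ ∞ (affine (n := n)) {w | w 0 ≠ 0} := by
  rw [contDiffOn_piLp]
  intro j
  have h (i : Fin (n + 1)) : ContDiffOn ℝ ∞
      (fun w : EuclideanSpace ℂ (Fin (n + 1)) => w i) {w | w 0 ≠ 0} := by fun_prop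
  exact ((h j.succ).mul ((h 0).inv fun w hw => hw)).congr fun w _ => div_eq_mul_inv _ _


theorem mem_proj_image {v : {v : EuclideanSpace ℂ (Fin (n + 1)) // v ≠ 0}} :
    proj v ∈ proj '' {w : {v : EuclideanSpace ℂ (Fin (n + 1)) // v ≠ 0} | w.1 0 ≠ 0} ↔
      v.1 0 ≠ 0 := by
  constructor
  · rintro ⟨w, hw, h⟩ h0
    obtain ⟨c, hc⟩ := proj_eq_iff.1 h
    apply hw
    simp [← hc, h0]
  · exact fun h => ⟨v, h, rfl⟩

/-- The map `[w] ↦ (w₁/w₀, …, wₙ/w₀)` (meaningful where `w₀ ≠ 0`). -/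
def affineMap (p : CPn n) : EuclideanSpace ℂ (Fin n) :=
  Projectivization.lift (fun v => affine v.1) (by
    rintro a b t h
    have ht : t ≠ 0 := by rintro rfl; exact a.2 (by simpa using h)
    rw [h, affine_smul ht]) p

theorem affineMap_proj (v : {v : EuclideanSpace ℂ (Fin (n + 1)) // v ≠ 0}) :
    affineMap (proj v) = affine v.1 := rfl

/-- The standard affine chart of `ℂPⁿ`, defined on `{w₀ ≠ 0}`, with values in `ℂⁿ`. -/
def affineChart (n : ℕ) : OpenPartialHomeomorph (CPn n) (EuclideanSpace ℂ (Fin n)) where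
  toFun := affineMap
  invFun u := proj ⟨cone u, cone_ne_zero u⟩
  source := proj '' {w | w.1 0 ≠ 0}
  target := Set.univ
  map_source' _ _ := Set.mem_univ _
  map_target' u _ := ⟨_, by simp [cone_zero], rfl⟩
  left_inv' := by
    rintro _ ⟨w, hw, rfl⟩
    exact (proj_eq_iff.2 ⟨w.1 0, cone_affine hw⟩).symm
  right_inv' u _ := affine_cone u
  open_source := by
    rw [← isQuotientMap_proj.isOpen_preimage]
    have : proj ⁻¹' (proj '' {w | w.1 0 ≠ 0}) =
        {w : {v : EuclideanSpace ℂ (Fin (n + 1)) // v ≠ 0} | w.1 0 ≠ 0} := by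
      ext v; exact mem_proj_image
    rw [this]
    exact isOpen_ne_fun (by fun_prop) continuous_const
  open_target := isOpen_univ
  continuousOn_toFun := by
    have ho : IsOpen (proj '' {w : {v : EuclideanSpace ℂ (Fin (n + 1)) // v ≠ 0} | w.1 0 ≠ 0}) := by
      rw [← isQuotientMap_proj.isOpen_preimage]
      have : proj ⁻¹' (proj '' {w | w.1 0 ≠ 0}) =
          {w : {v : EuclideanSpace ℂ (Fin (n + 1)) // v ≠ 0} | w.1 0 ≠ 0} := by
        ext v; exact mem_proj_image
      rw [this]
      exact isOpen_ne_fun (by fun_prop) continuous_const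
    rw [isQuotientMap_proj.continuousOn_isOpen_iff ho]
    have hc : ContinuousOn (affine (n := n)) {w | w 0 ≠ 0} := contDiffOn_affine.continuousOn
    exact hc.comp continuous_subtype_val.continuousOn fun v hv => mem_proj_image.1 hv
  continuousOn_invFun :=
    (isQuotientMap_proj.continuous.comp
      (contDiff_cone.continuous.subtype_mk _)).continuousOn

/-- The action of a unitary transformation of `ℂⁿ⁺¹` on `ℂPⁿ`. -/
def act (U : EuclideanSpace ℂ (Fin (n + 1)) ≃ₗᵢ[ℂ] EuclideanSpace ℂ (Fin (n + 1))) (p : CPn n) :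
    CPn n :=
  Projectivization.map U.toLinearEquiv.toLinearMap U.injective p

theorem act_proj (U : EuclideanSpace ℂ (Fin (n + 1)) ≃ₗᵢ[ℂ] EuclideanSpace ℂ (Fin (n + 1)))
    (v : {v : EuclideanSpace ℂ (Fin (n + 1)) // v ≠ 0}) :
    act U (proj v) = proj ⟨U v.1, by simpa using v.2⟩ := rfl

theorem continuous_act
    (U : EuclideanSpace ℂ (Fin (n + 1)) ≃ₗᵢ[ℂ] EuclideanSpace ℂ (Fin (n + 1))) :
    Continuous (act U) := by
  rw [isQuotientMap_proj.continuous_iff]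
  exact isQuotientMap_proj.continuous.comp
    ((U.continuous.comp continuous_subtype_val).subtype_mk fun v => by simpa using v.2)

theorem act_symm_act
    (U : EuclideanSpace ℂ (Fin (n + 1)) ≃ₗᵢ[ℂ] EuclideanSpace ℂ (Fin (n + 1))) (p : CPn n) :
    act U.symm (act U p) = p := by
  obtain ⟨v, rfl⟩ := proj_surjective p
  simp [act_proj]

/-- `act U` as a homeomorphism. -/
def actHomeo (U : EuclideanSpace ℂ (Fin (n + 1)) ≃ₗᵢ[ℂ] EuclideanSpace ℂ (Fin (n + 1))) :
    CPn n ≃ₜ CPn n where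
  toFun := act U
  invFun := act U.symm
  left_inv := act_symm_act U
  right_inv p := by simpa using act_symm_act U.symm p
  continuous_toFun := continuous_act U
  continuous_invFun := continuous_act U.symm

/-- The affine chart in the unitary frame `U e₀, …, U eₙ`: if `U⁻¹ w = (z₀, …, zₙ)` then
`[w] ↦ (z₁/z₀, …, zₙ/z₀)`. -/
def frameChart (U : EuclideanSpace ℂ (Fin (n + 1)) ≃ₗᵢ[ℂ] EuclideanSpace ℂ (Fin (n + 1))) :
    OpenPartialHomeomorph (CPn n) (EuclideanSpace ℂ (Fin n)) :=
  (actHomeo U.symm).toOpenPartialHomeomorph ≫ₕ affineChart n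

theorem exists_frame (p : CPn n) :
    ∃ U : EuclideanSpace ℂ (Fin (n + 1)) ≃ₗᵢ[ℂ] EuclideanSpace ℂ (Fin (n + 1)),
      p = act U (proj ⟨cone 0, cone_ne_zero 0⟩) := by
  obtain ⟨⟨v, hv⟩, rfl⟩ := proj_surjective p
  have hv' : (‖v‖ : ℂ) ≠ 0 := by simpa using hv
  obtain ⟨b, hb⟩ := Orthonormal.exists_orthonormalBasis_extension_of_card_eq (𝕜 := ℂ)
    (ι := Fin (n + 1)) (E := EuclideanSpace ℂ (Fin (n + 1)))
    (v := fun _ => (‖v‖ : ℂ)⁻¹ • v) (s := {0}) (by simp) (by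
      rw [orthonormal_iff_ite]
      rintro ⟨i, rfl⟩ ⟨j, rfl⟩
      simp [norm_smul, hv])
  refine ⟨b.repr.symm, ?_⟩
  rw [act_proj, proj_eq_iff]
  have h0 : cone (0 : EuclideanSpace ℂ (Fin n)) = EuclideanSpace.single 0 1 := by
    ext j
    refine Fin.cases ?_ (fun i => ?_) j <;> simp [cone_zero, cone_succ]
  refine ⟨‖v‖, ?_⟩
  change (‖v‖ : ℂ) • b.repr.symm (cone 0) = v
  rw [h0, OrthonormalBasis.repr_symm_single, hb 0 (by simp)]
  exact smul_inv_smul₀ hv' v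

/-- A unitary frame whose first vector spans the line `p`. -/
def frame (p : CPn n) : EuclideanSpace ℂ (Fin (n + 1)) ≃ₗᵢ[ℂ] EuclideanSpace ℂ (Fin (n + 1)) :=
  (exists_frame p).choose

/-- The smooth structure of `ℂPⁿ`; the preferred chart at `p` is the affine chart in a unitary
frame in which `p = [1 : 0 : ⋯ : 0]`. -/
instance : ChartedSpace (EuclideanSpace ℂ (Fin n)) (CPn n) where
  atlas := Set.range frameChart
  chartAt p := frameChart (frame p)
  mem_chart_source p := by
    rw [frameChart, OpenPartialHomeomorph.trans_source]
    refine ⟨Set.mem_univ _, ?_⟩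
    have h : act (frame p).symm p = proj ⟨cone 0, cone_ne_zero 0⟩ := by
      conv_lhs => arg 2; rw [(exists_frame p).choose_spec]
      exact act_symm_act (frame p) _
    change act (frame p).symm p ∈ proj '' _
    rw [h]
    exact mem_proj_image.2 (by simp [cone_zero])
  chart_mem_atlas p := ⟨_, rfl⟩

instance : IsManifold (𝓘(ℝ, EuclideanSpace ℂ (Fin n))) ∞ (CPn n) := by
  apply isManifold_of_contDiffOn
  rintro _ _ ⟨U, rfl⟩ ⟨U', rfl⟩
  simp only [modelWithCornersSelf_coe, modelWithCornersSelf_coe_symm, Function.id_comp,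
    Function.comp_id, Set.preimage_id, Set.range_id, Set.inter_univ]
  have key : ∀ u : EuclideanSpace ℂ (Fin n), act U'.symm ((frameChart U).symm u) =
      proj ⟨U'.symm (U (cone u)), by simpa using cone_ne_zero u⟩ := fun u => rfl
  have hfun : ∀ u : EuclideanSpace ℂ (Fin n), ((frameChart U).symm.trans (frameChart U')) u =
      affine (U'.symm (U (cone u))) := fun u => rfl
  refine ContDiffOn.congr ?_ fun u _ => hfun u
  refine contDiffOn_affine.comp (t := {w : EuclideanSpace ℂ (Fin (n + 1)) | w 0 ≠ 0}) ?_ fun u hu => ?_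
  · have h1 : ContDiff ℝ ∞ fun w => U'.symm (U w) :=
      ((U.trans U'.symm).toContinuousLinearEquiv.toContinuousLinearMap.restrictScalars ℝ).contDiff
    exact (h1.comp contDiff_cone).contDiffOn
  · have h2 : act U'.symm ((frameChart U).symm u) ∈ (affineChart n).source := hu.2.2
    rw [key] at h2
    exact mem_proj_image.1 h2

/-- The Fubini–Study metric. In the affine chart of a unitary frame with `p = [1 : 0 : ⋯ : 0]`, which
is the preferred chart at `p`, it is at `p` the standard Euclidean inner product of `ℂⁿ`. -/
def fubiniStudy (n : ℕ) : Bundle.RiemannianMetric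
    (fun p : CPn n => TangentSpace (𝓘(ℝ, EuclideanSpace ℂ (Fin n))) p) where
  inner p := (innerSL ℝ : EuclideanSpace ℂ (Fin n) →L[ℝ] EuclideanSpace ℂ (Fin n) →L[ℝ] ℝ)
  symm p v w := real_inner_comm (F := EuclideanSpace ℂ (Fin n)) _ _
  pos p v hv := real_inner_self_pos (F := EuclideanSpace ℂ (Fin n)).2 hv
  continuousAt p := by
    change ContinuousAt (fun v : EuclideanSpace ℂ (Fin n) => inner ℝ v v) 0
    fun_prop
  isVonNBounded p := by
    change Bornology.IsVonNBounded ℝ {v : EuclideanSpace ℂ (Fin n) | inner ℝ v v < 1}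
    rw [NormedSpace.isVonNBounded_iff]
    refine Metric.isBounded_ball (x := (0 : EuclideanSpace ℂ (Fin n))) (r := 1) |>.subset ?_
    intro v hv
    have : ‖v‖ ^ 2 < 1 := by rw [← real_inner_self_eq_norm_sq]; exact hv
    simpa using (sq_lt_one_iff₀ (norm_nonneg v)).1 this

end CPn
end CP

/-! ### Compact symmetric pairs and their linear isotropy representations -/

/-- The Lie bracket of the Lie algebra of a Lie group needs `C³` only. -/
instance instLEInftyMinSmoothnessThree : ENat.LEInfty (minSmoothness ℝ 3) :=
  ⟨by rw [minSmoothness_of_isRCLikeNormedField]; exact ENat.LEInfty.out⟩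

section SymmetricPair

/-- The adjoint representation of a Lie group: `Ad(g)` is the differential at `1` of
`h ↦ g h g⁻¹`. -/
def lieAd (E : Type*) [NormedAddCommGroup E] [NormedSpace ℝ E]
    {G : Type*} [TopologicalSpace G] [ChartedSpace E G] [Group G] (g : G) :
    GroupLieAlgebra 𝓘(ℝ, E) G →L[ℝ] GroupLieAlgebra 𝓘(ℝ, E) G :=
  mfderiv 𝓘(ℝ, E) 𝓘(ℝ, E) (fun h : G => g * h * g⁻¹) 1

/-- A symmetric pair `(G, K)` with respect to an involutive automorphism `θ` of the Lie group `G`: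
`K` is a closed subgroup with `G_θ⁰ ⊆ K ⊆ G_θ`, where `G_θ` is the fixed point group of `θ` and
`G_θ⁰` its identity component. -/
structure SymmetricPair (E : Type*) [NormedAddCommGroup E] [NormedSpace ℝ E]
    (G : Type*) [TopologicalSpace G] [ChartedSpace E G] [Group G] where
  θ : G ≃* G
  contMDiff_θ : ContMDiff 𝓘(ℝ, E) 𝓘(ℝ, E) ∞ θ
  involutive_θ : ∀ g, θ (θ g) = g
  K : Subgroup G
  isClosed_K : IsClosed (K : Set G)
  identityComponent_subset : connectedComponentIn {g : G | θ g = g} 1 ⊆ (K : Set G)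
  K_subset : (K : Set G) ⊆ {g : G | θ g = g}

variable {E : Type*} [NormedAddCommGroup E] [NormedSpace ℝ E]
  {G : Type*} [TopologicalSpace G] [ChartedSpace E G] [Group G]

namespace SymmetricPair

/-- The involution of the Lie algebra induced by `θ`. -/
def dθ (P : SymmetricPair E G) : GroupLieAlgebra 𝓘(ℝ, E) G →L[ℝ] GroupLieAlgebra 𝓘(ℝ, E) G :=
  mfderiv 𝓘(ℝ, E) 𝓘(ℝ, E) P.θ 1

/-- The subspace `𝔪 = {X ∈ 𝔤 | θ(X) = -X}`. -/
def 𝔪 (P : SymmetricPair E G) : Submodule ℝ (GroupLieAlgebra 𝓘(ℝ, E) G) where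
  carrier := {X | P.dθ X = -X}
  add_mem' {X Y} hX hY := by
    change P.dθ (X + Y) = -(X + Y)
    rw [map_add, hX, hY, neg_add]
  zero_mem' := by
    change P.dθ 0 = -0
    rw [map_zero, neg_zero]
  smul_mem' c X hX := by
    change P.dθ (c • X) = -(c • X)
    rw [map_smul, hX, smul_neg]

/-- `(G, K)` is irreducible: `Ad(K)` acts irreducibly on `𝔪`. -/
def IsIrreducible (P : SymmetricPair E G) : Prop :=
  P.𝔪 ≠ ⊥ ∧ ∀ V : Submodule ℝ (GroupLieAlgebra 𝓘(ℝ, E) G), V ≤ P.𝔪 →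
    (∀ k ∈ P.K, ∀ X ∈ V, lieAd E k X ∈ V) → V = ⊥ ∨ V = P.𝔪

/-- An inner product on `𝔤` which is invariant under `θ` and under the adjoint representation
of `G`. -/
structure InvariantInner (P : SymmetricPair E G) where
  form : LinearMap.BilinForm ℝ (GroupLieAlgebra 𝓘(ℝ, E) G)
  symm : ∀ X Y, form X Y = form Y X
  pos : ∀ X, X ≠ 0 → 0 < form X X
  ad_inv : ∀ (g : G) X Y, form (lieAd E g X) (lieAd E g Y) = form X Y
  θ_inv : ∀ X Y, form (P.dθ X) (P.dθ Y) = form X Y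

/-- A Hermitian structure on the symmetric pair: an orthogonal complex structure `J` on
`𝔪 = T_o(G/K)` which commutes with `Ad(K)`, i.e. a `G`-invariant Hermitian structure on `G/K`. -/
structure HermitianStructure (P : SymmetricPair E G) (B : P.InvariantInner) where
  J : P.𝔪 →ₗ[ℝ] P.𝔪
  sq : ∀ X, J (J X) = -X
  isometry : ∀ X Y, B.form (J X) (J Y) = B.form X Y
  ad_comm : ∀ k ∈ P.K, ∀ X Y : P.𝔪,
    (Y : GroupLieAlgebra 𝓘(ℝ, E) G) = lieAd E k X →
      (J Y : GroupLieAlgebra 𝓘(ℝ, E) G) = lieAd E k (J X)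

/-- `𝔞` is a maximal abelian subspace in `𝔪`. -/
def IsMaximalAbelian (P : SymmetricPair E G)
    (𝔞 : Submodule ℝ (GroupLieAlgebra 𝓘(ℝ, E) G)) : Prop :=
  Maximal (fun V : Submodule ℝ (GroupLieAlgebra 𝓘(ℝ, E) G) =>
    V ≤ P.𝔪 ∧ ∀ X ∈ V, ∀ Y ∈ V, ⁅X, Y⁆ = 0) 𝔞

/-- The restricted roots: the nonzero `α ∈ 𝔞` for which there is a nonzero `X ∈ 𝔤 ⊗ ℂ` with
`[H, X] = √-1 ⟨α, H⟩ X` for all `H ∈ 𝔞`. -/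
def restrictedRoots [FiniteDimensional ℝ E] [LieGroup 𝓘(ℝ, E) ∞ G] (P : SymmetricPair E G)
    (B : P.InvariantInner) (𝔞 : Submodule ℝ (GroupLieAlgebra 𝓘(ℝ, E) G)) :
    Set (GroupLieAlgebra 𝓘(ℝ, E) G) :=
  {α | α ∈ 𝔞 ∧ α ≠ 0 ∧ ∃ X : ℂ ⊗[ℝ] GroupLieAlgebra 𝓘(ℝ, E) G, X ≠ 0 ∧
    ∀ H ∈ 𝔞, ⁅(1 : ℂ) ⊗ₜ[ℝ] H, X⁆ = (Complex.I * (B.form α H : ℂ)) • X}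

/-- The orbit `Ad(K)H ⊆ 𝔪` of the s-representation through `H ∈ 𝔪`. -/
def orbit (P : SymmetricPair E G) (H : GroupLieAlgebra 𝓘(ℝ, E) G) : Set P.𝔪 :=
  {X | ∃ k ∈ P.K, (X : GroupLieAlgebra 𝓘(ℝ, E) G) = lieAd E k H}

/-- An identification of `(𝔪, J, ⟨,⟩)` with the Hermitian vector space `ℂⁿ⁺¹`: a `ℂ`-linear
isometry, where `√-1` acts on `𝔪` as `J`. -/
structure HermitianIso (P : SymmetricPair E G) {B : P.InvariantInner}
    (J : P.HermitianStructure B) (n : ℕ) where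
  Φ : P.𝔪 ≃ₗ[ℝ] EuclideanSpace ℂ (Fin (n + 1))
  map_J : ∀ X, Φ (J.J X) = Complex.I • Φ X
  norm_sq : ∀ X : P.𝔪, ‖Φ X‖ ^ 2 = B.form X X

/-- The image in `ℂPⁿ` of a subset `S` of `𝔪 ≅ ℂⁿ⁺¹` under the projection `v ↦ [v]`. -/
def HermitianIso.projImage {P : SymmetricPair E G} {B : P.InvariantInner}
    {J : P.HermitianStructure B} {n : ℕ} (Φ : P.HermitianIso J n) (S : Set P.𝔪) : Set (CPn n) :=
  {p | ∃ X ∈ S, ∃ h : Φ.Φ X ≠ 0, p = CPn.proj ⟨Φ.Φ X, h⟩}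

end SymmetricPair

end SymmetricPair

end

/-! Identify `𝔪` with `ℂⁿ⁺¹`; then `Ad(K)` becomes a compact group of unitary transformations, each
of which induces an isometry of `ℂPⁿ` preserving the orbit of `[α]`. It remains to find, for a point
`[β]` with `β = Ad(g)α` and a normal vector `u` there, an element of `K` whose isometry fixes `[β]`
and sends `u` to `-u`.

The tangent space of `ℂPⁿ` at a line `ℓ` is `Hom(ℓ, ℓ^⊥)`. A unitary map that is `-1` on `ℓ` and
fixes the horizontal lift `ζ` of `u` therefore has differential sending `u` to `-u`
(`CPn.mfderiv_act`, `CPn.isWeaklyReflective_orbit`). So the task is to find `k ∈ K` with `kβ = -β`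
and `kζ = ζ`. Since `ζ` is Hermitian orthogonal to `β`, normality of `u` says that `ζ` is orthogonal
to all `[X, β]` with `θX = X`. Testing with `X = [ζ, β]` gives `[ζ, β] = 0`
(`ad_eq_zero_of_normal`). After translating `β` to `α`, an element of the stabilizer of `α` moves
the commuting vector into `𝔞` (`exists_stabilizer_mem`). It stays orthogonal to `α`, so the
reflection of the restricted root `α`, realized in `K` by a half turn in a copy of `𝔰𝔲(2)`
(`exists_reflection`), fixes it and negates `α`. Conjugating back gives `k` (`exists_neg_fix`).

Two foundations are needed. The orbit is an embedded submanifold: the Lie algebra of a closed matrix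
group yields slice charts (`CPn.exists_slice_chart`). And the algebra above must be linked to `G`:
the derivative of `Ad` is the Lie bracket (`hasFDerivAt_lieAd`), and `exp(ad X)` lies in `Ad(K)`
whenever `θX = X` (`exp_mem_adK`). Everything used about `(G, K)` is then collected in
`OrthogonalSymmetricData`. -/

/-! ### Closed subgroups of finite-dimensional algebras -/

section ClosedSubgroup

open Filter Topology NormedSpace

variable {𝔸 : Type*} [NormedRing 𝔸] [NormedAlgebra ℝ 𝔸] [CompleteSpace 𝔸]

theorem exp_smul_add_smul (A : 𝔸) (s t : ℝ) : exp ((s + t) • A) = exp (s • A) * exp (t • A) := by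
  let _ : NormedAlgebra ℚ 𝔸 := NormedAlgebra.restrictScalars ℚ ℝ 𝔸
  rw [add_smul]
  exact exp_add_of_commute ((Commute.refl A).smul_left s |>.smul_right t)

theorem exp_neg_mul_exp (A : 𝔸) : exp (-A) * exp A = 1 := by
  simpa using (exp_smul_add_smul A (-1) 1).symm

theorem exp_mul_exp_neg (A : 𝔸) : exp A * exp (-A) = 1 := by
  simpa using exp_neg_mul_exp (-A)

/-- Every element of the submonoid `S` has a left inverse in `S`. -/
def Submonoid.InverseClosed (S : Submonoid 𝔸) : Prop :=
  ∀ x ∈ S, ∃ y ∈ S, y * x = 1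

theorem Submonoid.InverseClosed.exp_neg_mem {S : Submonoid 𝔸} (hS : S.InverseClosed) {A : 𝔸}
    (hA : exp A ∈ S) : exp (-A) ∈ S := by
  obtain ⟨y, hy, h⟩ := hS _ hA
  have : y = exp (-A) := by
    rw [← mul_one y, ← exp_mul_exp_neg A, ← mul_assoc, h, one_mul]
  rwa [← this]

theorem Submonoid.InverseClosed.exp_int_smul_mem {S : Submonoid 𝔸} (hS : S.InverseClosed) {A : 𝔸}
    (hA : exp A ∈ S) (m : ℤ) : exp ((m : ℝ) • A) ∈ S := by
  let _ : NormedAlgebra ℚ 𝔸 := NormedAlgebra.restrictScalars ℚ ℝ 𝔸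
  obtain ⟨k, rfl | rfl⟩ := m.eq_nat_or_neg
  · rw [Int.cast_natCast, Nat.cast_smul_eq_nsmul, exp_nsmul]
    exact pow_mem hA k
  · rw [Int.cast_neg, Int.cast_natCast, neg_smul, ← smul_neg, Nat.cast_smul_eq_nsmul, exp_nsmul]
    exact pow_mem (hS.exp_neg_mem hA) k

theorem continuous_exp' : Continuous (exp : 𝔸 → 𝔸) := by
  let _ : NormedAlgebra ℚ 𝔸 := NormedAlgebra.restrictScalars ℚ ℝ 𝔸
  exact exp_continuous

/-- Replacing `r i` by its integer part changes `r i • A i` by a fraction of `A i`, which tends to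
`0`, and exponentials of integer multiples are powers, hence in `S`; closedness finishes. -/
theorem exp_mem_of_tendsto {S : Submonoid 𝔸} (hc : IsClosed (S : Set 𝔸)) (hS : S.InverseClosed)
    {ι : Type*} {l : Filter ι} [l.NeBot] {A : ι → 𝔸} {r : ι → ℝ} {B : 𝔸}
    (hA : Tendsto A l (𝓝 0)) (hmem : ∀ᶠ i in l, exp (A i) ∈ S)
    (hr : Tendsto (fun i => r i • A i) l (𝓝 B)) : exp B ∈ S := by
  have h1 : Tendsto (fun i => Int.fract (r i) • A i) l (𝓝 0) := by
    rw [tendsto_zero_iff_norm_tendsto_zero] at hA ⊢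
    refine squeeze_zero (fun _ => norm_nonneg _) (fun i => ?_) hA
    rw [norm_smul, Real.norm_of_nonneg (Int.fract_nonneg _)]
    exact mul_le_of_le_one_left (norm_nonneg _) (Int.fract_lt_one _).le
  have h2 : Tendsto (fun i => (⌊r i⌋ : ℝ) • A i) l (𝓝 B) := by
    have := hr.sub h1
    rw [sub_zero] at this
    refine this.congr fun i => ?_
    rw [← sub_smul, Int.self_sub_fract]
  exact hc.mem_of_tendsto ((continuous_exp'.tendsto B).comp h2)
    (hmem.mono fun i hi => hS.exp_int_smul_mem hi _)

/-- The velocity at `1` of a curve in a closed group generates a one-parameter subgroup of it. -/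
theorem exp_smul_mem_of_hasDerivAt {S : Submonoid 𝔸} (hc : IsClosed (S : Set 𝔸))
    (hS : S.InverseClosed) {γ : ℝ → 𝔸} {A : 𝔸} (h0 : γ 0 = 1) (hγ : HasDerivAt γ A 0)
    (hmem : ∀ᶠ t in 𝓝 0, γ t ∈ S) (t : ℝ) : exp (t • A) ∈ S := by
  -- The local inverse of `exp` serves as a logarithm near `1`.
  have hs : HasStrictFDerivAt (exp : 𝔸 → 𝔸) ((ContinuousLinearEquiv.refl ℝ 𝔸 : 𝔸 ≃L[ℝ] 𝔸) :
    𝔸 →L[ℝ] 𝔸) 0 := hasStrictFDerivAt_exp_zero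
  set L := hs.localInverse with hL
  have h1 : L 1 = 0 := by
    have := hs.localInverse_apply_image
    rwa [exp_zero] at this
  have hd : HasDerivAt (fun s => L (γ s)) A 0 := by
    have h2 := hs.to_localInverse.hasFDerivAt
    rw [exp_zero, ← h0] at h2
    simpa using! h2.comp_hasDerivAt 0 hγ
  have hcont : Tendsto γ (𝓝 0) (𝓝 1) := h0 ▸ hγ.continuousAt
  have hr : ∀ᶠ s in 𝓝 (0 : ℝ), exp (L (γ s)) = γ s := by
    have := hs.eventually_right_inverse
    rw [exp_zero] at this
    exact hcont.eventually this
  -- The quotient `log γ(s) / s` tends to the velocity `A`, so `t / s` is the right multiplier.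
  refine exp_mem_of_tendsto (l := 𝓝[≠] (0 : ℝ)) (A := fun s => L (γ s)) (r := fun s => t * s⁻¹)
    hc hS ?_ ?_ ?_
  · have := hd.continuousAt.tendsto
    simp only [h0, h1] at this
    exact this.mono_left nhdsWithin_le_nhds
  · refine nhdsWithin_le_nhds ?_
    filter_upwards [hr, hmem] with s h2 h3
    rwa [h2]
  · have := (hasDerivAt_iff_tendsto_slope.1 hd).const_smul t
    refine this.congr fun s => ?_
    simp [slope, h0, h1, mul_smul]

/-- The Lie algebra of a closed group in a finite-dimensional algebra. -/
def expLie (S : Submonoid 𝔸) (hc : IsClosed (S : Set 𝔸)) (hS : S.InverseClosed) :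
    Submodule ℝ 𝔸 where
  carrier := {A | ∀ t : ℝ, exp (t • A) ∈ S}
  zero_mem' t := by simp [exp_zero, S.one_mem]
  smul_mem' c A hA t := by simpa [smul_smul] using hA (t * c)
  add_mem' {A B} hA hB := by
    -- The product of the two one-parameter groups is a curve in `S` with velocity `A + B` at `1`.
    refine exp_smul_mem_of_hasDerivAt hc hS (γ := fun t => exp (t • A) * exp (t • B)) ?_ ?_ ?_
    · simp [exp_zero]
    · simpa [exp_zero] using! (hasDerivAt_exp_smul_const A (0 : ℝ)).mul
        (hasDerivAt_exp_smul_const B (0 : ℝ))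
    · exact Eventually.of_forall fun t => S.mul_mem (hA t) (hB t)

variable [FiniteDimensional ℝ 𝔸]

/-- Otherwise nonzero `z → 0` in `C` have `exp z ∈ S`. A limit of the directions `z / ‖z‖`, which
exists along an ultrafilter because the unit sphere is compact, is a unit vector of `C` lying in the
Lie algebra of `S`, by `exp_mem_of_tendsto` with multipliers `t / ‖z‖`. -/
theorem eventually_exp_mem_imp_eq_zero {S : Submonoid 𝔸} (hc : IsClosed (S : Set 𝔸))
    (hS : S.InverseClosed) {C : Submodule ℝ 𝔸} (hC : Disjoint (expLie S hc hS) C) :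
    ∀ᶠ z : C in 𝓝 0, exp (z : 𝔸) ∈ S → z = 0 := by
  by_contra hcon
  rw [Filter.not_eventually] at hcon
  have : (𝓝 (0 : C) ⊓ 𝓟 {z : C | ¬(exp (z : 𝔸) ∈ S → z = 0)}).NeBot :=
    frequently_iff_neBot.1 hcon
  obtain ⟨l, hl⟩ := Ultrafilter.exists_le (𝓝 (0 : C) ⊓ 𝓟 {z : C | ¬(exp (z : 𝔸) ∈ S → z = 0)})
  have hl0 : Tendsto (fun z : C => (z : 𝔸)) l (𝓝 0) := by
    have : Tendsto (fun z : C => (z : 𝔸)) (𝓝 0) (𝓝 0) := by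
      simpa using (continuous_subtype_val (p := fun x : 𝔸 => x ∈ C)).tendsto 0
    exact this.mono_left (hl.trans inf_le_left)
  have hlm : ∀ᶠ z : C in l, exp (z : 𝔸) ∈ S ∧ z ≠ 0 := by
    have : {z : C | ¬(exp (z : 𝔸) ∈ S → z = 0)} ∈ (l : Filter C) :=
      hl (mem_inf_of_right (mem_principal_self _))
    filter_upwards [this] with z hz
    simpa using hz
  have hsph : ∀ᶠ z : C in l, ‖z‖⁻¹ • z ∈ Metric.sphere (0 : C) 1 := by
    filter_upwards [hlm] with z hz
    simp [norm_smul, hz.2]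
  obtain ⟨B, hB, hlB⟩ := (isCompact_sphere (0 : C) 1).ultrafilter_le_nhds
    (l.map fun z => ‖z‖⁻¹ • z) (le_principal_iff.2 hsph)
  have hlB' : Tendsto (fun z : C => ‖z‖⁻¹ • (z : 𝔸)) l (𝓝 (B : 𝔸)) :=
    ((continuous_subtype_val (p := fun x : 𝔸 => x ∈ C)).tendsto B).comp hlB
  have hmem : (B : 𝔸) ∈ expLie S hc hS := fun t => by
    refine exp_mem_of_tendsto hc hS (r := fun z : C => t * ‖z‖⁻¹) hl0 (hlm.mono fun z h => h.1) ?_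
    simpa [mul_smul] using hlB'.const_smul t
  have : (B : 𝔸) = 0 := Submodule.disjoint_def.1 hC _ hmem B.2
  have hB0 : B = 0 := Subtype.ext this
  simp [hB0] at hB

/-- If the Lie algebra of a closed group is spanned by two subspaces `𝔥₁`, `𝔥₂`, then every element
of the group close to `1` is of the form `exp Y₁ exp Y₂` with `Yᵢ ∈ 𝔥ᵢ` small. -/
theorem eventually_mem_imp_exists_exp_mul_exp {S : Submonoid 𝔸} (hc : IsClosed (S : Set 𝔸))
    (hS : S.InverseClosed) {𝔥₁ 𝔥₂ : Submodule ℝ 𝔸} (hsup : 𝔥₁ ⊔ 𝔥₂ = expLie S hc hS)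
    {p : 𝔥₁ → Prop} (hp : ∀ᶠ y in 𝓝 0, p y) :
    ∀ᶠ h in 𝓝 (1 : 𝔸), h ∈ S → ∃ y₁ : 𝔥₁, p y₁ ∧ ∃ y₂ : 𝔥₂, h = exp (y₁ : 𝔸) * exp (y₂ : 𝔸) := by
  -- A third factor from a complement `C` makes the product of exponentials a submersion at `0`, so
  -- that its values fill a neighbourhood of `1`.
  obtain ⟨C, hC⟩ := Submodule.exists_isCompl (expLie S hc hS)
  let f : 𝔥₁ × 𝔥₂ × C → 𝔸 := fun x => exp (x.1 : 𝔸) * exp (x.2.1 : 𝔸) * exp (x.2.2 : 𝔸)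
  let i₁ : (𝔥₁ × 𝔥₂ × C) →L[ℝ] 𝔸 := 𝔥₁.subtypeL ∘L ContinuousLinearMap.fst ℝ _ _
  let i₂ : (𝔥₁ × 𝔥₂ × C) →L[ℝ] 𝔸 :=
    𝔥₂.subtypeL ∘L ContinuousLinearMap.fst ℝ _ _ ∘L ContinuousLinearMap.snd ℝ _ _
  let i₃ : (𝔥₁ × 𝔥₂ × C) →L[ℝ] 𝔸 :=
    C.subtypeL ∘L ContinuousLinearMap.snd ℝ _ _ ∘L ContinuousLinearMap.snd ℝ _ _
  have he (i : (𝔥₁ × 𝔥₂ × C) →L[ℝ] 𝔸) : HasStrictFDerivAt (fun x => exp (i x)) i 0 := by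
    have h : HasStrictFDerivAt (exp : 𝔸 → 𝔸) (1 : 𝔸 →L[ℝ] 𝔸) (i 0) := by
      rw [map_zero]; exact hasStrictFDerivAt_exp_zero
    simpa using! h.comp 0 i.hasStrictFDerivAt
  have hf : HasStrictFDerivAt f (i₁ + i₂ + i₃) 0 := by
    have h := ((he i₁).mul' (he i₂)).mul' (he i₃)
    refine h.congr_fderiv ?_
    ext x <;> simp [exp_zero] <;> abel
  have hsurj : (i₁ + i₂ + i₃ : (𝔥₁ × 𝔥₂ × C) →L[ℝ] 𝔸).range = ⊤ := by
    rw [LinearMap.range_eq_top]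
    intro a
    have ha : a ∈ (𝔥₁ ⊔ 𝔥₂) ⊔ C := by rw [hsup, hC.sup_eq_top]; trivial
    obtain ⟨b, hb, z, hz, rfl⟩ := Submodule.mem_sup.1 ha
    obtain ⟨y, hy, y', hy', rfl⟩ := Submodule.mem_sup.1 hb
    exact ⟨(⟨y, hy⟩, ⟨y', hy'⟩, ⟨z, hz⟩), rfl⟩
  have hf0 : f 0 = 1 := by simp [f, exp_zero]
  have hmap := hf.map_nhds_eq_of_surj hsurj
  rw [hf0] at hmap
  rw [← hmap, eventually_map]
  have t1 : Tendsto (fun x : 𝔥₁ × 𝔥₂ × C => x.1) (𝓝 0) (𝓝 0) := continuous_fst.tendsto 0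
  have t3 : Tendsto (fun x : 𝔥₁ × 𝔥₂ × C => x.2.2) (𝓝 0) (𝓝 0) :=
    (continuous_snd.comp continuous_snd).tendsto 0
  filter_upwards [t1.eventually hp,
    t3.eventually (eventually_exp_mem_imp_eq_zero hc hS hC.disjoint)] with x hx1 hx3 hxS
  have hy {y : 𝔸} (hy : y ∈ expLie S hc hS) : exp (-y) ∈ S := by simpa using hy (-1)
  have h1 := hy (hsup ▸ Submodule.mem_sup_left x.1.2)
  have h2 := hy (hsup ▸ Submodule.mem_sup_right x.2.1.2)
  -- If the product lies in `S`, so does its factor from `C`, which must then be trivial.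
  have h3 : exp (x.2.2 : 𝔸) = exp (-(x.2.1 : 𝔸)) * (exp (-(x.1 : 𝔸)) * f x) := by
    rw [← mul_assoc (exp (-(x.1 : 𝔸))), ← mul_assoc (exp (-(x.1 : 𝔸))), exp_neg_mul_exp, one_mul,
      ← mul_assoc, exp_neg_mul_exp, one_mul]
  have h4 := hx3 (h3 ▸ S.mul_mem h2 (S.mul_mem h1 hxS))
  exact ⟨x.1, hx1, x.2.1, by simp [f, h4, exp_zero]⟩

end ClosedSubgroup

/-! ### Unitary transformations of complex projective space -/

section Unitary

open Filter Topology

namespace CPn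

variable {n : ℕ}

local notation "𝓥" => EuclideanSpace ℂ (Fin (n + 1))
local notation "𝓤" => EuclideanSpace ℂ (Fin n)

theorem frame_spec (p : CPn n) : act (frame p) (proj ⟨cone 0, cone_ne_zero 0⟩) = p :=
  (exists_frame p).choose_spec.symm

theorem frameChart_proj (U : 𝓥 ≃ₗᵢ[ℂ] 𝓥) (v : {v : 𝓥 // v ≠ 0}) :
    frameChart U (proj v) = affine (U.symm v.1) := rfl

theorem proj_mem_frameChart_source (U : 𝓥 ≃ₗᵢ[ℂ] 𝓥) (v : {v : 𝓥 // v ≠ 0}) :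
    proj v ∈ (frameChart U).source ↔ U.symm v.1 0 ≠ 0 := by
  rw [frameChart, OpenPartialHomeomorph.trans_source]
  refine (and_iff_right (Set.mem_univ _)).trans ?_
  exact mem_proj_image (v := ⟨U.symm v.1, by simpa using v.2⟩)

theorem frameChart_target (U : 𝓥 ≃ₗᵢ[ℂ] 𝓥) : (frameChart U).target = Set.univ := by
  rw [frameChart, OpenPartialHomeomorph.trans_target]
  exact Set.eq_univ_of_forall fun u => ⟨Set.mem_univ _, Set.mem_univ _⟩

theorem frameChart_mem_maximalAtlas (U : 𝓥 ≃ₗᵢ[ℂ] 𝓥) :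
    frameChart U ∈ IsManifold.maximalAtlas 𝓘(ℝ, 𝓤) ∞ (CPn n) :=
  IsManifold.subset_maximalAtlas ⟨U, rfl⟩

theorem act_mul (U W : 𝓥 ≃ₗᵢ[ℂ] 𝓥) (p : CPn n) : act (U * W) p = act U (act W p) := by
  obtain ⟨v, rfl⟩ := proj_surjective p
  rfl

theorem act_one (p : CPn n) : act 1 p = p := by
  obtain ⟨v, rfl⟩ := proj_surjective p
  rfl

/-- In the charts of the frames `F` and `U * F` the action of `U` is the identity map; smoothness of
the action follows. -/
theorem act_eq_frameChart_symm (U F : 𝓥 ≃ₗᵢ[ℂ] 𝓥) {q : CPn n} (hq : q ∈ (frameChart F).source) :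
    act U q = (frameChart (U * F)).symm (frameChart F q) := by
  conv_lhs => rw [← (frameChart F).left_inv hq]
  rfl

theorem contMDiff_act (U : 𝓥 ≃ₗᵢ[ℂ] 𝓥) : ContMDiff 𝓘(ℝ, 𝓤) 𝓘(ℝ, 𝓤) ∞ (act U) := by
  intro p
  have hp : p ∈ (frameChart (frame p)).source := mem_chart_source 𝓤 p
  have h1 := contMDiffAt_of_mem_maximalAtlas (frameChart_mem_maximalAtlas (frame p)) hp
  have h2 := contMDiffAt_symm_of_mem_maximalAtlas (frameChart_mem_maximalAtlas (U * frame p))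
    (x := frameChart (frame p) p) (by rw [frameChart_target]; trivial)
  refine (h2.comp p h1).congr_of_eventuallyEq ?_
  filter_upwards [(frameChart (frame p)).open_source.mem_nhds hp] with q hq
  exact act_eq_frameChart_symm U _ hq

/-- The diffeomorphism of `ℂPⁿ` given by a unitary transformation. -/
noncomputable def actDiffeo (U : 𝓥 ≃ₗᵢ[ℂ] 𝓥) : Diffeomorph 𝓘(ℝ, 𝓤) 𝓘(ℝ, 𝓤) (CPn n) (CPn n) ∞ where
  toEquiv := (actHomeo U).toEquiv
  contMDiff_toFun := contMDiff_act U
  contMDiff_invFun := contMDiff_act U.symm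

/-- The last `n` coordinates. -/
noncomputable def tail : 𝓥 →L[ℂ] 𝓤 :=
  LinearMap.toContinuousLinearMap
    { toFun := fun w => WithLp.toLp 2 fun j => w j.succ
      map_add' := fun _ _ => rfl
      map_smul' := fun _ _ => rfl }

theorem tail_apply (w : 𝓥) (j : Fin n) : tail w j = w j.succ := rfl

/-- The inclusion `u ↦ (0, u)`. -/
noncomputable def zeroCons : 𝓤 →L[ℂ] 𝓥 :=
  LinearMap.toContinuousLinearMap
    { toFun := fun u => WithLp.toLp 2 (Fin.cons 0 u)
      map_add' := fun u v => by ext j; refine Fin.cases ?_ (fun i => ?_) j <;> simp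
      map_smul' := fun c u => by ext j; refine Fin.cases ?_ (fun i => ?_) j <;> simp }

@[simp] theorem zeroCons_zero (u : 𝓤) : zeroCons u 0 = 0 := rfl
@[simp] theorem zeroCons_succ (u : 𝓤) (j : Fin n) : zeroCons u j.succ = u j := rfl

theorem tail_zeroCons (u : 𝓤) : tail (zeroCons u) = u := rfl

theorem zeroCons_tail {w : 𝓥} (hw : w 0 = 0) : zeroCons (tail w) = w := by
  ext j; refine Fin.cases ?_ (fun i => ?_) j <;> simp [hw, tail_apply]

theorem cone_eq_add (u : 𝓤) : cone u = cone 0 + zeroCons u := by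
  ext j; refine Fin.cases ?_ (fun i => ?_) j <;> simp [cone_zero, cone_succ]

theorem affine_eq (w : 𝓥) : affine w = (w 0)⁻¹ • tail w := by
  ext j; simp [affine, tail_apply, div_eq_inv_mul]

theorem norm_zeroCons (u : 𝓤) : ‖zeroCons u‖ = ‖u‖ := by
  simp [EuclideanSpace.norm_eq, Fin.sum_univ_succ]

theorem cone_zero_eq_single : (cone 0 : 𝓥) = EuclideanSpace.single 0 1 := by
  ext j
  refine Fin.cases ?_ (fun i => ?_) j <;> simp [cone_zero, cone_succ]

theorem norm_cone_zero : ‖(cone 0 : 𝓥)‖ = 1 := by simp [cone_zero_eq_single]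

theorem inner_cone_zero (w : 𝓥) : inner ℂ (cone 0 : 𝓥) w = w 0 := by
  simp [cone_zero_eq_single, EuclideanSpace.inner_single_left]

theorem tail_cone_zero : tail (cone 0 : 𝓥) = 0 := by
  ext j; simp [tail_apply, cone_succ]

/-- A unitary transformation fixing the line of `e₀` preserves its orthogonal complement. -/
theorem unitary_zeroCons_zero {W : 𝓥 ≃ₗᵢ[ℂ] 𝓥} {c : ℂ} (hW : W (cone 0) = c • cone 0)
    (u : 𝓤) : W (zeroCons u) 0 = 0 := by
  have hc : c ≠ 0 := by
    rintro rfl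
    exact cone_ne_zero (0 : 𝓤) (by simpa using hW)
  have h : inner ℂ (W (cone 0)) (W (zeroCons u)) = 0 := by
    rw [W.inner_map_map, inner_cone_zero, zeroCons_zero]
  rw [hW, inner_smul_left, inner_cone_zero] at h
  exact (mul_eq_zero.1 h).resolve_left (by simpa using hc)

/-- The zeroth coordinate of `W (cone u)` is the constant `c`, so in the affine chart `W` acts
linearly. -/
theorem affine_unitary_cone {W : 𝓥 ≃ₗᵢ[ℂ] 𝓥} {c : ℂ} (hW : W (cone 0) = c • cone 0)
    (u : 𝓤) : affine (W (cone u)) = c⁻¹ • tail (W (zeroCons u)) := by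
  rw [affine_eq, cone_eq_add, map_add, hW, PiLp.add_apply, unitary_zeroCons_zero hW]
  simp [tail_cone_zero, cone_zero]

theorem exists_frame_symm_act (U : 𝓥 ≃ₗᵢ[ℂ] 𝓥) (p : CPn n) :
    ∃ c : ℂ, ‖c‖ = 1 ∧ (frame (act U p)).symm (U (frame p (cone 0))) = c • cone 0 := by
  have h : act ((frame (act U p)).symm * U * frame p) (proj ⟨cone 0, cone_ne_zero 0⟩) =
      proj ⟨cone 0, cone_ne_zero 0⟩ := by
    rw [act_mul, act_mul, frame_spec]
    conv_lhs => arg 2; rw [← frame_spec (act U p)]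
    exact act_symm_act _ _
  obtain ⟨c, hc⟩ := (proj_eq_iff
    (v := ⟨(frame (act U p)).symm (U (frame p (cone 0))), by simpa using cone_ne_zero (0 : 𝓤)⟩)
    (w := ⟨cone 0, cone_ne_zero 0⟩)).1 h
  refine ⟨c, ?_, hc.symm⟩
  have := congrArg norm hc
  simpa [norm_smul, norm_cone_zero] using this

/-- In the preferred charts at `p` and `act U p` the action is linear, hence equal to its
derivative. The factor `c⁻¹` reflects the identification of tangent vectors with homomorphisms from
the line to its orthogonal complement; it is the source of the sign `-1` in the final argument. -/
theorem mfderiv_act (U : 𝓥 ≃ₗᵢ[ℂ] 𝓥) (p : CPn n) {c : ℂ}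
    (hc : (frame (act U p)).symm (U (frame p (cone 0))) = c • cone 0) (ξ : 𝓤) :
    (mfderiv 𝓘(ℝ, 𝓤) 𝓘(ℝ, 𝓤) (act U) p ξ : 𝓤) =
      c⁻¹ • tail ((frame (act U p)).symm (U (frame p (zeroCons ξ)))) := by
  let W : 𝓥 ≃ₗᵢ[ℂ] 𝓥 := (frame (act U p)).symm * U * frame p
  let L : 𝓤 →L[ℝ] 𝓤 :=
    (c⁻¹ • tail ∘L W.toContinuousLinearEquiv.toContinuousLinearMap ∘L zeroCons).restrictScalars ℝ
  have hL : HasMFDerivAt 𝓘(ℝ, 𝓤) 𝓘(ℝ, 𝓤) (act U) p L := by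
    refine ⟨(continuous_act U).continuousAt, ?_⟩
    have : writtenInExtChartAt 𝓘(ℝ, 𝓤) 𝓘(ℝ, 𝓤) p (act U) = L := by
      funext u
      exact affine_unitary_cone (W := W) hc u
    rw [this]
    exact L.hasFDerivWithinAt
  rw [hL.mfderiv]
  rfl

/-- In the preferred charts the differential is a unit scalar times a unitary map of the complement
of `e₀`, and the metric at each base point is the Euclidean one. -/
theorem isRiemannianIsometry_actDiffeo (U : 𝓥 ≃ₗᵢ[ℂ] 𝓥) :
    IsRiemannianIsometry (fubiniStudy n) (actDiffeo U) := by
  intro p ξ η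
  obtain ⟨c, hc1, hc⟩ := exists_frame_symm_act U p
  let W : 𝓥 ≃ₗᵢ[ℂ] 𝓥 := (frame (act U p)).symm * U * frame p
  let L : 𝓤 →ₗᵢ[ℝ] 𝓤 :=
    { toLinearMap := ((c⁻¹ • tail ∘L W.toContinuousLinearEquiv.toContinuousLinearMap ∘L
        zeroCons).restrictScalars ℝ).toLinearMap
      norm_map' := fun u => by
        change ‖c⁻¹ • tail (W (zeroCons u))‖ = ‖u‖
        rw [norm_smul, norm_inv, hc1, inv_one, one_mul, ← norm_zeroCons,
          zeroCons_tail (unitary_zeroCons_zero hc u), W.norm_map, norm_zeroCons] }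
  have key := L.inner_map_map ξ η
  have h1 := mfderiv_act U p hc ξ
  have h2 := mfderiv_act U p hc η
  change inner (E := 𝓤) ℝ (mfderiv 𝓘(ℝ, 𝓤) 𝓘(ℝ, 𝓤) (act U) p ξ : 𝓤)
    (mfderiv 𝓘(ℝ, 𝓤) 𝓘(ℝ, 𝓤) (act U) p η : 𝓤) = _
  rw [h1, h2]
  exact key

/-- The velocity of the orbit of a curve of unitary transformations. -/
theorem tail_mem_tangentVectors {S : Set (CPn n)} {p : CPn n} {U : ℝ → 𝓥 ≃ₗᵢ[ℂ] 𝓥} {w : 𝓥}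
    (h0 : U 0 = 1) (hS : ∀ᶠ t in 𝓝 0, act (U t) p ∈ S)
    (hw : HasDerivAt (fun t => U t (frame p (cone 0))) w 0) :
    (tail ((frame p).symm w) : 𝓤) ∈ tangentVectors S p := by
  have hγ0 : act (U 0) p = p := by rw [h0, act_one]
  suffices h : HasMFDerivAt 𝓘(ℝ, ℝ) 𝓘(ℝ, 𝓤) (fun t => act (U t) p) 0
      (ContinuousLinearMap.toSpanSingleton ℝ (tail ((frame p).symm w) : 𝓤)) by
    refine ⟨fun t => act (U t) p, hγ0, hS, h.mdifferentiableAt, ?_⟩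
    rw [h.mfderiv]
    exact one_smul ℝ _
  have hproj (t : ℝ) : act (U t) p = proj ⟨U t (frame p (cone 0)),
      by simpa using cone_ne_zero (0 : 𝓤)⟩ := by
    conv_lhs => rw [← frame_spec p]
    rfl
  refine ⟨?_, ?_⟩
  · simp only [hproj]
    refine isQuotientMap_proj.continuous.continuousAt.comp ?_
    exact Topology.IsInducing.subtypeVal.continuousAt_iff.2 hw.continuousAt
  · have hwr : writtenInExtChartAt 𝓘(ℝ, ℝ) 𝓘(ℝ, 𝓤) 0
        (fun t => act (U t) p) = fun t => affine ((frame p).symm (U t (frame p (cone 0)))) := by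
      funext t
      change frameChart (frame (act (U 0) p)) (act (U t) p) = _
      rw [hγ0, hproj]
      rfl
    rw [hwr]
    have hx : extChartAt 𝓘(ℝ, ℝ) (0 : ℝ) 0 = 0 := rfl
    rw [hx]
    have hF : HasDerivAt (fun t => (frame p).symm (U t (frame p (cone 0)))) ((frame p).symm w) 0 :=
      (((frame p).symm.toContinuousLinearEquiv.toContinuousLinearMap.restrictScalars
        ℝ).hasFDerivAt.comp_hasDerivAt 0 hw)
    have hF0 : (frame p).symm (U 0 (frame p (cone 0))) = cone 0 := by simp [h0]
    have hz : HasDerivAt (fun t => (frame p).symm (U t (frame p (cone 0))) 0)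
        ((frame p).symm w 0) 0 :=
      ((EuclideanSpace.proj (0 : Fin (n + 1)) : 𝓥 →L[ℂ] ℂ).restrictScalars
        ℝ).hasFDerivAt.comp_hasDerivAt 0 hF
    have ht : HasDerivAt (fun t => tail ((frame p).symm (U t (frame p (cone 0)))))
        (tail ((frame p).symm w)) 0 :=
      ((tail (n := n)).restrictScalars ℝ).hasFDerivAt.comp_hasDerivAt 0 hF
    -- At `t = 0` the tail vanishes and the zeroth coordinate is `1`, so only the derivative of the
    -- tail survives in the quotient rule.
    have h := (hz.fun_inv (by rw [hF0, cone_zero]; exact one_ne_zero)).smul ht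
    rw [hF0, tail_cone_zero, smul_zero, add_zero, cone_zero, inv_one, one_smul] at h
    simp only [affine_eq]
    exact h.hasFDerivAt.hasFDerivWithinAt

end CPn

end Unitary

/-! ### Orbits of compact groups of unitary transformations in `ℂPⁿ` -/

section Orbit

open Filter Topology NormedSpace

theorem exp_apply_of_eigenvector {W : Type*} [NormedAddCommGroup W] [NormedSpace ℂ W]
    [CompleteSpace W] {A : W →L[ℂ] W} {v : W} {μ : ℂ} (h : A v = μ • v) :
    exp A v = exp μ • v := by
  have hpow (k : ℕ) : (A ^ k) v = μ ^ k • v := by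
    induction k with
    | zero => simp
    | succ k ih => rw [pow_succ', mul_apply_eq_comp, ih, map_smul, h, smul_smul, pow_succ]
  have h1 := (exp_series_hasSum_exp' (𝕂 := ℂ) A).mapL (ContinuousLinearMap.apply ℂ W v)
  have h2 := (exp_series_hasSum_exp' (𝕂 := ℂ) μ).smul_const v
  refine h1.unique (h2.congr_fun fun k => ?_)
  simp [hpow, mul_smul]

namespace CPn

variable {n : ℕ}

local notation "𝓥" => EuclideanSpace ℂ (Fin (n + 1))
local notation "𝓤" => EuclideanSpace ℂ (Fin n)

/-- A unitary transformation as an element of the algebra of endomorphisms. -/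
noncomputable def clm : (𝓥 ≃ₗᵢ[ℂ] 𝓥) →* (𝓥 →L[ℂ] 𝓥) where
  toFun U := U.toContinuousLinearEquiv.toContinuousLinearMap
  map_one' := rfl
  map_mul' _ _ := rfl

theorem clm_apply (U : 𝓥 ≃ₗᵢ[ℂ] 𝓥) (v : 𝓥) : clm U v = U v := rfl

/-- The absolute value of the cosine of the angle between a line and a unit vector `v₀`. -/
noncomputable def absCos (v₀ : 𝓥) (q : CPn n) : ℝ :=
  Projectivization.lift (fun v => ‖inner ℂ v₀ v.1‖ / ‖v.1‖) (by
    rintro a b t h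
    have ht : t ≠ 0 := by rintro rfl; exact a.2 (by simpa using h)
    rw [h, inner_smul_right, norm_smul, norm_mul, mul_div_mul_left _ _ (by simpa using ht)]) q

theorem absCos_proj (v₀ : 𝓥) (v : {v : 𝓥 // v ≠ 0}) :
    absCos v₀ (proj v) = ‖inner ℂ v₀ v.1‖ / ‖v.1‖ := rfl

theorem continuous_absCos (v₀ : 𝓥) : Continuous (absCos v₀) := by
  rw [isQuotientMap_proj.continuous_iff]
  change Continuous fun v : {v : 𝓥 // v ≠ 0} => ‖inner ℂ v₀ v.1‖ / ‖v.1‖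
  refine Continuous.div ?_ (by fun_prop) fun v => by simpa using v.2
  exact (continuous_const.inner continuous_subtype_val).norm

theorem norm_frame_cone (p : CPn n) : ‖frame p (cone 0)‖ = 1 := by
  rw [LinearIsometryEquiv.norm_map, norm_cone_zero]

theorem frame_cone_ne_zero (p : CPn n) : frame p (cone 0) ≠ 0 := by
  simpa using cone_ne_zero (0 : 𝓤)

theorem act_eq_proj (U : 𝓥 ≃ₗᵢ[ℂ] 𝓥) (p : CPn n) :
    act U p = proj ⟨U (frame p (cone 0)), by simpa using frame_cone_ne_zero p⟩ := by
  conv_lhs => rw [← frame_spec p]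
  rfl

theorem absCos_act (U : 𝓥 ≃ₗᵢ[ℂ] 𝓥) (p : CPn n) :
    absCos (frame p (cone 0)) (act U p) =
      ‖inner ℂ (frame p (cone 0)) (clm U (frame p (cone 0)))‖ := by
  rw [act_eq_proj, absCos_proj, clm_apply, LinearIsometryEquiv.norm_map, norm_frame_cone, div_one]

/-- This is the equality case of the Cauchy–Schwarz inequality. -/
theorem act_eq_self_of_norm_inner {U : 𝓥 ≃ₗᵢ[ℂ] 𝓥} {p : CPn n}
    (h : ‖inner ℂ (frame p (cone 0)) (clm U (frame p (cone 0)))‖ = 1) : act U p = p := by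
  have h0 := frame_cone_ne_zero p
  have h1 : ‖inner ℂ (frame p (cone 0)) (U (frame p (cone 0)))‖ =
      ‖frame p (cone 0)‖ * ‖U (frame p (cone 0))‖ := by
    rw [LinearIsometryEquiv.norm_map U, norm_frame_cone, one_mul]; exact h
  obtain ⟨r, -, hr⟩ := (norm_inner_eq_norm_iff h0 (by simpa using h0)).1 h1
  rw [act_eq_proj]
  conv_rhs => rw [← frame_spec p]
  exact (proj_eq_iff (v := ⟨U (frame p (cone 0)), by simpa using h0⟩)
    (w := ⟨frame p (cone 0), h0⟩)).2 ⟨r, hr.symm⟩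

/-- Points of the orbit of `p` close to `p` are images of `p` by group elements close to `1`. -/
theorem exists_open_of_compact {H : Subgroup (𝓥 ≃ₗᵢ[ℂ] 𝓥)}
    (hH : IsCompact (clm '' (H : Set (𝓥 ≃ₗᵢ[ℂ] 𝓥)))) (p : CPn n) {N : Set (𝓥 →L[ℂ] 𝓥)}
    (hN : N ∈ 𝓝 1) :
    ∃ O ∈ 𝓝 p, ∀ U ∈ H, act U p ∈ O → ∃ U' ∈ H, clm U' ∈ N ∧ act U' p = act U p := by
  obtain ⟨N', hN'N, hN'o, hN'1⟩ := mem_nhds_iff.1 hN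
  set v₀ := frame p (cone 0) with hv₀
  -- `C` is the compact set of group elements that cannot be brought into `N'` by right
  -- multiplication with the stabilizer of `p`.
  let C : Set (𝓥 →L[ℂ] 𝓥) := clm '' (H : Set (𝓥 ≃ₗᵢ[ℂ] 𝓥)) ∩
    ⋂ W : {W : 𝓥 ≃ₗᵢ[ℂ] 𝓥 // W ∈ H ∧ act W p = p}, {A | A * clm W.1 ∉ N'}
  have hC : IsCompact C := hH.inter_right <| isClosed_iInter fun W =>
    (hN'o.preimage (continuous_id.mul continuous_const)).isClosed_compl
  let f : (𝓥 →L[ℂ] 𝓥) → ℝ := fun A => ‖inner ℂ v₀ (A v₀)‖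
  have hf : Continuous f :=
    (continuous_const.inner (ContinuousLinearMap.apply ℂ 𝓥 v₀).continuous).norm
  have hclosed : IsClosed (f '' C) := (hC.image hf).isClosed
  -- The value `1` is attained only on the stabilizer of `p`, and a stabilizer element is moved to
  -- `1 ∈ N'` by its inverse. Hence the points whose `absCos` avoids the closed set `f '' C` form a
  -- neighbourhood of `p`.
  have h1 : (1 : ℝ) ∉ f '' C := by
    rintro ⟨_, ⟨⟨U, hU, rfl⟩, hUW⟩, h⟩
    have hp := act_eq_self_of_norm_inner h
    have hinv : act U⁻¹ p = p := by
      conv_lhs => rw [← hp]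
      rw [← act_mul, inv_mul_cancel, act_one]
    have := Set.mem_iInter.1 hUW ⟨U⁻¹, H.inv_mem hU, hinv⟩
    rw [Set.mem_ofPred_eq, ← map_mul, mul_inv_cancel, map_one] at this
    exact this hN'1
  have hp1 : absCos v₀ p = 1 := by
    have := absCos_act 1 p
    rw [act_one, map_one] at this
    have hv1 : ‖v₀‖ = 1 := norm_frame_cone p
    simpa [← hv₀, hv1] using this
  refine ⟨absCos v₀ ⁻¹' (f '' C)ᶜ, (continuous_absCos v₀).continuousAt.preimage_mem_nhds
    (hclosed.isOpen_compl.mem_nhds (by rwa [hp1])), fun U hU hUO => ?_⟩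
  have hUC : clm U ∉ C := fun hc => hUO ⟨clm U, hc, (absCos_act U p).symm⟩
  have : ∃ W : {W : 𝓥 ≃ₗᵢ[ℂ] 𝓥 // W ∈ H ∧ act W p = p}, clm U * clm W.1 ∈ N' := by
    by_contra! hcon
    exact hUC ⟨⟨U, hU, rfl⟩, Set.mem_iInter.2 hcon⟩
  obtain ⟨⟨W, hW, hWp⟩, hUW⟩ := this
  exact ⟨U * W, H.mul_mem hU hW, hN'N (by rwa [map_mul]), by rw [act_mul, hWp]⟩

/-- A chart of `ℂPⁿ` moved by a unitary transformation. -/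
theorem actHomeo_trans_mem_maximalAtlas (U : 𝓥 ≃ₗᵢ[ℂ] 𝓥)
    {φ : OpenPartialHomeomorph (CPn n) 𝓤} (hφ : φ ∈ IsManifold.maximalAtlas 𝓘(ℝ, 𝓤) ∞ (CPn n)) :
    (actHomeo U).toOpenPartialHomeomorph ≫ₕ φ ∈ IsManifold.maximalAtlas 𝓘(ℝ, 𝓤) ∞ (CPn n) := by
  rw [IsManifold.mem_maximalAtlas_iff_contMDiffOn] at hφ ⊢
  refine ⟨hφ.1.comp (contMDiff_act U).contMDiffOn fun q hq => hq.2, ?_⟩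
  exact (contMDiff_act U.symm).comp_contMDiffOn (hφ.2.mono fun q hq => hq.1)

/-- The data of a local section: a linear map `σ` inverting `τ` on the image of `𝔥`. -/
theorem exists_section {A W : Type*} [AddCommGroup A] [Module ℝ A] [AddCommGroup W] [Module ℝ W]
    (𝔥 : Submodule ℝ A) (τ : A →ₗ[ℝ] W) :
    ∃ (σ : W →ₗ[ℝ] A) (π : W →ₗ[ℝ] W), (∀ x, σ x ∈ 𝔥) ∧ (∀ x, τ (σ x) = π x) ∧
      (∀ x, σ (π x) = σ x) ∧ (∀ x, x ∈ 𝔥.map τ → π x = x) ∧ ∀ x, π x ∈ 𝔥.map τ := by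
  obtain ⟨N, hN⟩ := Submodule.exists_isCompl (𝔥.map τ)
  have hm : ∀ a ∈ 𝔥, τ a ∈ 𝔥.map τ := fun a ha => Submodule.mem_map_of_mem ha
  have hsurj : Function.Surjective (τ.restrict hm) := by
    rintro ⟨_, a, ha, rfl⟩
    exact ⟨⟨a, ha⟩, rfl⟩
  obtain ⟨s, hs⟩ := (τ.restrict hm).exists_rightInverse_of_surjective (LinearMap.range_eq_top.2 hsurj)
  let P := Submodule.projectionOnto (𝔥.map τ) N hN
  have hP (x : W) (hx : x ∈ 𝔥.map τ) : P x = ⟨x, hx⟩ :=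
    Submodule.projectionOnto_apply_left hN ⟨x, hx⟩
  refine ⟨𝔥.subtype ∘ₗ s ∘ₗ P, (𝔥.map τ).subtype ∘ₗ P, fun x => (s (P x)).2, fun x => ?_,
    fun x => ?_, fun x hx => ?_, fun x => (P x).2⟩
  · exact congrArg Subtype.val (LinearMap.congr_fun hs (P x))
  · change ((s (P (P x : W)) : 𝔥) : A) = s (P x)
    rw [hP _ (P x).2]
  · change ((P x : 𝔥.map τ) : W) = x
    rw [hP x hx]

end CPn

end Orbit

/-! ### The parametrization underlying the slice charts -/

section Slice

open Filter Topology NormedSpace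

namespace CPn

variable {n : ℕ}

local notation "𝓥" => EuclideanSpace ℂ (Fin (n + 1))
local notation "𝓤" => EuclideanSpace ℂ (Fin n)

/-- The lift to `ℂⁿ⁺¹` of the map `x ↦ exp(σ x) [1 : x - π x]` in the unitary frame `F`. -/
noncomputable def sliceLift (F : 𝓥 ≃ₗᵢ[ℂ] 𝓥) (σ : 𝓤 →L[ℝ] (𝓥 →L[ℂ] 𝓥)) (π : 𝓤 →L[ℝ] 𝓤) (x : 𝓤) :
    𝓥 :=
  F.symm (exp (σ x) (F (cone (x - π x))))

theorem sliceLift_zero (F : 𝓥 ≃ₗᵢ[ℂ] 𝓥) (σ : 𝓤 →L[ℝ] (𝓥 →L[ℂ] 𝓥)) (π : 𝓤 →L[ℝ] 𝓤) :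
    sliceLift F σ π 0 = cone 0 := by
  simp [sliceLift, exp_zero]

theorem contDiff_sliceLift (F : 𝓥 ≃ₗᵢ[ℂ] 𝓥) (σ : 𝓤 →L[ℝ] (𝓥 →L[ℂ] 𝓥)) (π : 𝓤 →L[ℝ] 𝓤) :
    ContDiff ℝ ω (sliceLift F σ π) := by
  have hF (F : 𝓥 ≃ₗᵢ[ℂ] 𝓥) : ContDiff ℝ ω F :=
    (F.toContinuousLinearEquiv.toContinuousLinearMap.restrictScalars ℝ).contDiff
  have he : ContDiff ℝ ω fun x => exp (σ x) := by
    have : ContDiff ℝ ω (exp : (𝓥 →L[ℂ] 𝓥) → (𝓥 →L[ℂ] 𝓥)) :=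
      contDiff_iff_contDiffAt.2 fun A => (exp_analytic (𝕂 := ℝ) A).contDiffAt
    exact this.comp σ.contDiff
  have hc : ContDiff ℝ ω fun x : 𝓤 => cone (x - π x) := by
    have : (fun x : 𝓤 => cone (x - π x)) = fun x => (cone 0 : 𝓥) + zeroCons (x - π x) :=
      funext fun x => cone_eq_add _
    rw [this]
    exact contDiff_const.add (((zeroCons (n := n)).restrictScalars ℝ).contDiff.comp
      (contDiff_id.sub π.contDiff))
  have hr : ContDiff ℝ ω fun x => (exp (σ x)).restrictScalars ℝ :=
    (ContinuousLinearMap.restrictScalarsL ℂ 𝓥 𝓥 ℝ ℝ).contDiff.comp he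
  exact (hF F.symm).comp (hr.clm_apply ((hF F).comp hc))

theorem hasDerivAt_sliceLift (F : 𝓥 ≃ₗᵢ[ℂ] 𝓥) (σ : 𝓤 →L[ℝ] (𝓥 →L[ℂ] 𝓥)) (π : 𝓤 →L[ℝ] 𝓤)
    (u : 𝓤) : HasDerivAt (fun t : ℝ => sliceLift F σ π (t • u))
      (F.symm (σ u (F (cone 0))) + zeroCons (u - π u)) 0 := by
  have hF (F : 𝓥 ≃ₗᵢ[ℂ] 𝓥) {f : ℝ → 𝓥} {w : 𝓥} (hf : HasDerivAt f w 0) :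
      HasDerivAt (fun t => F (f t)) (F w) 0 :=
    (F.toContinuousLinearEquiv.toContinuousLinearMap.restrictScalars
      ℝ).hasFDerivAt.comp_hasDerivAt 0 hf
  have h1 : HasDerivAt (fun t : ℝ => (exp (σ (t • u))).restrictScalars ℝ)
      ((σ u).restrictScalars ℝ) 0 := by
    have h := hasDerivAt_exp_smul_const (σ u) (0 : ℝ)
    rw [zero_smul, exp_zero, one_mul] at h
    simp only [map_smul]
    exact (ContinuousLinearMap.restrictScalarsL ℂ 𝓥 𝓥 ℝ ℝ).hasFDerivAt.comp_hasDerivAt 0 h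
  have h2 : HasDerivAt (fun t : ℝ => (cone (t • u - π (t • u)) : 𝓥)) (zeroCons (u - π u)) 0 := by
    have h3 : (fun t : ℝ => (cone (t • u - π (t • u)) : 𝓥)) =
        fun t => cone 0 + t • zeroCons (u - π u) := by
      funext t
      rw [cone_eq_add, map_smul, ← smul_sub]
      congr 1
      exact ((zeroCons (n := n)).restrictScalars ℝ).map_smul t _
    rw [h3]
    simpa using ((hasDerivAt_id (0 : ℝ)).smul_const (zeroCons (u - π u))).const_add (cone 0 : 𝓥)
  have h4 := hF F.symm (h1.clm_apply (hF F h2))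
  refine h4.congr_deriv ?_
  simp [exp_zero]

/-- Near `0`, the map `x ↦ exp(σ x) [1 : x - π x]` is the inverse of a chart, provided that
`x ↦ d/dt exp(t σ x) [1 : 0]` is the projection `π`. -/
theorem hasFDerivAt_affine_sliceLift (F : 𝓥 ≃ₗᵢ[ℂ] 𝓥) (σ : 𝓤 →L[ℝ] (𝓥 →L[ℂ] 𝓥)) (π : 𝓤 →L[ℝ] 𝓤)
    (h : ∀ x, tail (F.symm (σ x (F (cone 0)))) = π x) :
    HasFDerivAt (fun x => affine (sliceLift F σ π x))
      (ContinuousLinearEquiv.refl ℝ 𝓤 : 𝓤 →L[ℝ] 𝓤) 0 ∧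
    ∀ x, sliceLift F σ π x 0 ≠ 0 → ContDiffAt ℝ ω (fun x => affine (sliceLift F σ π x)) x := by
  have hsm : ∀ x, sliceLift F σ π x 0 ≠ 0 →
      ContDiffAt ℝ ω (fun x => affine (sliceLift F σ π x)) x := by
    intro x hx
    simp only [affine_eq]
    have h0 : ContDiffAt ℝ ω (fun x => sliceLift F σ π x 0) x :=
      (((EuclideanSpace.proj (0 : Fin (n + 1)) : 𝓥 →L[ℂ] ℂ).restrictScalars ℝ).contDiff.comp
        (contDiff_sliceLift F σ π)).contDiffAt
    have ht : ContDiffAt ℝ ω (fun x => tail (sliceLift F σ π x)) x :=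
      (((tail (n := n)).restrictScalars ℝ).contDiff.comp (contDiff_sliceLift F σ π)).contDiffAt
    exact (h0.inv hx).smul ht
  refine ⟨?_, hsm⟩
  have h0 : sliceLift F σ π 0 0 ≠ 0 := by simp [sliceLift_zero, cone_zero]
  have hd := ((hsm 0 h0).differentiableAt (by simp)).hasFDerivAt
  refine hd.congr_fderiv ?_
  ext1 u
  have hu : HasDerivAt (fun t : ℝ => affine (sliceLift F σ π (t • u)))
      (fderiv ℝ (fun x => affine (sliceLift F σ π x)) 0 u) 0 := by
    have h1 : HasDerivAt (fun t : ℝ => t • u) u 0 := by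
      simpa using (hasDerivAt_id (0 : ℝ)).smul_const u
    exact hd.comp_hasDerivAt_of_eq (0 : ℝ) h1 (zero_smul ℝ u).symm
  have hL := hasDerivAt_sliceLift F σ π u
  have hz : HasDerivAt (fun t : ℝ => sliceLift F σ π (t • u) 0) _ 0 :=
    ((EuclideanSpace.proj (0 : Fin (n + 1)) : 𝓥 →L[ℂ] ℂ).restrictScalars
      ℝ).hasFDerivAt.comp_hasDerivAt 0 hL
  have ht : HasDerivAt (fun t : ℝ => tail (sliceLift F σ π (t • u))) _ 0 :=
    ((tail (n := n)).restrictScalars ℝ).hasFDerivAt.comp_hasDerivAt 0 hL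
  -- The derivative is `π u` from the group direction plus `u - π u` from the transverse direction,
  -- together `u`; the term from the zeroth coordinate is multiplied by the tail of `cone 0`, which
  -- is `0`.
  have hI := (hz.fun_inv (by simpa using h0)).smul ht
  simp only [affine_eq] at hu ⊢
  refine hu.unique ?_
  refine hI.congr_deriv ?_
  simp [sliceLift_zero, tail_cone_zero, cone_zero, h, tail_zeroCons]

end CPn

end Slice

/-! ### Orbits of compact unitary groups are submanifolds -/

section Slice

open Filter Topology NormedSpace

namespace CPn

variable {n : ℕ}

local notation "𝓥" => EuclideanSpace ℂ (Fin (n + 1))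
local notation "𝓤" => EuclideanSpace ℂ (Fin n)

/-- The infinitesimal action of `A` at `p`, in the unitary frame at `p`. -/
noncomputable def infAct (p : CPn n) : (𝓥 →L[ℂ] 𝓥) →L[ℝ] 𝓤 :=
  LinearMap.toContinuousLinearMap
    { toFun := fun A => tail ((frame p).symm (A (frame p (cone 0))))
      map_add' := fun A B => by simp
      map_smul' := fun c A => by
        have := ((tail (n := n)).restrictScalars ℝ).map_smul c
          ((frame p).symm (A (frame p (cone 0))))
        have h2 := (((frame p).symm.toContinuousLinearEquiv.toContinuousLinearMap).restrictScalars
          ℝ).map_smul c (A (frame p (cone 0)))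
        exact (congrArg tail h2).trans this }

theorem infAct_apply (p : CPn n) (A : 𝓥 →L[ℂ] 𝓥) :
    infAct p A = tail ((frame p).symm (A (frame p (cone 0)))) := rfl

/-- Vanishing of the infinitesimal action makes the vector spanning `p` an eigenvector of `A`, hence
of `exp A`. The isotropy factor of a group element can thus be dropped. -/
theorem exp_apply_of_infAct_eq_zero {p : CPn n} {A : 𝓥 →L[ℂ] 𝓥} (h : infAct p A = 0) :
    ∃ c : ℂ, c ≠ 0 ∧ exp A (frame p (cone 0)) = c • frame p (cone 0) := by
  obtain ⟨w, hw⟩ := (frame p).surjective (A (frame p (cone 0)))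
  have hA : A (frame p (cone 0)) = w 0 • frame p (cone 0) := by
    rw [infAct_apply, ← hw, LinearIsometryEquiv.symm_apply_apply] at h
    rw [← hw, ← map_smul]
    congr 1
    ext j
    refine Fin.cases ?_ (fun i => ?_) j
    · simp [cone_zero]
    · have : w i.succ = 0 := congrArg (fun u : 𝓤 => u i) h
      simp [cone_succ, this]
  refine ⟨exp (w 0), ?_, exp_apply_of_eigenvector hA⟩
  rw [← Complex.exp_eq_exp_ℂ]
  exact Complex.exp_ne_zero _

variable (H : Subgroup (EuclideanSpace ℂ (Fin (n + 1)) ≃ₗᵢ[ℂ] EuclideanSpace ℂ (Fin (n + 1))))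

/-- A group of unitary transformations as a submonoid of the algebra of endomorphisms. -/
noncomputable def clmSubmonoid : Submonoid (𝓥 →L[ℂ] 𝓥) := H.toSubmonoid.map clm

theorem inverseClosed_clmSubmonoid : (clmSubmonoid H).InverseClosed := by
  rintro _ ⟨U, hU, rfl⟩
  exact ⟨clm U⁻¹, ⟨U⁻¹, H.inv_mem hU, rfl⟩, by rw [← map_mul, inv_mul_cancel, map_one]⟩

variable {H}

/-- A slice chart at `p` for the orbit of `p` under a compact group of unitary transformations. -/
theorem exists_slice_chart (hH : IsCompact (clm '' (H : Set (𝓥 ≃ₗᵢ[ℂ] 𝓥)))) (p : CPn n) :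
    ∃ (T : Submodule ℝ 𝓤), ∃ φ ∈ IsManifold.maximalAtlas 𝓘(ℝ, 𝓤) ∞ (CPn n), p ∈ φ.source ∧
      ∀ q ∈ φ.source, (∃ U ∈ H, q = act U p) ↔ φ q ∈ T := by
  have hc : IsClosed (clmSubmonoid H : Set (𝓥 →L[ℂ] 𝓥)) := hH.isClosed
  have hS := inverseClosed_clmSubmonoid H
  set 𝔥 := expLie (clmSubmonoid H) hc hS with h𝔥
  -- The image `T` of `𝔥` under `infAct p` will be the tangent space of the orbit at `p`; `σ₀` lifts
  -- its vectors to `𝔥` and `π₀` projects onto it.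
  obtain ⟨σ₀, π₀, hσ𝔥, hτσ, hσπ, hπT, hTπ⟩ := exists_section 𝔥 (infAct p).toLinearMap
  set T := 𝔥.map (infAct p).toLinearMap with hT
  let σ : 𝓤 →L[ℝ] (𝓥 →L[ℂ] 𝓥) := LinearMap.toContinuousLinearMap σ₀
  let π : 𝓤 →L[ℝ] 𝓤 := LinearMap.toContinuousLinearMap π₀
  let F := frame p
  let Ψ : 𝓤 → 𝓤 := fun x => affine (sliceLift F σ π x)
  obtain ⟨hΨd, hΨs⟩ := hasFDerivAt_affine_sliceLift F σ π fun x => hτσ x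
  have hlift0 : sliceLift F σ π 0 0 ≠ 0 := by simp [sliceLift_zero, cone_zero]
  have hΨ0s := hΨs 0 hlift0
  have hω : (ω : WithTop ℕ∞) ≠ 0 := by simp
  have hΨ0 : Ψ 0 = 0 := by simp [Ψ, sliceLift_zero, affine_cone]
  let e := hΨ0s.toOpenPartialHomeomorph Ψ hΨd hω
  have he0 : (0 : 𝓤) ∈ e.source := hΨ0s.mem_toOpenPartialHomeomorph_source hΨd hω
  have he (x : 𝓤) : e x = Ψ x := rfl
  have hesymm : ContDiffAt ℝ ω e.symm 0 := by
    have := hΨ0s.to_localInverse hΨd hω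
    rwa [show affine (sliceLift F σ π 0) = 0 from hΨ0] at this
  have he0' : (0 : 𝓤) ∈ e.target := by
    have := e.map_source he0
    rwa [he, hΨ0] at this
  have hes0 : e.symm 0 = 0 := by
    have := e.left_inv he0
    rwa [he, hΨ0] at this
  let φ₀ := frameChart F ≫ₕ e.symm
  have hpF : p ∈ (frameChart F).source := mem_chart_source 𝓤 p
  have hFp : frameChart F p = 0 := by
    conv_lhs => arg 2; rw [← frame_spec p]
    change affine (F.symm (F (cone 0))) = 0
    rw [LinearIsometryEquiv.symm_apply_apply, affine_cone]
  have hpφ : p ∈ φ₀.source := ⟨hpF, by change frameChart F p ∈ e.target; rwa [hFp]⟩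
  have hφp : φ₀ p = 0 := by change e.symm (frameChart F p) = 0; rw [hFp, hes0]
  have hliftx (x : 𝓤) (hx : x ∈ T) : sliceLift F σ π x = F.symm (exp (σ x) (F (cone 0))) := by
    rw [sliceLift, show π x = x from hπT x hx, sub_self]
  -- elements of the group close to `1`
  let 𝔥₁ : Submodule ℝ (𝓥 →L[ℂ] 𝓥) := LinearMap.range σ₀
  let 𝔥₂ : Submodule ℝ (𝓥 →L[ℂ] 𝓥) := 𝔥 ⊓ LinearMap.ker (infAct p).toLinearMap
  -- The Lie algebra splits into the image of the section and the isotropy algebra of `p`.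
  have hsup : 𝔥₁ ⊔ 𝔥₂ = 𝔥 := by
    refine le_antisymm (sup_le ?_ inf_le_left) fun A hA => ?_
    · rintro _ ⟨x, rfl⟩
      exact hσ𝔥 x
    · rw [Submodule.mem_sup]
      refine ⟨σ₀ (infAct p A), ⟨_, rfl⟩, A - σ₀ (infAct p A), ⟨𝔥.sub_mem hA (hσ𝔥 _), ?_⟩, by abel⟩
      have h1 : infAct p (σ₀ (infAct p A)) = π₀ (infAct p A) := hτσ _
      have h2 : π₀ (infAct p A) = infAct p A := hπT _ ⟨A, hA, rfl⟩
      change infAct p (A - σ₀ (infAct p A)) = 0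
      rw [map_sub, h1, h2, sub_self]
  have hnear : ∀ᶠ y : 𝔥₁ in 𝓝 0, infAct p (y : 𝓥 →L[ℂ] 𝓥) ∈ e.source := by
    have : Tendsto (fun y : 𝔥₁ => infAct p (y : 𝓥 →L[ℂ] 𝓥)) (𝓝 0) (𝓝 0) := by
      have := ((infAct p).continuous.comp
        (continuous_subtype_val (p := fun A => A ∈ 𝔥₁))).tendsto 0
      simpa using! this
    exact this.eventually (e.open_source.mem_nhds he0)
  obtain ⟨O, hO, hOH⟩ := exists_open_of_compact hH p
    (eventually_mem_imp_exists_exp_mul_exp hc hS hsup hnear)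
  -- the neighbourhood of `p` on which the chart is defined
  let R : Set (CPn n) := {q | ContDiffAt ℝ ω Ψ (φ₀ q) ∧ ContDiffAt ℝ ω e.symm (frameChart F q) ∧
    q ∈ O ∧ sliceLift F σ π (φ₀ q) 0 ≠ 0}
  have hR : R ∈ 𝓝 p := by
    have c1 : Tendsto φ₀ (𝓝 p) (𝓝 0) := by
      have := φ₀.continuousAt hpφ
      rwa [ContinuousAt, hφp] at this
    have c2 : Tendsto (frameChart F) (𝓝 p) (𝓝 0) := by
      have := (frameChart F).continuousAt hpF
      rwa [ContinuousAt, hFp] at this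
    have c3 : ∀ᶠ x in 𝓝 (0 : 𝓤), sliceLift F σ π x 0 ≠ 0 := by
      have h1 : Continuous fun x => sliceLift F σ π x 0 :=
        (EuclideanSpace.proj (0 : Fin (n + 1)) : 𝓥 →L[ℂ] ℂ).continuous.comp
          (contDiff_sliceLift F σ π).continuous
      exact h1.continuousAt.eventually_ne hlift0
    filter_upwards [c1.eventually (hΨ0s.eventually (by simp)),
      c2.eventually (hesymm.eventually (by simp)), hO, c1.eventually c3] with q h1 h2 h3 h4
    exact ⟨h1, h2, h3, h4⟩
  refine ⟨T, φ₀.restr R, ?_, ?_, ?_⟩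
  · rw [IsManifold.mem_maximalAtlas_iff_contMDiffOn]
    constructor
    · rintro q ⟨hq, hqR⟩
      have hqR' : q ∈ R := interior_subset hqR
      refine ContMDiffAt.contMDiffWithinAt ?_
      have h1 := contMDiffAt_of_mem_maximalAtlas (frameChart_mem_maximalAtlas F) hq.1
      exact (hqR'.2.1.of_le le_top).contMDiffAt.comp q h1
    · rintro x ⟨hx, hxR⟩
      have hxR' : φ₀.symm x ∈ R := interior_subset hxR
      refine ContMDiffAt.contMDiffWithinAt ?_
      have h2 := contMDiffAt_symm_of_mem_maximalAtlas (frameChart_mem_maximalAtlas F) (x := Ψ x)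
        (by rw [frameChart_target]; trivial)
      have h3 := hxR'.1
      rw [φ₀.right_inv hx] at h3
      exact h2.comp x (h3.of_le le_top).contMDiffAt
  · exact ⟨hpφ, mem_interior_iff_mem_nhds.2 hR⟩
  · rintro q ⟨hq, hqR⟩
    have hqR' : q ∈ R := interior_subset hqR
    change _ ↔ φ₀ q ∈ T
    constructor
    · rintro ⟨U, hU, rfl⟩
      -- The point is reached by a group element `exp y₁ exp y₂` near `1`. The isotropy factor only
      -- rescales the vector spanning `p`, and `y₁ = σ x` with `x ∈ T`, so the slice coordinate of
      -- the point is `x`.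
      obtain ⟨U', hU', hN, hUU'⟩ := hOH U hU hqR'.2.2.1
      obtain ⟨y₁, hy₁, y₂, hy⟩ := hN ⟨U', hU', rfl⟩
      obtain ⟨c, hc0, hcy⟩ := exp_apply_of_infAct_eq_zero (p := p) y₂.2.2
      set x := infAct p (y₁ : 𝓥 →L[ℂ] 𝓥) with hx
      have hσx : σ x = y₁ := by
        obtain ⟨z, hz⟩ := y₁.2
        have h1 : x = π₀ z := by rw [hx, ← hz]; exact hτσ z
        change σ₀ x = y₁
        rw [h1, hσπ, hz]
      have hxT : x ∈ T := Submodule.mem_map_of_mem (hsup ▸ Submodule.mem_sup_left y₁.2)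
      have hval : frameChart F (act U p) = Ψ x := by
        rw [← hUU', act_eq_proj, frameChart_proj]
        change affine (F.symm (clm U' (F (cone 0)))) = affine (sliceLift F σ π x)
        rw [hy, mul_apply_eq_comp, hcy, map_smul, map_smul, affine_smul hc0, hliftx x hxT, hσx]
      have : φ₀ (act U p) = x := by
        change e.symm (frameChart F (act U p)) = x
        rw [hval, ← he, e.left_inv hy₁]
      rwa [this]
    · intro hqT
      -- For `x ∈ T` the transverse part `x - π x` vanishes, so the point with coordinate `x` is the
      -- translate of `p` by `exp (σ x)`.
      have h𝔥x : σ (φ₀ q) ∈ 𝔥 := hσ𝔥 _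
      obtain ⟨U, hU, hUx⟩ : exp (σ (φ₀ q)) ∈ clmSubmonoid H := by simpa using h𝔥x 1
      refine ⟨U, hU, (frameChart F).injOn hq.1 ?_ ?_⟩
      · rw [act_eq_proj, proj_mem_frameChart_source]
        change F.symm (clm U (F (cone 0))) 0 ≠ 0
        rw [hUx, ← hliftx _ hqT]
        exact hqR'.2.2.2
      · have h1 : frameChart F q = Ψ (φ₀ q) := (e.right_inv hq.2).symm
        rw [h1, act_eq_proj, frameChart_proj]
        change affine (sliceLift F σ π (φ₀ q)) = affine (F.symm (clm U (F (cone 0))))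
        rw [hUx, hliftx _ hqT]

/-- The slice chart at `p`, moved by group elements, serves every point of the orbit, with the same
linear subspace. -/
theorem isSubmanifold_orbit (hH : IsCompact (clm '' (H : Set (𝓥 ≃ₗᵢ[ℂ] 𝓥)))) (p : CPn n) :
    IsSubmanifold 𝓤 {q | ∃ U ∈ H, q = act U p} := by
  obtain ⟨T, φ, hφ, hp, hT⟩ := exists_slice_chart hH p
  refine ⟨Module.finrank ℝ T, ?_⟩
  rintro _ ⟨U, hU, rfl⟩
  refine ⟨(actHomeo U⁻¹).toOpenPartialHomeomorph ≫ₕ φ,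
    actHomeo_trans_mem_maximalAtlas _ hφ, ⟨Set.mem_univ _, ?_⟩, T, rfl, ?_⟩
  · change act U⁻¹ (act U p) ∈ φ.source
    rwa [← act_mul, inv_mul_cancel, act_one]
  · rintro q ⟨-, hq⟩
    refine Iff.trans ?_ (hT (act U⁻¹ q) hq)
    constructor
    · rintro ⟨W, hW, rfl⟩
      exact ⟨U⁻¹ * W, H.mul_mem (H.inv_mem hU) hW, by rw [act_mul]⟩
    · rintro ⟨W, hW, h⟩
      refine ⟨U * W, H.mul_mem hU hW, ?_⟩
      rw [act_mul, ← h, ← act_mul, mul_inv_cancel, act_one]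

end CPn

end Slice

/-! ### The adjoint representation and the Lie bracket -/

section Adjoint

open Filter Topology VectorField

variable {E : Type*} [NormedAddCommGroup E] [NormedSpace ℝ E]
  {G : Type*} [TopologicalSpace G] [ChartedSpace E G] [Group G]

theorem lieAd_one : lieAd E (1 : G) = ContinuousLinearMap.id ℝ _ := by
  have h : (fun h : G => 1 * h * 1⁻¹) = id := by ext; simp
  rw [lieAd, h]
  exact mfderiv_id

variable (E G) in
/-- A map `G × G → G` in the preferred chart at `1`. -/
noncomputable def inChart (f : G × G → G) (z : E × E) : E :=
  extChartAt 𝓘(ℝ, E) (1 : G)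
    (f ((extChartAt 𝓘(ℝ, E) (1 : G)).symm z.1, (extChartAt 𝓘(ℝ, E) (1 : G)).symm z.2))

variable (E G) in
/-- The coordinates of the identity element. -/
noncomputable def chartOne : E := extChartAt 𝓘(ℝ, E) (1 : G) 1

theorem chart_symm_chartOne : (extChartAt 𝓘(ℝ, E) (1 : G)).symm (chartOne E G) = 1 :=
  extChartAt_to_inv 1

/-- The derivative of a map in the preferred charts. -/
theorem HasMFDerivAt.hasFDerivAt_written {F : Type*} [NormedAddCommGroup F] [NormedSpace ℝ F]
    {N : Type*} [TopologicalSpace N] [ChartedSpace F N] {F' : Type*} [NormedAddCommGroup F']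
    [NormedSpace ℝ F'] {N' : Type*} [TopologicalSpace N'] [ChartedSpace F' N'] {f : N → N'} {x : N}
    {f' : F →L[ℝ] F'} (hf : HasMFDerivAt 𝓘(ℝ, F) 𝓘(ℝ, F') f x f') :
    HasFDerivAt (writtenInExtChartAt 𝓘(ℝ, F) 𝓘(ℝ, F') x f) f' (extChartAt 𝓘(ℝ, F) x x) := by
  have h : HasFDerivWithinAt (writtenInExtChartAt 𝓘(ℝ, F) 𝓘(ℝ, F') x f) f'
    (Set.range 𝓘(ℝ, F)) (extChartAt 𝓘(ℝ, F) x x) := hf.2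
  rw [modelWithCornersSelf_coe, Set.range_id, hasFDerivWithinAt_univ] at h
  exact h

theorem mfderiv_eq_fderiv_inChart {F : Type*} [NormedAddCommGroup F] [NormedSpace ℝ F]
    {f : G → F} (hf : MDifferentiableAt 𝓘(ℝ, E) 𝓘(ℝ, F) f 1) (v : GroupLieAlgebra 𝓘(ℝ, E) G) :
    (mfderiv 𝓘(ℝ, E) 𝓘(ℝ, F) f 1 v : F) =
      fderiv ℝ (fun y => f ((extChartAt 𝓘(ℝ, E) (1 : G)).symm y)) (chartOne E G) v := by
  have h := hf.hasMFDerivAt.hasFDerivAt_written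
  exact (DFunLike.congr_fun h.fderiv v).symm

variable [LieGroup 𝓘(ℝ, E) ∞ G]

theorem contMDiff_conj (g : G) : ContMDiff 𝓘(ℝ, E) 𝓘(ℝ, E) ∞ fun h : G => g * h * g⁻¹ :=
  (contMDiff_const.mul contMDiff_id).mul contMDiff_const

theorem lieAd_mul (g h : G) (X : GroupLieAlgebra 𝓘(ℝ, E) G) :
    lieAd E (g * h) X = lieAd E g (lieAd E h X) := by
  have h1 : (fun x : G => g * h * x * (g * h)⁻¹) =
      (fun x => g * x * g⁻¹) ∘ fun x => h * x * h⁻¹ := by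
    ext x; simp [mul_assoc]
  have h2 := mfderiv_comp_of_eq (x := (1 : G)) (y := 1) (I' := 𝓘(ℝ, E))
    ((contMDiff_conj (E := E) g).mdifferentiable (by simp) 1)
    ((contMDiff_conj (E := E) h).mdifferentiable (by simp) 1) (by simp)
  rw [← h1] at h2
  have h3 : ∀ y : G, y = 1 → ∀ v : E,
      (mfderiv 𝓘(ℝ, E) 𝓘(ℝ, E) (fun x : G => g * x * g⁻¹) y v : E) = lieAd E g v := by
    rintro _ rfl v
    rfl
  exact (DFunLike.congr_fun h2 X).trans (h3 _ (by simp) _)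

theorem contMDiffAt_chart_symm {x : E} (hx : x ∈ (extChartAt 𝓘(ℝ, E) (1 : G)).target) :
    ContMDiffAt 𝓘(ℝ, E) 𝓘(ℝ, E) ∞ (extChartAt 𝓘(ℝ, E) (1 : G)).symm x :=
  (contMDiffOn_extChartAt_symm (1 : G)).contMDiffAt ((isOpen_extChartAt_target 1).mem_nhds hx)

theorem contDiffAt_inChart {f : G × G → G}
    (hf : ContMDiff (𝓘(ℝ, E).prod 𝓘(ℝ, E)) 𝓘(ℝ, E) ∞ f) {x y : E}
    (hx : x ∈ (extChartAt 𝓘(ℝ, E) (1 : G)).target)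
    (hy : y ∈ (extChartAt 𝓘(ℝ, E) (1 : G)).target)
    (hxy : f ((extChartAt 𝓘(ℝ, E) (1 : G)).symm x, (extChartAt 𝓘(ℝ, E) (1 : G)).symm y) ∈
      (extChartAt 𝓘(ℝ, E) (1 : G)).source) :
    ContDiffAt ℝ ∞ (inChart E G f) (x, y) := by
  rw [← contMDiffAt_iff_contDiffAt]
  have h1 : ContMDiffAt 𝓘(ℝ, E × E) 𝓘(ℝ, E) ∞
      (fun z : E × E => (extChartAt 𝓘(ℝ, E) (1 : G)).symm z.1) (x, y) :=
    ContMDiffAt.comp (x, y) (contMDiffAt_chart_symm hx) contDiff_fst.contMDiff.contMDiffAt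
  have h2 : ContMDiffAt 𝓘(ℝ, E × E) 𝓘(ℝ, E) ∞
      (fun z : E × E => (extChartAt 𝓘(ℝ, E) (1 : G)).symm z.2) (x, y) :=
    ContMDiffAt.comp (x, y) (contMDiffAt_chart_symm hy) contDiff_snd.contMDiff.contMDiffAt
  have h3 := ContMDiffAt.comp (x, y) hf.contMDiffAt (h1.prodMk h2)
  exact ContMDiffAt.comp (x, y) (contMDiffAt_extChartAt' (by simpa using hxy)) h3

variable (E G) in
theorem contDiffAt_inChart_mul :
    ContDiffAt ℝ ∞ (inChart E G fun z => z.1 * z.2) (chartOne E G, chartOne E G) :=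
  contDiffAt_inChart (contMDiff_mul 𝓘(ℝ, E) ∞) (mem_extChartAt_target 1) (mem_extChartAt_target 1)
    (by rw [chart_symm_chartOne, mul_one]; exact mem_extChartAt_source _)

variable (E G) in
theorem contDiffAt_inChart_conj :
    ContDiffAt ℝ ∞ (inChart E G fun z => z.1 * z.2 * z.1⁻¹) (chartOne E G, chartOne E G) :=
  contDiffAt_inChart ((contMDiff_fst.mul contMDiff_snd).mul contMDiff_fst.inv)
    (mem_extChartAt_target 1) (mem_extChartAt_target 1)
    (by rw [chart_symm_chartOne]; simp)

/-- A `C¹` map is differentiable near each point. -/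
theorem ContDiffAt.eventually_differentiableAt {F F' : Type*} [NormedAddCommGroup F]
    [NormedSpace ℝ F] [NormedAddCommGroup F'] [NormedSpace ℝ F'] {f : F → F'} {x : F}
    (hf : ContDiffAt ℝ ∞ f x) : ∀ᶠ y in 𝓝 x, DifferentiableAt ℝ f y :=
  ((hf.of_le (m := 1) (by exact_mod_cast le_top)).eventually (by simp)).mono
    fun _ h => h.differentiableAt (by simp)

/-- Expressing `Ad` as a partial derivative of the conjugation map in one fixed chart makes it
differentiable in the group variable. -/
theorem eventually_lieAd_eq :
    ∀ᶠ x in 𝓝 (chartOne E G), ∀ v : GroupLieAlgebra 𝓘(ℝ, E) G,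
      (lieAd E ((extChartAt 𝓘(ℝ, E) (1 : G)).symm x) v : E) =
        fderiv ℝ (inChart E G fun z => z.1 * z.2 * z.1⁻¹) (x, chartOne E G) (0, v) := by
  have hc : Tendsto (fun x : E => (x, chartOne E G)) (𝓝 (chartOne E G))
      (𝓝 (chartOne E G, chartOne E G)) := (Continuous.prodMk_left _).tendsto _
  filter_upwards [hc.eventually (contDiffAt_inChart_conj E G).eventually_differentiableAt]
    with x hx v
  set g := (extChartAt 𝓘(ℝ, E) (1 : G)).symm x
  have h1 : HasFDerivAt (fun y => inChart E G (fun z => z.1 * z.2 * z.1⁻¹) (x, y))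
      ((fderiv ℝ (inChart E G fun z => z.1 * z.2 * z.1⁻¹) (x, chartOne E G)).comp
        (ContinuousLinearMap.inr ℝ E E)) (chartOne E G) :=
    hx.hasFDerivAt.comp (chartOne E G) (hasFDerivAt_prodMk_right x (chartOne E G))
  have hg : MDifferentiableAt 𝓘(ℝ, E) 𝓘(ℝ, E) (fun h : G => g * h * g⁻¹) 1 :=
    (contMDiff_conj (E := E) g).mdifferentiable (by simp) 1
  have hw := hg.hasMFDerivAt.hasFDerivAt_written
  have h2 : writtenInExtChartAt 𝓘(ℝ, E) 𝓘(ℝ, E) 1 (fun h : G => g * h * g⁻¹) =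
      fun y => inChart E G (fun z => z.1 * z.2 * z.1⁻¹) (x, y) := by
    funext y
    change extChartAt 𝓘(ℝ, E) (g * 1 * g⁻¹) _ = _
    rw [mul_one, mul_inv_cancel]
    rfl
  rw [h2] at hw
  exact DFunLike.congr_fun (hw.unique h1) v

/-- In the chart, left-invariant fields are partial derivatives of the multiplication, so their
bracket can be read off from its second derivative at the identity. -/
theorem eventually_mpullback_eq (v : GroupLieAlgebra 𝓘(ℝ, E) G) :
    ∀ᶠ x in 𝓝 (chartOne E G),
      (mpullbackWithin 𝓘(ℝ, E) 𝓘(ℝ, E) (extChartAt 𝓘(ℝ, E) (1 : G)).symm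
        (mulInvariantVectorField v) (Set.range 𝓘(ℝ, E)) x : E) =
      fderiv ℝ (inChart E G fun z => z.1 * z.2) (x, chartOne E G) (0, v) := by
  have hc : Tendsto (fun x : E => (x, chartOne E G)) (𝓝 (chartOne E G))
      (𝓝 (chartOne E G, chartOne E G)) := (Continuous.prodMk_left _).tendsto _
  filter_upwards [hc.eventually (contDiffAt_inChart_mul E G).eventually_differentiableAt,
    (isOpen_extChartAt_target (I := 𝓘(ℝ, E)) (1 : G)).mem_nhds (mem_extChartAt_target 1)]
    with x hx hxt
  set g := (extChartAt 𝓘(ℝ, E) (1 : G)).symm x with hg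
  have h1 : HasFDerivAt (fun y => inChart E G (fun z => z.1 * z.2) (x, y))
      ((fderiv ℝ (inChart E G fun z => z.1 * z.2) (x, chartOne E G)).comp
        (ContinuousLinearMap.inr ℝ E E)) (chartOne E G) :=
    hx.hasFDerivAt.comp (chartOne E G) (hasFDerivAt_prodMk_right x (chartOne E G))
  have hinv : (mfderivWithin 𝓘(ℝ, E) 𝓘(ℝ, E) (extChartAt 𝓘(ℝ, E) (1 : G)).symm
      (Set.range 𝓘(ℝ, E)) x).inverse = mfderiv 𝓘(ℝ, E) 𝓘(ℝ, E) (extChartAt 𝓘(ℝ, E) (1 : G)) g :=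
    ContinuousLinearMap.inverse_eq (mfderivWithin_extChartAt_symm_comp_mfderiv_extChartAt hxt)
      (mfderiv_extChartAt_comp_mfderivWithin_extChartAt_symm hxt)
  have hm1 : MDifferentiableAt 𝓘(ℝ, E) 𝓘(ℝ, E) (fun h : G => g * h) 1 :=
    (contMDiff_mul_left (I := 𝓘(ℝ, E)) (n := ∞)).mdifferentiable (by simp) 1
  have hgs : g * 1 ∈ (chartAt E (1 : G)).source := by
    rw [mul_one, ← extChartAt_source 𝓘(ℝ, E)]
    exact (extChartAt 𝓘(ℝ, E) (1 : G)).map_target hxt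
  have hm2 : MDifferentiableAt 𝓘(ℝ, E) 𝓘(ℝ, E) (extChartAt 𝓘(ℝ, E) (1 : G)) (g * 1) :=
    mdifferentiableAt_extChartAt hgs
  have hcomp := mfderiv_comp (x := (1 : G)) hm2 hm1
  have hval := mfderiv_eq_fderiv_inChart (hm2.comp (1 : G) hm1) v
  rw [hcomp] at hval
  have h3 : fderiv ℝ (fun y => ((extChartAt 𝓘(ℝ, E) (1 : G)) ∘ fun h => g * h)
      ((extChartAt 𝓘(ℝ, E) (1 : G)).symm y)) (chartOne E G) v =
      fderiv ℝ (inChart E G fun z => z.1 * z.2) (x, chartOne E G) (0, v) :=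
    DFunLike.congr_fun h1.fderiv v
  have h4 : ∀ y : G, y = g → ∀ w : E, (mfderiv 𝓘(ℝ, E) 𝓘(ℝ, E)
      (extChartAt 𝓘(ℝ, E) (1 : G)) y w : E) =
      mfderiv 𝓘(ℝ, E) 𝓘(ℝ, E) (extChartAt 𝓘(ℝ, E) (1 : G)) g w := by
    rintro _ rfl w
    rfl
  refine Eq.trans ?_ (hval.trans h3)
  refine Eq.trans ?_ (h4 _ (mul_one g) _).symm
  rw [mpullbackWithin_apply, hinv]
  rfl

/-- This is `(g h g⁻¹) g = g h` in the chart; in this form the second derivative of the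
multiplication enters without any derivative of inversion. -/
theorem eventually_inChart_mul_conj (x : E) :
    ∀ᶠ y in 𝓝 (chartOne E G), inChart E G (fun z => z.1 * z.2)
      (inChart E G (fun z => z.1 * z.2 * z.1⁻¹) (x, y), x) =
      inChart E G (fun z => z.1 * z.2) (x, y) := by
  set g := (extChartAt 𝓘(ℝ, E) (1 : G)).symm x with hg
  have h1 : ContinuousAt (fun y => g * (extChartAt 𝓘(ℝ, E) (1 : G)).symm y * g⁻¹)
      (chartOne E G) := by
    have h2 := (contMDiff_conj (E := E) g).continuous.continuousAt.comp
      (contMDiffAt_chart_symm (mem_extChartAt_target (I := 𝓘(ℝ, E)) (1 : G))).continuousAt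
    exact h2
  have h3 : ∀ᶠ y in 𝓝 (chartOne E G), g * (extChartAt 𝓘(ℝ, E) (1 : G)).symm y * g⁻¹ ∈
      (extChartAt 𝓘(ℝ, E) (1 : G)).source := by
    refine h1.eventually (extChartAt_source_mem_nhds' ?_)
    have h4 : g * (extChartAt 𝓘(ℝ, E) (1 : G)).symm (chartOne E G) * g⁻¹ = 1 := by
      rw [chart_symm_chartOne, mul_one, mul_inv_cancel]
    simp only [h4]
    exact mem_extChartAt_source _
  filter_upwards [h3] with y hy
  simp only [inChart]
  rw [(extChartAt 𝓘(ℝ, E) (1 : G)).left_inv hy, ← hg, inv_mul_cancel_right]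

/-- The differential of the adjoint representation is the Lie bracket. -/
theorem hasFDerivAt_lieAd (w : E) :
    ∃ L : E →L[ℝ] E, HasFDerivAt
      (fun x => (lieAd E ((extChartAt 𝓘(ℝ, E) (1 : G)).symm x) w : E)) L (chartOne E G) ∧
      ∀ v : E, L v = Bracket.bracket (L := GroupLieAlgebra 𝓘(ℝ, E) G)
        (M := GroupLieAlgebra 𝓘(ℝ, E) G) v w := by
  set e := chartOne E G with he
  set m := inChart E G fun z => z.1 * z.2 with hm
  set c := inChart E G fun z => z.1 * z.2 * z.1⁻¹ with hc
  have hms : ContDiffAt ℝ ∞ m (e, e) := contDiffAt_inChart_mul E G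
  have hcs : ContDiffAt ℝ ∞ c (e, e) := contDiffAt_inChart_conj E G
  have tr : Tendsto (fun x : E => (x, e)) (𝓝 e) (𝓝 (e, e)) := (Continuous.prodMk_left _).tendsto _
  have tl : Tendsto (fun x : E => (e, x)) (𝓝 e) (𝓝 (e, e)) := (Continuous.prodMk_right _).tendsto _
  obtain ⟨M', hM'⟩ : ∃ M', HasFDerivAt (fderiv ℝ m) M' (e, e) :=
    ⟨_, ((hms.fderiv_right (m := ∞) (by simp)).differentiableAt (by simp)).hasFDerivAt⟩
  have hsymm (p q : E × E) : M' p q = M' q p := by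
    have h := hms.isSymmSndFDerivAt
      (by rw [minSmoothness_of_isRCLikeNormedField]; exact ENat.LEInfty.out)
    have := h.eq p q
    rwa [hM'.fderiv] at this
  obtain ⟨C', hC'⟩ : ∃ C', HasFDerivAt (fderiv ℝ c) C' (e, e) :=
    ⟨_, ((hcs.fderiv_right (m := ∞) (by simp)).differentiableAt (by simp)).hasFDerivAt⟩
  have hl : HasFDerivAt (fun x : E => (e, x)) (ContinuousLinearMap.inr ℝ E E) e :=
    hasFDerivAt_prodMk_right e e
  have hr : HasFDerivAt (fun x : E => (x, e)) (ContinuousLinearMap.inl ℝ E E) e :=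
    hasFDerivAt_prodMk_left e e
  have hMl : HasFDerivAt (fun x => fderiv ℝ m (e, x)) (M'.comp (ContinuousLinearMap.inr ℝ E E)) e :=
    HasFDerivAt.comp (f := fun x : E => (e, x)) e hM' hl
  have hMr : HasFDerivAt (fun x => fderiv ℝ m (x, e)) (M'.comp (ContinuousLinearMap.inl ℝ E E)) e :=
    HasFDerivAt.comp (f := fun x : E => (x, e)) e hM' hr
  have hA0 := (HasFDerivAt.comp (f := fun x : E => (x, e)) e hC' hr).clm_apply (hasFDerivAt_const ((0, w) : E × E) e)
  obtain ⟨L, hL⟩ : ∃ L, HasFDerivAt (fun x => fderiv ℝ c (x, e) (0, w)) L e := ⟨_, hA0⟩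
  refine ⟨L, hL.congr_of_eventuallyEq (eventually_lieAd_eq.mono fun x hx => hx w), fun v => ?_⟩
  have hAe : fderiv ℝ c (e, e) (0, w) = w := by
    have h := (eventually_lieAd_eq (E := E) (G := G)).self_of_nhds w
    rw [chart_symm_chartOne, lieAd_one] at h
    exact h.symm
  -- the first derivatives of the multiplication at the identity
  have hm1 (u : E) : fderiv ℝ m (e, e) (u, 0) = u := by
    have h1 := HasFDerivAt.comp (f := fun x : E => (x, e)) e
      (hms.differentiableAt (by simp)).hasFDerivAt hr
    have h2 : (fun x => m (x, e)) =ᶠ[𝓝 e] id := by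
      filter_upwards [(isOpen_extChartAt_target (I := 𝓘(ℝ, E)) (1 : G)).mem_nhds
        (mem_extChartAt_target 1)] with x hx
      simp only [hm, inChart, he, chart_symm_chartOne, mul_one]
      exact (extChartAt 𝓘(ℝ, E) (1 : G)).right_inv hx
    exact DFunLike.congr_fun (h1.unique ((hasFDerivAt_id e).congr_of_eventuallyEq h2)) u
  have hm2 (u : E) : fderiv ℝ m (e, e) (0, u) = u := by
    have h1 := HasFDerivAt.comp (f := fun x : E => (e, x)) e
      (hms.differentiableAt (by simp)).hasFDerivAt hl
    have h2 : (fun x => m (e, x)) =ᶠ[𝓝 e] id := by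
      filter_upwards [(isOpen_extChartAt_target (I := 𝓘(ℝ, E)) (1 : G)).mem_nhds
        (mem_extChartAt_target 1)] with x hx
      simp only [hm, inChart, he, chart_symm_chartOne, one_mul]
      exact (extChartAt 𝓘(ℝ, E) (1 : G)).right_inv hx
    exact DFunLike.congr_fun (h1.unique ((hasFDerivAt_id e).congr_of_eventuallyEq h2)) u
  -- `g h g⁻¹ g = g h`, differentiated with respect to `h` and then with respect to `g`
  have heq : ∀ᶠ x in 𝓝 e, fderiv ℝ m (e, x) (fderiv ℝ c (x, e) (0, w), 0) =
      fderiv ℝ m (x, e) (0, w) := by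
    filter_upwards [(isOpen_extChartAt_target (I := 𝓘(ℝ, E)) (1 : G)).mem_nhds
      (mem_extChartAt_target 1), tr.eventually hms.eventually_differentiableAt,
      tl.eventually hms.eventually_differentiableAt,
      tr.eventually hcs.eventually_differentiableAt] with x hx h1 h2 h3
    have hce : c (x, e) = e := by
      simp only [hc, inChart, he, chart_symm_chartOne, mul_one, mul_inv_cancel]
      rfl
    have hxl : HasFDerivAt (fun y : E => (x, y)) (ContinuousLinearMap.inr ℝ E E) e :=
      hasFDerivAt_prodMk_right x e
    have d1 := HasFDerivAt.comp (f := fun y : E => (x, y)) e h1.hasFDerivAt hxl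
    have d2 := (HasFDerivAt.comp (f := fun y : E => (x, y)) e h3.hasFDerivAt hxl).prodMk (hasFDerivAt_const x e)
    have h2' : HasFDerivAt m (fderiv ℝ m (e, x)) (c (x, e), x) := by
      rw [hce]; exact h2.hasFDerivAt
    have d3 := HasFDerivAt.comp (f := fun y : E => (c (x, y), x)) e h2' d2
    have := d3.unique (d1.congr_of_eventuallyEq (eventually_inChart_mul_conj x))
    exact DFunLike.congr_fun this w
  have dl := hMl.clm_apply (hL.prodMk (hasFDerivAt_const (0 : E) e))
  have dr := hMr.clm_apply (hasFDerivAt_const ((0, w) : E × E) e)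
  have hd := dl.unique (dr.congr_of_eventuallyEq heq)
  -- The product rule at the identity, where the first derivatives of the multiplication and `Ad`
  -- are trivial.
  have hdv : M' (0, v) (w, 0) + L v = M' (v, 0) (0, w) := by
    have := DFunLike.congr_fun hd v
    simpa [hAe, hm1, add_comm] using this
  -- the bracket of the invariant vector fields in the chart
  have hfield (u : E) : HasFDerivAt
      (mpullbackWithin 𝓘(ℝ, E) 𝓘(ℝ, E) (extChartAt 𝓘(ℝ, E) (1 : G)).symm
        (mulInvariantVectorField u) (Set.range 𝓘(ℝ, E)) : E → E)
      ((M'.comp (ContinuousLinearMap.inl ℝ E E)).flip ((0, u) : E × E)) e := by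
    have h1 := hMr.clm_apply (hasFDerivAt_const ((0, u) : E × E) e)
    refine (h1.congr_of_eventuallyEq (eventually_mpullback_eq u)).congr_fderiv ?_
    ext z
    simp
  have hval (u : E) :
      (mpullbackWithin 𝓘(ℝ, E) 𝓘(ℝ, E) (extChartAt 𝓘(ℝ, E) (1 : G)).symm
        (mulInvariantVectorField u) (Set.range 𝓘(ℝ, E)) e : E) = u :=
    (eventually_mpullback_eq u).self_of_nhds.trans (hm2 u)
  have hbr : Bracket.bracket (L := GroupLieAlgebra 𝓘(ℝ, E) G)
      (M := GroupLieAlgebra 𝓘(ℝ, E) G) v w = M' (v, 0) (0, w) - M' (w, 0) (0, v) := by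
    have h1 : (extChartAt 𝓘(ℝ, E) (1 : G)).symm ⁻¹' Set.univ ∩ Set.range 𝓘(ℝ, E) = Set.univ := by
      simp
    have h2 : ∀ z : E, (mfderiv 𝓘(ℝ, E) 𝓘(ℝ, E) (extChartAt 𝓘(ℝ, E) (1 : G)) 1).inverse z = z := by
      intro z
      rw [mfderiv_extChartAt_self]
      exact DFunLike.congr_fun (ContinuousLinearMap.inverse_id (R := ℝ) (M := E)) z
    refine Eq.trans (h2 (lieBracketWithin ℝ _ _ _ e)) ?_
    rw [h1]
    refine (congrFun lieBracketWithin_univ e).trans ?_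
    have h3 : ∀ {p q : E → E} {p' q' : E →L[ℝ] E}, HasFDerivAt p p' e → HasFDerivAt q q' e →
        lieBracket ℝ p q e = q' (p e) - p' (q e) := by
      intro p q p' q' hp hq
      simp only [lieBracket_eq, hp.fderiv, hq.fderiv]
    refine (h3 (hfield v) (hfield w)).trans ?_
    rw [hval v, hval w]
    simp
  -- Symmetry of the second derivative turns the subtracted term into the one in `hdv`, leaving `L
  -- v`.
  rw [hbr, hsymm (w, 0), ← hdv, add_sub_cancel_left]

end Adjoint

/-! ### Derivative of `Ad` along curves, and the Lie algebra of `K` -/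

section AdjointGroup

set_option linter.unusedSectionVars false

open Filter Topology VectorField

variable {E : Type*} [NormedAddCommGroup E] [NormedSpace ℝ E] [FiniteDimensional ℝ E]
  {G : Type*} [TopologicalSpace G] [ChartedSpace E G] [Group G] [LieGroup 𝓘(ℝ, E) ∞ G]

/-- The adjoint representation on the model space. -/
noncomputable def adRep (E : Type*) [NormedAddCommGroup E] [NormedSpace ℝ E]
    {G : Type*} [TopologicalSpace G] [ChartedSpace E G] [Group G] (g : G) : E →L[ℝ] E :=
  lieAd E g

/-- The adjoint representation of the Lie algebra on the model space. -/
noncomputable def adLie (G : Type*) [TopologicalSpace G] [ChartedSpace E G] [Group G]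
    [LieGroup 𝓘(ℝ, E) ∞ G] (X : E) : E →L[ℝ] E :=
  LinearMap.toContinuousLinearMap
    (LieAlgebra.ad ℝ (GroupLieAlgebra 𝓘(ℝ, E) G) X : E →ₗ[ℝ] E)

theorem adRep_one : adRep E (1 : G) = 1 := lieAd_one

theorem adRep_mul (g h : G) : adRep E (g * h) = adRep E g * adRep E h := by
  ext X
  exact lieAd_mul g h X

/-- This upgrades `hasFDerivAt_lieAd` from single vectors to operators: smoothness of conjugation
gives the operator-valued derivative, and evaluation at vectors identifies it. -/
theorem hasFDerivAt_adRep_chart : ∃ L : E →L[ℝ] (E →L[ℝ] E), HasFDerivAt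
    (fun x => adRep E ((extChartAt 𝓘(ℝ, E) (1 : G)).symm x)) L (chartOne E G) ∧
      ∀ v, L v = adLie G v := by
  have hcs : ContDiffAt ℝ ∞ (inChart E G fun z => z.1 * z.2 * z.1⁻¹)
    (chartOne E G, chartOne E G) := contDiffAt_inChart_conj E G
  have h1 : DifferentiableAt ℝ (fun x : E => (fderiv ℝ (inChart E G fun z => z.1 * z.2 * z.1⁻¹)
      (x, chartOne E G)).comp (ContinuousLinearMap.inr ℝ E E)) (chartOne E G) := by
    have h2 := (hcs.fderiv_right (m := ∞) (by simp)).differentiableAt (by simp)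
    have h3 : HasFDerivAt (fun x : E => (x, chartOne E G)) (ContinuousLinearMap.inl ℝ E E)
      (chartOne E G) := hasFDerivAt_prodMk_left _ _
    exact (DifferentiableAt.comp (f := fun x : E => (x, chartOne E G)) (chartOne E G) h2
      h3.differentiableAt).clm_comp (differentiableAt_const _)
  have h4 : (fun x => adRep E ((extChartAt 𝓘(ℝ, E) (1 : G)).symm x)) =ᶠ[𝓝 (chartOne E G)]
      fun x : E => (fderiv ℝ (inChart E G fun z => z.1 * z.2 * z.1⁻¹)
        (x, chartOne E G)).comp (ContinuousLinearMap.inr ℝ E E) := by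
    filter_upwards [eventually_lieAd_eq (E := E) (G := G)] with x hx
    ext v
    exact hx v
  obtain ⟨L, hL⟩ := h1
  have hL' := hL.congr_of_eventuallyEq h4
  refine ⟨L, hL', fun v => ?_⟩
  ext w
  obtain ⟨L₁, hL₁, hLw⟩ := hasFDerivAt_lieAd (G := G) w
  have h5 : HasFDerivAt (fun x => adRep E ((extChartAt 𝓘(ℝ, E) (1 : G)).symm x) w)
      (L.flip w) (chartOne E G) :=
    (ContinuousLinearMap.apply ℝ E w).hasFDerivAt.comp (chartOne E G) hL'
  exact (DFunLike.congr_fun (h5.unique hL₁) v).trans (hLw v)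

/-- Along a curve in the group with velocity `X` at `1`, the derivative of `Ad` is `ad X`. -/
theorem hasDerivAt_adRep {γ : ℝ → G} {X : E} (h0 : γ 0 = 1)
    (hγ : HasMFDerivAt 𝓘(ℝ, ℝ) 𝓘(ℝ, E) γ 0 (ContinuousLinearMap.toSpanSingleton ℝ X : ℝ →L[ℝ] E)) :
    HasDerivAt (fun t => adRep E (γ t)) (adLie G X) 0 := by
  obtain ⟨L, hL, hLv⟩ := hasFDerivAt_adRep_chart (E := E) (G := G)
  have h1 : HasFDerivAt (fun t => extChartAt 𝓘(ℝ, E) (1 : G) (γ t))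
      (ContinuousLinearMap.toSpanSingleton ℝ X : ℝ →L[ℝ] E) 0 := by
    have := hγ.hasFDerivAt_written
    rw [writtenInExtChartAt, h0] at this
    exact this
  have h2 : HasDerivAt (fun t => extChartAt 𝓘(ℝ, E) (1 : G) (γ t)) X 0 := by
    simpa using h1.hasDerivAt
  have h3 := hL.comp_hasDerivAt_of_eq (0 : ℝ) h2 (by rw [h0]; rfl)
  rw [hLv] at h3
  refine h3.congr_of_eventuallyEq ?_
  have h4 : ∀ᶠ t in 𝓝 (0 : ℝ), γ t ∈ (extChartAt 𝓘(ℝ, E) (1 : G)).source := by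
    refine hγ.1.eventually ?_
    rw [h0]
    exact extChartAt_source_mem_nhds 1
  filter_upwards [h4] with t ht
  simp only [Function.comp_apply]
  rw [(extChartAt 𝓘(ℝ, E) (1 : G)).left_inv ht]

/-- Continuity at `1` spreads over the group by multiplicativity. -/
theorem continuous_adRep : Continuous (adRep E : G → E →L[ℝ] E) := by
  have h1 : ContinuousAt (adRep E : G → E →L[ℝ] E) 1 := by
    obtain ⟨L, hL, -⟩ := hasFDerivAt_adRep_chart (E := E) (G := G)
    have h2 := hL.continuousAt.comp_of_eq (continuousAt_extChartAt (I := 𝓘(ℝ, E)) (1 : G)) rfl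
    refine h2.congr ?_
    filter_upwards [extChartAt_source_mem_nhds (I := 𝓘(ℝ, E)) (1 : G)] with g hg
    simp only [Function.comp_apply]
    rw [(extChartAt 𝓘(ℝ, E) (1 : G)).left_inv hg]
  rw [continuous_iff_continuousAt]
  intro g₀
  have h2 : (adRep E : G → E →L[ℝ] E) = fun g => adRep E g₀ * adRep E (g₀⁻¹ * g) := by
    funext g
    rw [← adRep_mul, mul_inv_cancel_left]
  rw [h2]
  refine continuousAt_const.mul (h1.comp_of_eq ?_ (inv_mul_cancel g₀))
  exact (contMDiff_mul_left (I := 𝓘(ℝ, E)) (n := ∞) (a := g₀⁻¹)).continuous.continuousAt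

/-- A local curve suffices, because `exp_smul_mem_of_hasDerivAt` uses only a velocity at the
identity. -/
theorem exists_integralCurve (X : GroupLieAlgebra 𝓘(ℝ, E) G) :
    ∃ γ : ℝ → G, γ 0 = 1 ∧ IsMIntegralCurveAt γ (mulInvariantVectorField X) 0 := by
  have : IsManifold 𝓘(ℝ, E) 1 G := IsManifold.of_le (n := ∞) (by simp)
  refine exists_isMIntegralCurveAt_of_contMDiffAt_boundaryless 0 ?_
  refine (contMDiffAt_mulInvariantVectorField X).of_le ?_
  rw [minSmoothness_of_isRCLikeNormedField]
  exact one_le_two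

theorem mulInvariantVectorField_one (X : GroupLieAlgebra 𝓘(ℝ, E) G) :
    (mulInvariantVectorField X (1 : G) : E) = X := by
  have h : (fun h : G => 1 * h) = id := by ext; simp
  rw [mulInvariantVectorField, h]
  exact DFunLike.congr_fun (mfderiv_id (I := 𝓘(ℝ, E)) (x := (1 : G))) X

theorem hasMFDerivAt_of_isMIntegralCurveAt {γ : ℝ → G} {X : GroupLieAlgebra 𝓘(ℝ, E) G}
    (h0 : γ 0 = 1) (hγ : IsMIntegralCurveAt γ (mulInvariantVectorField X) 0) :
    HasMFDerivAt 𝓘(ℝ, ℝ) 𝓘(ℝ, E) γ 0 (ContinuousLinearMap.toSpanSingleton ℝ X : ℝ →L[ℝ] E) := by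
  have h1 := hγ.self_of_nhds
  have h2 : ∀ g : G, g = 1 → (mulInvariantVectorField X g : E) = X := by
    rintro _ rfl
    exact mulInvariantVectorField_one X
  have h3 : (ContinuousLinearMap.toSpanSingleton ℝ X : ℝ →L[ℝ] E) =
      ContinuousLinearMap.toSpanSingleton ℝ (mulInvariantVectorField X (γ 0) : E) :=
    congrArg (fun v : E => ContinuousLinearMap.toSpanSingleton ℝ v) (h2 _ h0).symm
  exact h1.congr_mfderiv h3.symm

namespace SymmetricPair

variable (P : SymmetricPair E G)

theorem mdifferentiableAt_θ (g : G) : MDifferentiableAt 𝓘(ℝ, E) 𝓘(ℝ, E) P.θ g :=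
  P.contMDiff_θ.mdifferentiable (by simp) g

theorem dθ_eq {f : G → G} (hf : f = P.θ) {y : G} (hy : y = 1) (v : E) :
    (mfderiv 𝓘(ℝ, E) 𝓘(ℝ, E) f y v : E) = P.dθ v := by
  subst hf hy
  rfl

theorem dθ_dθ (X : GroupLieAlgebra 𝓘(ℝ, E) G) : P.dθ (P.dθ X) = X := by
  have h1 : (P.θ : G → G) ∘ P.θ = id := funext P.involutive_θ
  have h2 := mfderiv_comp (x := (1 : G)) (P.mdifferentiableAt_θ _) (P.mdifferentiableAt_θ 1)
  rw [h1, mfderiv_id] at h2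
  exact ((DFunLike.congr_fun h2 X).trans (P.dθ_eq rfl (map_one P.θ) _)).symm

theorem dθ_lieAd (g : G) (X : GroupLieAlgebra 𝓘(ℝ, E) G) :
    P.dθ (lieAd E g X) = lieAd E (P.θ g) (P.dθ X) := by
  have h1 : (P.θ : G → G) ∘ (fun h => g * h * g⁻¹) = (fun h => P.θ g * h * (P.θ g)⁻¹) ∘ P.θ := by
    ext h; simp
  have h2 := mfderiv_comp (x := (1 : G)) (P.mdifferentiableAt_θ _)
    ((contMDiff_conj (E := E) g).mdifferentiable (by simp) 1)
  have h3 := mfderiv_comp (x := (1 : G))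
    ((contMDiff_conj (E := E) (P.θ g)).mdifferentiable (by simp) _) (P.mdifferentiableAt_θ 1)
  rw [h1, h3] at h2
  have h4 : ∀ y : G, y = 1 → ∀ v : E, (mfderiv 𝓘(ℝ, E) 𝓘(ℝ, E)
      (fun h : G => P.θ g * h * (P.θ g)⁻¹) y v : E) = lieAd E (P.θ g) v := by
    rintro _ rfl v
    rfl
  exact (P.dθ_eq rfl (by simp) _).symm.trans
    ((DFunLike.congr_fun h2 X).symm.trans (h4 _ (map_one P.θ) _))

theorem mfderiv_θ_mulInvariantVectorField {X : GroupLieAlgebra 𝓘(ℝ, E) G} (hX : P.dθ X = X)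
    (g : G) : mfderiv 𝓘(ℝ, E) 𝓘(ℝ, E) P.θ g (mulInvariantVectorField X g) =
      mulInvariantVectorField X (P.θ g) := by
  have hm (g h : G) : MDifferentiableAt 𝓘(ℝ, E) 𝓘(ℝ, E) (fun x : G => g * x) h :=
    (contMDiff_mul_left (I := 𝓘(ℝ, E)) (n := ∞)).mdifferentiable (by simp) h
  have h1 : (P.θ : G → G) ∘ (fun h => g * h) = (fun h => P.θ g * h) ∘ P.θ := by
    ext h; simp
  have h2 := mfderiv_comp (x := (1 : G)) (P.mdifferentiableAt_θ _) (hm g 1)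
  have h3 := mfderiv_comp (x := (1 : G)) (hm (P.θ g) _) (P.mdifferentiableAt_θ 1)
  rw [h1, h3] at h2
  have h4 : ∀ y : G, y = 1 → ∀ v : E, (mfderiv 𝓘(ℝ, E) 𝓘(ℝ, E)
      (fun h : G => P.θ g * h) y v : E) = mulInvariantVectorField (I := 𝓘(ℝ, E)) (G := G) v
        (P.θ g) := by
    rintro _ rfl v
    rfl
  have h5 : ∀ y : G, y = g → ∀ v : E, (mfderiv 𝓘(ℝ, E) 𝓘(ℝ, E) P.θ y v : E) =
      mfderiv 𝓘(ℝ, E) 𝓘(ℝ, E) P.θ g v := by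
    rintro _ rfl v
    rfl
  have h6 := (h4 _ (map_one P.θ) _).symm.trans (DFunLike.congr_fun h2 X)
  have h7 : (mulInvariantVectorField X (P.θ g) : E) =
      mulInvariantVectorField (P.dθ X : GroupLieAlgebra 𝓘(ℝ, E) G) (P.θ g) := by rw [hX]
  exact ((h7.trans h6).trans (h5 _ (mul_one g) _)).symm

theorem θ_comp_isMIntegralCurveAt {γ : ℝ → G} {X : GroupLieAlgebra 𝓘(ℝ, E) G} (hX : P.dθ X = X)
    (hγ : IsMIntegralCurveAt γ (mulInvariantVectorField X) 0) :
    IsMIntegralCurveAt (P.θ ∘ γ) (mulInvariantVectorField X) 0 := by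
  filter_upwards [hγ] with t ht
  have h1 := (P.mdifferentiableAt_θ (γ t)).hasMFDerivAt.comp t ht
  refine h1.congr_mfderiv ?_
  refine ContinuousLinearMap.ext_ring ?_
  have h2 : mfderiv 𝓘(ℝ, E) 𝓘(ℝ, E) P.θ (γ t) ((1 : ℝ) • mulInvariantVectorField X (γ t)) =
      (1 : ℝ) • mulInvariantVectorField X (P.θ (γ t)) := by
    rw [one_smul, one_smul]
    exact P.mfderiv_θ_mulInvariantVectorField hX (γ t)
  exact h2

/-- The Lie algebra of `K` contains the fixed points of `θ`. -/
theorem eventually_mem_K [T2Space G] {γ : ℝ → G} {X : GroupLieAlgebra 𝓘(ℝ, E) G} (hX : P.dθ X = X)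
    (h0 : γ 0 = 1) (hγ : IsMIntegralCurveAt γ (mulInvariantVectorField X) 0) :
    ∀ᶠ t in 𝓝 0, γ t ∈ P.K := by
  have : IsManifold 𝓘(ℝ, E) 1 G := IsManifold.of_le (n := ∞) (by simp)
  -- Both curves are integral curves of the same field through `1`, so they agree near `0`.
  have h1 : P.θ ∘ γ =ᶠ[𝓝 0] γ := by
    refine isMIntegralCurveAt_eventuallyEq_of_contMDiffAt_boundaryless (I := 𝓘(ℝ, E))
      (v := mulInvariantVectorField X) ?_ (P.θ_comp_isMIntegralCurveAt hX hγ) hγ ?_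
    · refine (contMDiffAt_mulInvariantVectorField X).of_le ?_
      rw [minSmoothness_of_isRCLikeNormedField]
      exact one_le_two
    · simp [h0]
  obtain ⟨ε, hε, hball⟩ := Metric.eventually_nhds_iff_ball.1 (h1.and hγ)
  refine Metric.eventually_nhds_iff_ball.2 ⟨ε, hε, fun t ht => ?_⟩
  refine P.identityComponent_subset ?_
  -- A connected arc of fixed points through `1` stays in the identity component, hence in `K`.
  have hpre : IsPreconnected (γ '' Metric.ball 0 ε) := by
    refine IsPreconnected.image ?_ γ fun s hs => (hball s hs).2.1.continuousWithinAt
    exact (convex_ball (0 : ℝ) ε).isPreconnected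
  refine hpre.subset_connectedComponentIn ⟨0, Metric.mem_ball_self hε, h0⟩ ?_ ⟨t, ht, rfl⟩
  rintro _ ⟨s, hs, rfl⟩
  exact (hball s hs).1

end SymmetricPair

end AdjointGroup

/-! ### Orthogonal symmetric Lie algebras -/

open Filter Topology

/-- An orthogonal symmetric Lie algebra with a compact group `K` of automorphisms whose Lie algebra
contains the fixed points of the involution. -/
structure OrthogonalSymmetricData (E : Type*) [NormedAddCommGroup E] [NormedSpace ℝ E] where
  ad : E →ₗ[ℝ] E →L[ℝ] E
  ad_self : ∀ X, ad X X = 0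
  ad_ad : ∀ X Y Z, ad X (ad Y Z) = ad (ad X Y) Z + ad Y (ad X Z)
  θ : E →L[ℝ] E
  θ_θ : ∀ X, θ (θ X) = X
  θ_ad : ∀ X Y, θ (ad X Y) = ad (θ X) (θ Y)
  B : LinearMap.BilinForm ℝ E
  B_comm : ∀ X Y, B X Y = B Y X
  B_pos : ∀ X, X ≠ 0 → 0 < B X X
  B_ad : ∀ Z X Y, B (ad Z X) Y = -B X (ad Z Y)
  K : Submonoid (E →L[ℝ] E)
  isCompact_K : IsCompact (K : Set (E →L[ℝ] E))
  inverseClosed_K : K.InverseClosed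
  K_ad : ∀ k ∈ K, ∀ X Y, k (ad X Y) = ad (k X) (k Y)
  K_B : ∀ k ∈ K, ∀ X Y, B (k X) (k Y) = B X Y
  K_θ : ∀ k ∈ K, ∀ X, k (θ X) = θ (k X)
  exp_mem : ∀ X, θ X = X → NormedSpace.exp (ad X) ∈ K

/-- The solutions of a linear differential equation with constant coefficients. -/
theorem exp_smul_apply_of_hasDerivAt {E : Type*} [NormedAddCommGroup E] [NormedSpace ℝ E]
    [CompleteSpace E] {A : E →L[ℝ] E} {v : ℝ → E} (hv : ∀ t, HasDerivAt v (A (v t)) t) (t : ℝ) :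
    NormedSpace.exp (t • A) (v 0) = v t := by
  have h1 : ∀ s, HasDerivAt (fun s => NormedSpace.exp (s • (-A)) (v s)) 0 s := fun s => by
    refine ((hasDerivAt_exp_smul_const (-A) s).clm_apply (hv s)).congr_deriv ?_
    simp
  have h2 : NormedSpace.exp (t • (-A)) (v t) = v 0 := by
    have h3 := is_const_of_deriv_eq_zero (fun s => (h1 s).differentiableAt)
      (fun s => (h1 s).deriv) t 0
    simpa using h3
  rw [← h2, smul_neg]
  exact DFunLike.congr_fun (exp_mul_exp_neg (t • A)) (v t)

namespace OrthogonalSymmetricData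

variable {E : Type*} [NormedAddCommGroup E] [NormedSpace ℝ E] (D : OrthogonalSymmetricData E)

theorem ad_comm (X Y : E) : D.ad X Y = -D.ad Y X := by
  have h := D.ad_self (X + Y)
  simp only [map_add, add_apply, D.ad_self, zero_add, add_zero] at h
  exact eq_neg_of_add_eq_zero_right h

theorem ad_eq_zero_comm {X Y : E} (h : D.ad X Y = 0) : D.ad Y X = 0 := by
  rw [D.ad_comm, h, neg_zero]

theorem eq_zero_of_B {X : E} (h : D.B X X = 0) : X = 0 := by
  by_contra hX
  exact (D.B_pos X hX).ne' h

theorem exists_inverse {k : E →L[ℝ] E} (hk : k ∈ D.K) :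
    ∃ l ∈ D.K, (∀ X, l (k X) = X) ∧ ∀ X, k (l X) = X := by
  obtain ⟨l, hl, h1⟩ := D.inverseClosed_K k hk
  obtain ⟨m, hm, h2⟩ := D.inverseClosed_K l hl
  have h3 : m = k := by
    calc m = m * (l * k) := by rw [h1, mul_one]
      _ = k := by rw [← mul_assoc, h2, one_mul]
  subst h3
  exact ⟨l, hl, DFunLike.congr_fun h1, DFunLike.congr_fun h2⟩

theorem exp_smul_mem {X : E} (hX : D.θ X = X) (t : ℝ) : NormedSpace.exp (t • D.ad X) ∈ D.K := by
  rw [← map_smul]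
  exact D.exp_mem _ (by rw [map_smul, hX])

theorem θ_ad_of_neg {X Y : E} (hX : D.θ X = -X) (hY : D.θ Y = -Y) : D.θ (D.ad X Y) = D.ad X Y := by
  rw [D.θ_ad, hX, hY]; simp

/-- If `ξ` commutes with a finite set of elements, and `H` commutes with them as well, then the
compact stabilizer of the finite set contains an element which moves `ξ` to an element commuting
with `H`. -/
theorem exists_stabilizer_commute [FiniteDimensional ℝ E] {s : Set E} {H ξ : E} (hH : D.θ H = -H)
    (hξ : D.θ ξ = -ξ) (hsH : ∀ Y ∈ s, D.ad H Y = 0) (hsξ : ∀ Y ∈ s, D.ad ξ Y = 0) :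
    ∃ k ∈ D.K, (∀ Y ∈ s, k Y = Y) ∧ D.ad (k ξ) H = 0 := by
  have : CompleteSpace E := FiniteDimensional.complete ℝ E
  set Z : Set (E →L[ℝ] E) := {k | k ∈ D.K ∧ ∀ Y ∈ s, k Y = Y} with hZ
  have hZc : IsCompact Z := by
    have h1 : Z = (D.K : Set (E →L[ℝ] E)) ∩ ⋂ Y ∈ s, {k : E →L[ℝ] E | k Y = Y} := by
      ext k; simp [hZ]
    rw [h1]
    refine D.isCompact_K.inter_right (isClosed_biInter fun Y _ => ?_)
    exact isClosed_eq (ContinuousLinearMap.apply ℝ E Y).continuous continuous_const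
  have hBH : Continuous fun k : E →L[ℝ] E => D.B (k ξ) H := by
    have h1 : Continuous (D.B.flip H) := LinearMap.continuous_of_finiteDimensional _
    exact h1.comp (ContinuousLinearMap.apply ℝ E ξ).continuous
  -- Choose `k` in the compact stabilizer maximizing `B (k ξ) H`; criticality will force `k ξ` to
  -- commute with `H`.
  obtain ⟨k, ⟨hk, hks⟩, hmax⟩ := hZc.exists_isMaxOn ⟨1, D.K.one_mem, fun _ _ => rfl⟩ hBH.continuousOn
  refine ⟨k, hk, hks, ?_⟩
  have hkξ : D.θ (k ξ) = -k ξ := by rw [← D.K_θ k hk, hξ, map_neg]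
  have hkY : ∀ Y ∈ s, D.ad (k ξ) Y = 0 := fun Y hY => by
    conv_lhs => rw [← hks Y hY]
    rw [← D.K_ad k hk, hsξ Y hY, map_zero]
  set X := D.ad (k ξ) H with hX
  have hXθ : D.θ X = X := D.θ_ad_of_neg hkξ hH
  have hXY : ∀ Y ∈ s, D.ad X Y = 0 := fun Y hY => by
    have h := D.ad_ad (k ξ) H Y
    rw [hsH Y hY, hkY Y hY, map_zero, map_zero, add_zero] at h
    exact h.symm
  -- Since `X = [kξ, H]` commutes with `s`, varying `k` along `exp(t ad X)` is admissible.
  have hfix : ∀ t : ℝ, NormedSpace.exp (t • D.ad X) * k ∈ Z := fun t => by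
    refine ⟨D.K.mul_mem (D.exp_smul_mem hXθ t) hk, fun Y hY => ?_⟩
    rw [mul_apply_eq_comp, hks Y hY]
    exact exp_smul_apply_of_hasDerivAt (A := D.ad X) (v := fun _ => Y)
      (fun t => by rw [hXY Y hY]; exact hasDerivAt_const t Y) t
  have hder : HasDerivAt (fun t : ℝ => D.B ((NormedSpace.exp (t • D.ad X) * k) ξ) H)
      (D.B (D.ad X (k ξ)) H) 0 := by
    have h1 : HasDerivAt (fun t : ℝ => (NormedSpace.exp (t • D.ad X) * k) ξ) (D.ad X (k ξ)) 0 := by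
      have h2 := (hasDerivAt_exp_smul_const (D.ad X) (0 : ℝ)).clm_apply (hasDerivAt_const 0 (k ξ))
      simpa using h2
    exact (LinearMap.toContinuousLinearMap (D.B.flip H)).hasFDerivAt.comp_hasDerivAt (0 : ℝ) h1
  have hloc : IsLocalMax (fun t : ℝ => D.B ((NormedSpace.exp (t • D.ad X) * k) ξ) H) 0 :=
    Filter.Eventually.of_forall fun t => by
      have := hmax (hfix t)
      simpa using this
  -- By invariance of `B` the vanishing derivative `B([X, kξ], H)` equals `B X X`.
  have h0 := hloc.hasDerivAt_eq_zero hder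
  refine D.eq_zero_of_B ?_
  have h1 := D.B_ad (k ξ) X H
  rw [D.ad_comm, map_neg, LinearMap.neg_apply, h0, neg_zero] at h1
  rw [← hX] at h1
  linarith

/-- `V` is an abelian subspace of the `(-1)`-eigenspace of the involution. -/
def IsAbelian (V : Submodule ℝ E) : Prop :=
  (∀ X ∈ V, D.θ X = -X) ∧ ∀ X ∈ V, ∀ Y ∈ V, D.ad X Y = 0

/-- Adjoining `X` to `𝔞` keeps it abelian, so maximality applies. -/
theorem mem_of_commute {𝔞 : Submodule ℝ E} (h𝔞 : Maximal D.IsAbelian 𝔞) {X : E} (hX : D.θ X = -X)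
    (h : ∀ H ∈ 𝔞, D.ad X H = 0) : X ∈ 𝔞 := by
  have hV : D.IsAbelian (𝔞 ⊔ ℝ ∙ X) := by
    constructor
    · intro Y hY
      obtain ⟨H, hH, _, hc, rfl⟩ := Submodule.mem_sup.1 hY
      obtain ⟨c, rfl⟩ := Submodule.mem_span_singleton.1 hc
      rw [map_add, map_smul, hX, h𝔞.1.1 H hH, smul_neg, neg_add]
    · intro Y hY Y' hY'
      obtain ⟨H, hH, _, hc, rfl⟩ := Submodule.mem_sup.1 hY
      obtain ⟨c, rfl⟩ := Submodule.mem_span_singleton.1 hc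
      obtain ⟨H', hH', _, hc', rfl⟩ := Submodule.mem_sup.1 hY'
      obtain ⟨c', rfl⟩ := Submodule.mem_span_singleton.1 hc'
      simp [h𝔞.1.2 H hH H' hH', h H' hH', D.ad_eq_zero_comm (h H hH), D.ad_self]
  exact h𝔞.2 hV le_sup_left (Submodule.mem_sup_right (Submodule.mem_span_singleton_self X))

/-- `S` and `T` span, together with `α`, a copy of `𝔰𝔲(2)`. -/
theorem ad_rootPair {𝔞 : Submodule ℝ E} (h𝔞 : Maximal D.IsAbelian 𝔞) {α S T : E} (hα : α ∈ 𝔞)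
    (hS : D.θ S = S) (hT : D.θ T = -T) (h1 : ∀ H ∈ 𝔞, D.ad H S = D.B α H • T)
    (h2 : ∀ H ∈ 𝔞, D.ad H T = -(D.B α H • S)) : D.ad S T = D.B T T • α := by
  -- By the Jacobi identity, `[H, [S, T]]` is a multiple of `[T, T] - [S, S] = 0`. Once `[S, T]` is
  -- in `𝔞`, pairing with `𝔞` determines it.
  have hST : D.ad S T ∈ 𝔞 := by
    refine D.mem_of_commute h𝔞 (by rw [D.θ_ad, hS, hT, map_neg]) fun H hH => ?_
    rw [D.ad_comm, D.ad_ad, h1 H hH, h2 H hH]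
    simp [D.ad_self]
  have hmem : D.ad S T - D.B T T • α ∈ 𝔞 := 𝔞.sub_mem hST (𝔞.smul_mem _ hα)
  have hB : ∀ H ∈ 𝔞, D.B (D.ad S T - D.B T T • α) H = 0 := fun H hH => by
    have h3 : D.B (D.ad S T) H = D.B α H * D.B T T := by
      rw [D.B_ad, D.ad_comm, h1 H hH]
      simp
    rw [map_sub, LinearMap.sub_apply, h3, map_smul, LinearMap.smul_apply, smul_eq_mul]
    ring
  exact sub_eq_zero.1 (D.eq_zero_of_B (hB _ hmem))

/-- The centralizer condition for the normal vectors of an orbit. -/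
theorem ad_eq_zero_of_normal {β ξ : E} (hβ : D.θ β = -β) (hξ : D.θ ξ = -ξ)
    (h : ∀ X, D.θ X = X → D.B ξ (D.ad X β) = 0) : D.ad ξ β = 0 := by
  refine D.eq_zero_of_B ?_
  set X := D.ad ξ β with hX
  -- The hypothesis is tested on `X = [ξ, β]` itself, which is fixed by `θ`; invariance then gives
  -- `B X X = 0`.
  have h1 := h X (D.θ_ad_of_neg hξ hβ)
  have h2 := D.B_ad ξ X β
  rw [D.ad_comm, map_neg, LinearMap.neg_apply, ← hX] at h2
  have h3 := D.B_ad X ξ β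
  rw [h1, neg_zero] at h3
  rw [h3] at h2
  linarith

/-- `α` is a restricted root: `X₁ + √-1 X₂` is a root vector. -/
def IsRestrictedRoot (𝔞 : Submodule ℝ E) (α : E) : Prop :=
  α ∈ 𝔞 ∧ α ≠ 0 ∧ ∃ X₁ X₂ : E, (X₁ ≠ 0 ∨ X₂ ≠ 0) ∧
    ∀ H ∈ 𝔞, D.ad H X₁ = -(D.B α H • X₂) ∧ D.ad H X₂ = D.B α H • X₁

/-- For `H ∈ 𝔞` the operator `ad H` anticommutes with `θ`, so `(X₂ + θX₂, X₁ - θX₁)` and `(X₁ + θX₁,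
θX₂ - X₂)` both satisfy the relations. Their entries recover `2X₁` and `2X₂`, so one of the pairs is
nonzero. -/
theorem IsRestrictedRoot.exists_pair {D : OrthogonalSymmetricData E} {𝔞 : Submodule ℝ E} {α : E}
    (h𝔞 : D.IsAbelian 𝔞) (h : D.IsRestrictedRoot 𝔞 α) :
    ∃ S T : E, (S ≠ 0 ∨ T ≠ 0) ∧ D.θ S = S ∧ D.θ T = -T ∧
      (∀ H ∈ 𝔞, D.ad H S = D.B α H • T) ∧ ∀ H ∈ 𝔞, D.ad H T = -(D.B α H • S) := by
  obtain ⟨-, -, X₁, X₂, hX, hH⟩ := h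
  have hθ : ∀ H ∈ 𝔞, ∀ X, D.ad H (D.θ X) = -D.θ (D.ad H X) := fun H hH X => by
    rw [D.θ_ad, h𝔞.1 H hH, map_neg, neg_apply, neg_neg]
  by_cases h0 : X₂ + D.θ X₂ ≠ 0 ∨ X₁ - D.θ X₁ ≠ 0
  · refine ⟨X₂ + D.θ X₂, X₁ - D.θ X₁, h0, by simp [D.θ_θ, add_comm], by simp [D.θ_θ],
      fun H hH' => ?_, fun H hH' => ?_⟩
    · simp [hθ H hH', (hH H hH').2, sub_eq_add_neg]
    · simp [hθ H hH', (hH H hH').1, smul_add]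
      abel
  · refine ⟨X₁ + D.θ X₁, D.θ X₂ - X₂, ?_, by simp [D.θ_θ, add_comm], by simp [D.θ_θ],
      fun H hH' => ?_, fun H hH' => ?_⟩
    · by_contra hc
      push Not at h0 hc
      have e1 : (2 : ℝ) • X₁ = (X₁ + D.θ X₁) + (X₁ - D.θ X₁) := by rw [two_smul]; abel
      have e2 : (2 : ℝ) • X₂ = (X₂ + D.θ X₂) - (D.θ X₂ - X₂) := by rw [two_smul]; abel
      rw [hc.1, h0.2, add_zero] at e1
      rw [hc.2, h0.1, sub_zero] at e2
      simp at e1 e2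
      simp [e1, e2] at hX
    · simp [hθ H hH', (hH H hH').1, smul_sub]
      abel
    · simp [hθ H hH', (hH H hH').2, smul_add]
      abel

variable [FiniteDimensional ℝ E]

/-- An element commuting with `α` can be moved into a maximal abelian subspace containing `α` by an
element of the stabilizer of `α`. -/
theorem exists_stabilizer_mem {𝔞 : Submodule ℝ E} (h𝔞 : Maximal D.IsAbelian 𝔞) {α ξ : E}
    (hα : α ∈ 𝔞) (hξ : D.θ ξ = -ξ) (hαξ : D.ad ξ α = 0) : ∃ k ∈ D.K, k α = α ∧ k ξ ∈ 𝔞 := by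
  have : CompleteSpace E := FiniteDimensional.complete ℝ E
  -- Generators of `𝔞` are treated one at a time; each new group element fixes `α` and all earlier
  -- generators, so commutation already achieved persists.
  have key : ∀ s : Finset E, (∀ H ∈ s, H ∈ 𝔞) →
      ∃ k ∈ D.K, k α = α ∧ ∀ H ∈ s, D.ad (k ξ) H = 0 := by
    classical
    intro s
    induction s using Finset.induction_on with
    | empty => exact fun _ => ⟨1, D.K.one_mem, rfl, by simp⟩
    | insert H s _ ih =>
      intro hs
      obtain ⟨k, hk, hkα, hks⟩ := ih fun H' hH' => hs H' (Finset.mem_insert_of_mem hH')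
      have hH := hs H (Finset.mem_insert_self H s)
      have hkξ : D.θ (k ξ) = -k ξ := by rw [← D.K_θ k hk, hξ, map_neg]
      obtain ⟨l, hl, hls, hlH⟩ := D.exists_stabilizer_commute (s := insert α (s : Set E))
        (h𝔞.1.1 H hH) hkξ (by
          rintro Y (rfl | hY)
          · exact h𝔞.1.2 H hH Y hα
          · exact h𝔞.1.2 H hH Y (hs Y (Finset.mem_insert_of_mem hY))) (by
          rintro Y (rfl | hY)
          · conv_lhs => rw [← hkα]
            rw [← D.K_ad k hk, hαξ, map_zero]
          · exact hks Y hY)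
      refine ⟨l * k, D.K.mul_mem hl hk, ?_, ?_⟩
      · rw [mul_apply_eq_comp, hkα, hls α (Set.mem_insert _ _)]
      · intro Y hY
        rw [mul_apply_eq_comp]
        rcases Finset.mem_insert.1 hY with rfl | hY
        · exact hlH
        · conv_lhs => rw [← hls Y (Set.mem_insert_of_mem _ hY)]
          rw [← D.K_ad l hl, hks Y hY, map_zero]
  obtain ⟨s, hs⟩ := (IsNoetherian.noetherian 𝔞 : 𝔞.FG)
  obtain ⟨k, hk, hkα, hks⟩ := key s fun H hH => hs ▸ Submodule.subset_span hH
  refine ⟨k, hk, hkα, D.mem_of_commute h𝔞 (by rw [← D.K_θ k hk, hξ, map_neg]) fun H hH => ?_⟩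
  rw [← hs] at hH
  have hle : Submodule.span ℝ (s : Set E) ≤ LinearMap.ker (D.ad (k ξ)).toLinearMap :=
    Submodule.span_le.2 hks
  exact hle hH

/-- The reflection in the hyperplane orthogonal to a root `α`. -/
theorem exists_reflection {𝔞 : Submodule ℝ E} (h𝔞 : Maximal D.IsAbelian 𝔞) {α S T : E}
    (hα : α ∈ 𝔞) (hα0 : α ≠ 0) (hST : S ≠ 0 ∨ T ≠ 0)
    (hS : D.θ S = S) (hT : D.θ T = -T) (h1 : ∀ H ∈ 𝔞, D.ad H S = D.B α H • T)
    (h2 : ∀ H ∈ 𝔞, D.ad H T = -(D.B α H • S)) :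
    ∃ k ∈ D.K, k α = -α ∧ ∀ ξ ∈ 𝔞, D.B α ξ = 0 → k ξ = ξ := by
  have : CompleteSpace E := FiniteDimensional.complete ℝ E
  have ha := D.B_pos α hα0
  have hT0 : T ≠ 0 := by
    rintro rfl
    have h3 := h2 α hα
    simp [ha.ne'] at h3
    simp [h3] at hST
  have hc := D.B_pos T hT0
  set a := D.B α α
  set c := D.B T T
  have hSα : D.ad S α = -(a • T) := by rw [D.ad_comm, h1 α hα]
  have hSTα : D.ad S T = c • α := D.ad_rootPair h𝔞 hα hS hT h1 h2
  -- On the plane of `α` and `T` the operator `ad S` sends `α` to `-aT` and `T` to `cα`, so its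
  -- square is `-ac = -w²`. At time `π / w` the flow is a half turn.
  obtain ⟨w, hw, hw2⟩ : ∃ w : ℝ, 0 < w ∧ w * w = a * c :=
    ⟨√(a * c), by positivity, Real.mul_self_sqrt (by positivity)⟩
  refine ⟨_, D.exp_smul_mem hS (Real.pi / w), ?_, fun ξ hξ hαξ => ?_⟩
  · have hv : ∀ t : ℝ, HasDerivAt
        (fun t : ℝ => Real.cos (w * t) • α - ((a / w) * Real.sin (w * t)) • T)
        (D.ad S (Real.cos (w * t) • α - ((a / w) * Real.sin (w * t)) • T)) t := fun t => by
      have hw' : HasDerivAt (fun t : ℝ => w * t) w t := by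
        simpa using (hasDerivAt_id t).const_mul w
      refine (((hw'.cos).smul_const α).sub
        (((hw'.sin).const_mul (a / w)).smul_const T)).congr_deriv ?_
      have h3 : a / w * c = w := by field_simp; linarith [hw2]
      simp only [map_sub, map_smul, hSα, hSTα]
      have h4 : a / w * (Real.cos (w * t) * w) = Real.cos (w * t) * a := by field_simp
      rw [h4, smul_smul, mul_right_comm (a / w), h3, smul_neg, smul_smul, neg_mul, neg_smul,
        mul_comm (Real.sin _)]
      abel
    have h3 := exp_smul_apply_of_hasDerivAt hv (Real.pi / w)
    have h4 : w * (Real.pi / w) = Real.pi := by field_simp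
    simpa [h4] using h3
  · refine exp_smul_apply_of_hasDerivAt (A := D.ad S) (v := fun _ => ξ) (fun t => ?_) _
    rw [D.ad_comm, h1 ξ hξ, hαξ, zero_smul, neg_zero]
    exact hasDerivAt_const t ξ

/-- For each point `β` of the orbit of a restricted root and each normal vector `ξ ⊥ β` there is an
element of the isotropy group which maps `β` to `-β` and fixes `ξ`. -/
theorem exists_neg_fix {𝔞 : Submodule ℝ E} (h𝔞 : Maximal D.IsAbelian 𝔞) {α : E}
    (hα : D.IsRestrictedRoot 𝔞 α) {g : E →L[ℝ] E} (hg : g ∈ D.K) {ξ : E} (hξ : D.θ ξ = -ξ)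
    (hgξ : D.ad ξ (g α) = 0) (hB : D.B (g α) ξ = 0) :
    ∃ k ∈ D.K, k (g α) = -g α ∧ k ξ = ξ := by
  obtain ⟨g', hg', hgl, hgr⟩ := D.exists_inverse hg
  obtain ⟨S, T, h0, hS, hT, h1, h2⟩ := hα.exists_pair h𝔞.1
  obtain ⟨r, hr, hrα, hrf⟩ := D.exists_reflection h𝔞 hα.1 hα.2.1 h0 hS hT h1 h2
  obtain ⟨m, hm, hmα, hmξ⟩ := D.exists_stabilizer_mem h𝔞 hα.1 (ξ := g' ξ)
    (by rw [← D.K_θ g' hg', hξ, map_neg]) (by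
      have h3 := D.K_ad g' hg' ξ (g α)
      rwa [hgξ, map_zero, hgl, eq_comm] at h3)
  obtain ⟨m', hm', hml, hmr⟩ := D.exists_inverse hm
  have hm'α : m' α = α := by
    conv_lhs => rw [← hmα]
    exact hml α
  have hrm : r (m (g' ξ)) = m (g' ξ) := by
    refine hrf _ hmξ ?_
    have h3 := D.K_B m hm α (g' ξ)
    have h4 := D.K_B g' hg' (g α) ξ
    rw [hmα] at h3
    rw [hgl] at h4
    rw [h3, h4, hB]
  -- Carry `gα` back to `α`, move the normal vector into `𝔞` with `α` fixed, reflect, and undo both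
  -- moves.
  refine ⟨g * m' * r * m * g', D.K.mul_mem (D.K.mul_mem (D.K.mul_mem (D.K.mul_mem hg hm') hr) hm)
    hg', ?_, ?_⟩
  · simp [hgl, hmα, hrα, hm'α]
  · simp [hrm, hml, hgr]

end OrthogonalSymmetricData

/-! ### The symmetric Lie algebra of a compact symmetric pair -/

section SymmetricPairData

set_option linter.unusedSectionVars false

open Filter Topology

variable {E : Type*} [NormedAddCommGroup E] [NormedSpace ℝ E] [FiniteDimensional ℝ E]
  {G : Type*} [TopologicalSpace G] [ChartedSpace E G] [Group G] [LieGroup 𝓘(ℝ, E) ∞ G]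

theorem exists_curve (G : Type*) [TopologicalSpace G] [ChartedSpace E G] [Group G]
    [LieGroup 𝓘(ℝ, E) ∞ G] (X : E) : ∃ γ : ℝ → G, γ 0 = 1 ∧
    HasMFDerivAt 𝓘(ℝ, ℝ) 𝓘(ℝ, E) γ 0 (ContinuousLinearMap.toSpanSingleton ℝ X : ℝ →L[ℝ] E) := by
  obtain ⟨γ, h0, hγ⟩ := exists_integralCurve (G := G) X
  exact ⟨γ, h0, hasMFDerivAt_of_isMIntegralCurveAt h0 hγ⟩

/-- Differentiate `A ∘ Ad(γ t) = Ad(σ(γ t)) ∘ A` along a curve with velocity `X` at `1`. Both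
conjugations and `θ` are instances. -/
theorem map_adLie {σ : G → G} (h1 : σ 1 = 1) {A : E →L[ℝ] E}
    (hσ : HasMFDerivAt 𝓘(ℝ, E) 𝓘(ℝ, E) σ 1 A)
    (h : ∀ g Y, A (adRep E g Y) = adRep E (σ g) (A Y)) (X Y : E) :
    A (adLie G X Y) = adLie G (A X) (A Y) := by
  obtain ⟨γ, h0, hγ⟩ := exists_curve G X
  have hσγ : HasMFDerivAt 𝓘(ℝ, ℝ) 𝓘(ℝ, E) (σ ∘ γ) 0
      (ContinuousLinearMap.toSpanSingleton ℝ (A X) : ℝ →L[ℝ] E) := by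
    have h2 : HasMFDerivAt 𝓘(ℝ, E) 𝓘(ℝ, E) σ (γ 0) A := by
      rw [h0]; exact hσ
    refine (h2.comp (0 : ℝ) hγ).congr_mfderiv ?_
    refine ContinuousLinearMap.ext_ring ?_
    exact ((congrArg A (one_smul ℝ X)).trans (one_smul ℝ (A X)).symm)
  have h3 := (hasDerivAt_adRep h0 hγ).clm_apply (hasDerivAt_const 0 Y)
  have h4 := (hasDerivAt_adRep (γ := σ ∘ γ) (by simp [h0, h1]) hσγ).clm_apply
    (hasDerivAt_const 0 (A Y))
  have h5 := A.hasFDerivAt.comp_hasDerivAt (0 : ℝ) h3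
  have h6 : (fun t => A (adRep E (γ t) Y)) = fun t => adRep E (σ (γ t)) (A Y) :=
    funext fun t => h _ _
  have h7 := h5.unique (h6 ▸ h4)
  simpa using h7

theorem adRep_adLie (g : G) (X Y : E) :
    adRep E g (adLie G X Y) = adLie G (adRep E g X) (adRep E g Y) := by
  refine map_adLie (σ := fun h => g * h * g⁻¹) (by simp)
    ((contMDiff_conj (E := E) g).mdifferentiable (by simp) 1).hasMFDerivAt (fun h Y => ?_) X Y
  have h1 : adRep E (g * h * g⁻¹) * adRep E g = adRep E g * adRep E h := by
    rw [← adRep_mul, ← adRep_mul, inv_mul_cancel_right]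
  exact (DFunLike.congr_fun h1 Y).symm

/-- The infinitesimal form of `Ad`-invariance, by differentiating along a curve with velocity `Z`.
-/
theorem form_adLie {B : LinearMap.BilinForm ℝ E}
    (hB : ∀ (g : G) X Y, B (adRep E g X) (adRep E g Y) = B X Y) (Z X Y : E) :
    B (adLie G Z X) Y = -B X (adLie G Z Y) := by
  obtain ⟨γ, h0, hγ⟩ := exists_curve G Z
  have h3 (X : E) : HasDerivAt (fun t => adRep E (γ t) X) (adLie G Z X) 0 := by
    simpa using (hasDerivAt_adRep h0 hγ).clm_apply (hasDerivAt_const 0 X)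
  have h5 := (B.toContinuousBilinearMap.hasFDerivAt.comp_hasDerivAt (0 : ℝ) (h3 X)).clm_apply (h3 Y)
  have h6 : (fun t => B.toContinuousBilinearMap (adRep E (γ t) X) (adRep E (γ t) Y)) =
    fun _ => B X Y := funext fun t => hB _ _ _
  have h7 := h5.unique (h6 ▸ hasDerivAt_const (0 : ℝ) (B X Y))
  have h8 : B (adLie G Z X) (adRep E (γ 0) Y) + B (adRep E (γ 0) X) (adLie G Z Y) = 0 := h7
  rw [h0, adRep_one] at h8
  exact eq_neg_of_add_eq_zero_left h8

theorem adLie_smul (c : ℝ) (X : E) : adLie G (c • X) = c • adLie G X := by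
  ext Y
  exact smul_lie (L := GroupLieAlgebra 𝓘(ℝ, E) G) (M := GroupLieAlgebra 𝓘(ℝ, E) G) c X Y

theorem adLie_add (X X' : E) : adLie G (X + X') = adLie G X + adLie G X' := by
  ext Y
  exact add_lie (L := GroupLieAlgebra 𝓘(ℝ, E) G) (M := GroupLieAlgebra 𝓘(ℝ, E) G) X X' Y

variable (E G) in
/-- The adjoint representation as a homomorphism. -/
noncomputable def adHom : G →* (E →L[ℝ] E) where
  toFun := adRep E
  map_one' := adRep_one
  map_mul' := adRep_mul

/-- Real and imaginary part of an element of the complexification of a Lie algebra. -/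
theorem exists_re_im {L : Type*} [LieRing L] [LieAlgebra ℝ L] (X : ℂ ⊗[ℝ] L) :
    ∃ X₁ X₂ : L, (X ≠ 0 → X₁ ≠ 0 ∨ X₂ ≠ 0) ∧ ∀ (H : L) (c : ℝ),
      ⁅(1 : ℂ) ⊗ₜ[ℝ] H, X⁆ = (Complex.I * (c : ℂ)) • X → ⁅H, X₁⁆ = -(c • X₂) ∧ ⁅H, X₂⁆ = c • X₁ := by
  set re : ℂ ⊗[ℝ] L →ₗ[ℝ] L := (TensorProduct.lid ℝ L).toLinearMap ∘ₗ Complex.reLm.rTensor L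
    with hre
  set im : ℂ ⊗[ℝ] L →ₗ[ℝ] L := (TensorProduct.lid ℝ L).toLinearMap ∘ₗ Complex.imLm.rTensor L
    with him
  have re_tmul (z : ℂ) (Y : L) : re (z ⊗ₜ Y) = z.re • Y := by simp [hre]
  have im_tmul (z : ℂ) (Y : L) : im (z ⊗ₜ Y) = z.im • Y := by simp [him]
  have hdec (X : ℂ ⊗[ℝ] L) : X = 1 ⊗ₜ re X + Complex.I ⊗ₜ im X := by
    induction X using TensorProduct.induction_on with
    | zero => simp
    | tmul z Y =>
      rw [re_tmul, im_tmul, ← TensorProduct.smul_tmul, ← TensorProduct.smul_tmul,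
        ← TensorProduct.add_tmul]
      congr 1
      apply Complex.ext <;> simp
    | add X Y hX hY =>
      conv_lhs => rw [hX, hY]
      rw [map_add, map_add, TensorProduct.tmul_add, TensorProduct.tmul_add]
      abel
  have hlie (H : L) (X : ℂ ⊗[ℝ] L) :
      re ⁅(1 : ℂ) ⊗ₜ[ℝ] H, X⁆ = ⁅H, re X⁆ ∧ im ⁅(1 : ℂ) ⊗ₜ[ℝ] H, X⁆ = ⁅H, im X⁆ := by
    induction X using TensorProduct.induction_on with
    | zero =>
      have h0 : ⁅(1 : ℂ) ⊗ₜ[ℝ] H, (0 : ℂ ⊗[ℝ] L)⁆ = 0 := lie_zero (L := ℂ ⊗[ℝ] L) _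
      simp [h0]
    | tmul z Y => simp [re_tmul, im_tmul]
    | add X Y hX hY =>
      have h0 : ⁅(1 : ℂ) ⊗ₜ[ℝ] H, X + Y⁆ = ⁅(1 : ℂ) ⊗ₜ[ℝ] H, X⁆ + ⁅(1 : ℂ) ⊗ₜ[ℝ] H, Y⁆ :=
        lie_add (L := ℂ ⊗[ℝ] L) _ _ _
      simp [h0, hX.1, hX.2, hY.1, hY.2]
  have hsmul (z : ℂ) (X : ℂ ⊗[ℝ] L) : re (z • X) = z.re • re X - z.im • im X ∧
      im (z • X) = z.im • re X + z.re • im X := by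
    induction X using TensorProduct.induction_on with
    | zero => simp
    | tmul w Y =>
      rw [TensorProduct.smul_tmul', re_tmul, im_tmul, re_tmul, im_tmul, smul_smul, smul_smul,
        smul_smul, smul_smul, ← sub_smul, ← add_smul, smul_eq_mul, Complex.mul_re, Complex.mul_im]
      exact ⟨rfl, by rw [add_comm]⟩
    | add X Y hX hY =>
      rw [smul_add, map_add, map_add, map_add, map_add, hX.1, hX.2, hY.1, hY.2, smul_add, smul_add,
        smul_add, smul_add]
      constructor <;> abel
  refine ⟨re X, im X, fun hX => ?_, fun H c h => ?_⟩
  · by_contra hc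
    push Not at hc
    exact hX (by rw [hdec X, hc.1, hc.2]; simp)
  · rw [← (hlie H X).1, ← (hlie H X).2, h, (hsmul _ X).1, (hsmul _ X).2]
    simp

namespace SymmetricPair

variable (P : SymmetricPair E G)

theorem dθ_adLie (X Y : E) : P.dθ (adLie G X Y) = adLie (E := E) G (P.dθ X) (P.dθ Y) :=
  map_adLie (E := E) (A := (P.dθ : E →L[ℝ] E)) (map_one P.θ) (P.mdifferentiableAt_θ 1).hasMFDerivAt
    (fun g Y => P.dθ_lieAd g Y) X Y

/-- The group `Ad(K)`. -/
noncomputable def adK : Submonoid (E →L[ℝ] E) := P.K.toSubmonoid.map (adHom E G)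

theorem isCompact_adK [CompactSpace G] : IsCompact (P.adK : Set (E →L[ℝ] E)) :=
  P.isClosed_K.isCompact.image continuous_adRep

theorem inverseClosed_adK : P.adK.InverseClosed := by
  rintro _ ⟨k, hk, rfl⟩
  refine ⟨_, ⟨k⁻¹, P.K.inv_mem hk, rfl⟩, ?_⟩
  rw [← map_mul, inv_mul_cancel, map_one]

/-- The curve `Ad(γ t)` stays in the compact group `Ad(K)` near `t = 0` and has velocity `ad X` at
the identity, so the closed-group lemma applies without an exponential map on `G`. -/
theorem exp_mem_adK [T2Space G] [CompactSpace G] {X : E} (hX : P.dθ X = X) :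
    NormedSpace.exp (adLie G X) ∈ P.adK := by
  have : CompleteSpace E := FiniteDimensional.complete ℝ E
  obtain ⟨γ, h0, hγ⟩ := exists_integralCurve (G := G) X
  have h1 := exp_smul_mem_of_hasDerivAt P.isCompact_adK.isClosed P.inverseClosed_adK
    (by rw [h0, adRep_one]) (hasDerivAt_adRep h0 (hasMFDerivAt_of_isMIntegralCurveAt h0 hγ))
    ((P.eventually_mem_K hX h0 hγ).mono fun t ht => ⟨γ t, ht, rfl⟩) 1
  rwa [one_smul] at h1

/-- The orthogonal symmetric Lie algebra of a compact symmetric pair. -/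
noncomputable def data [T2Space G] [CompactSpace G] (B : P.InvariantInner) :
    OrthogonalSymmetricData E where
  ad := { toFun := adLie G, map_add' := adLie_add, map_smul' := adLie_smul }
  ad_self X := lie_self (L := GroupLieAlgebra 𝓘(ℝ, E) G) X
  ad_ad X Y Z := leibniz_lie (L₁ := GroupLieAlgebra 𝓘(ℝ, E) G) (L₂ := GroupLieAlgebra 𝓘(ℝ, E) G)
    (M := GroupLieAlgebra 𝓘(ℝ, E) G) X Y Z
  θ := P.dθ
  θ_θ := P.dθ_dθ
  θ_ad := P.dθ_adLie
  B := B.form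
  B_comm := B.symm
  B_pos := B.pos
  B_ad := form_adLie (G := G) B.ad_inv
  K := P.adK
  isCompact_K := P.isCompact_adK
  inverseClosed_K := P.inverseClosed_adK
  K_ad := by
    rintro _ ⟨k, -, rfl⟩
    exact adRep_adLie k
  K_B := by
    rintro _ ⟨k, -, rfl⟩
    exact B.ad_inv k
  K_θ := by
    rintro _ ⟨k, hk, rfl⟩ X
    have h : P.θ k = k := P.K_subset hk
    refine ((P.dθ_lieAd k X).trans ?_).symm
    rw [h]
    rfl
  exp_mem X := P.exp_mem_adK

theorem IsMaximalAbelian.data [T2Space G] [CompactSpace G] {B : P.InvariantInner}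
    {𝔞 : Submodule ℝ (GroupLieAlgebra 𝓘(ℝ, E) G)} (h : P.IsMaximalAbelian 𝔞) :
    Maximal (P.data B).IsAbelian 𝔞 := h

theorem isRestrictedRoot_data [T2Space G] [CompactSpace G] {B : P.InvariantInner}
    {𝔞 : Submodule ℝ (GroupLieAlgebra 𝓘(ℝ, E) G)} {α : GroupLieAlgebra 𝓘(ℝ, E) G}
    (h : α ∈ P.restrictedRoots B 𝔞) : (P.data B).IsRestrictedRoot 𝔞 α := by
  obtain ⟨h1, h2, X, hX, h⟩ := h
  obtain ⟨X₁, X₂, h0, hX'⟩ := exists_re_im X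
  exact ⟨h1, h2, X₁, X₂, h0 hX, fun H hH => hX' H _ (h H hH)⟩

end SymmetricPair

end SymmetricPairData

/-! ### A linear criterion for weak reflectivity of orbits in `ℂPⁿ` -/

section WeaklyReflectiveOrbit

open Filter Topology

namespace CPn

variable {n : ℕ}

local notation "𝓥" => EuclideanSpace ℂ (Fin (n + 1))
local notation "𝓤" => EuclideanSpace ℂ (Fin n)

theorem inner_real_eq_re {m : ℕ} (u v : EuclideanSpace ℂ (Fin m)) :
    inner ℝ u v = (inner ℂ u v).re := by
  simp [PiLp.inner_apply, Complex.inner]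

theorem inner_tail (u : 𝓤) (w : 𝓥) : inner ℂ u (tail w) = inner ℂ (zeroCons u) w := by
  simp only [PiLp.inner_apply, Fin.sum_univ_succ]
  simp [tail_apply]

variable {H : Subgroup (EuclideanSpace ℂ (Fin (n + 1)) ≃ₗᵢ[ℂ] EuclideanSpace ℂ (Fin (n + 1)))}

/-- The orbit of `[v]` under a compact group of unitary transformations is weakly reflective if for
each `w` in the orbit of `v`, each vector orthogonal to `w` and normal to the orbit is fixed by some
element of the group which maps `w` to `-w`. -/
theorem isWeaklyReflective_orbit (hH : IsCompact (clm '' (H : Set (𝓥 ≃ₗᵢ[ℂ] 𝓥))))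
    (v : {v : 𝓥 // v ≠ 0})
    (h : ∀ W ∈ H, ∀ ζ : 𝓥, inner ℂ (W v.1) ζ = 0 →
      (∀ (U : ℝ → 𝓥 ≃ₗᵢ[ℂ] 𝓥) (w' : 𝓥), U 0 = 1 → (∀ t, U t ∈ H) →
        HasDerivAt (fun t => U t (W v.1)) w' 0 → (inner ℂ ζ w').re = 0) →
      ∃ U ∈ H, U (W v.1) = -W v.1 ∧ U ζ = ζ) :
    IsWeaklyReflective (fubiniStudy n) {q | ∃ U ∈ H, q = act U (proj v)} := by
  refine ⟨isSubmanifold_orbit hH _, ?_⟩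
  rintro p ⟨W, hW, hp⟩ (u : 𝓤) hu
  obtain ⟨c, hc⟩ : ∃ c : ℂ, c • W v.1 = frame p (cone 0) := by
    have h1 : proj ⟨frame p (cone 0), frame_cone_ne_zero p⟩ =
        proj ⟨W v.1, by simpa using v.2⟩ := by
      rw [← act_proj W v, ← hp]
      exact frame_spec p
    exact proj_eq_iff.1 h1
  have hc0 : c ≠ 0 := by
    rintro rfl
    exact frame_cone_ne_zero p (by rw [← hc, zero_smul])
  have hcc : (starRingEnd ℂ) c ≠ 0 := by simpa using hc0
  -- The horizontal lift of `u`, rescaled because `W v` differs from the unit frame vector by the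
  -- factor `c`; the conjugate moves `c` across the inner product in `hnormal`.
  set ζ : 𝓥 := (starRingEnd ℂ) c • frame p (zeroCons u) with hζ
  have hζw : inner ℂ (W v.1) ζ = 0 := by
    have h1 : inner ℂ (c • W v.1) ζ = 0 := by
      rw [hc, hζ, inner_smul_right, LinearIsometryEquiv.inner_map_map, inner_cone_zero,
        zeroCons_zero, mul_zero]
    rw [inner_smul_left] at h1
    exact (mul_eq_zero.1 h1).resolve_left hcc
  have hnormal : ∀ (U : ℝ → 𝓥 ≃ₗᵢ[ℂ] 𝓥) (w' : 𝓥), U 0 = 1 → (∀ t, U t ∈ H) →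
      HasDerivAt (fun t => U t (W v.1)) w' 0 → (inner ℂ ζ w').re = 0 := by
    intro U w' h0 hUH hw'
    have hS : ∀ᶠ t in 𝓝 (0 : ℝ), act (U t) p ∈ {q | ∃ U ∈ H, q = act U (proj v)} :=
      Eventually.of_forall fun t => ⟨U t * W, H.mul_mem (hUH t) hW, by rw [hp, act_mul]⟩
    have hd : HasDerivAt (fun t => U t (frame p (cone 0))) (c • w') 0 := by
      simp only [← hc, map_smul]
      exact hw'.const_smul c
    have h1 := hu _ (tail_mem_tangentVectors h0 hS hd)
    have h2 : inner ℝ (u : 𝓤) (tail ((frame p).symm (c • w'))) = 0 := h1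
    rw [inner_real_eq_re, inner_tail, ← LinearIsometryEquiv.inner_map_map (frame p),
      LinearIsometryEquiv.apply_symm_apply, inner_smul_right] at h2
    rw [hζ, inner_smul_left, Complex.conj_conj]
    exact h2
  obtain ⟨U, hU, hUw, hUζ⟩ := h W hW ζ hζw hnormal
  have hUF : U (frame p (cone 0)) = -frame p (cone 0) := by
    rw [← hc, map_smul, hUw, smul_neg]
  have hUz : U (frame p (zeroCons u)) = frame p (zeroCons u) := by
    have h1 := hUζ
    rw [hζ, map_smul] at h1
    exact smul_right_injective _ hcc h1
  have hσ (q : CPn n) : actDiffeo U q = act U q := rfl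
  have hUp : act U p = p := by
    conv_lhs => rw [← frame_spec p]
    conv_rhs => rw [← frame_spec p]
    rw [act_proj, act_proj, proj_eq_iff]
    exact ⟨-1, by simp [hUF]⟩
  refine ⟨actDiffeo U, isRiemannianIsometry_actDiffeo U, hUp, ?_, ?_⟩
  -- `U` is `-1` on the line `p` and fixes the lift of `u`, so the differential sends `u` to `-u`.
  · have h1 := mfderiv_act U p (c := -1) (by rw [hUp, hUF]; simp) u
    refine h1.trans ?_
    have h2 : tail ((frame (act U p)).symm (U (frame p (zeroCons u)))) = (u : 𝓤) := by
      rw [hUp, hUz, LinearIsometryEquiv.symm_apply_apply, tail_zeroCons]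
    rw [h2]
    simp only [inv_neg, inv_one, neg_smul, one_smul]
    rfl
  · ext q
    constructor
    · rintro ⟨_, ⟨V, hV, rfl⟩, rfl⟩
      exact ⟨U * V, H.mul_mem hU hV, by rw [hσ, act_mul]⟩
    · rintro ⟨V, hV, rfl⟩
      refine ⟨_, ⟨U⁻¹ * V, H.mul_mem (H.inv_mem hU) hV, rfl⟩, ?_⟩
      rw [hσ, ← act_mul, mul_inv_cancel_left]

end CPn

end WeaklyReflectiveOrbit

/-! ### Unitary coordinates for an orthogonal complex structure -/

section HermitianVectorSpace

/-- A Euclidean vector space with an orthogonal complex structure is isometric to `ℂⁿ⁺¹`. -/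
theorem exists_hermitian_equiv {V : Type*} [AddCommGroup V] [Module ℝ V] [FiniteDimensional ℝ V]
    [Nontrivial V] (J : V →ₗ[ℝ] V) (hJ : ∀ X, J (J X) = -X) (B : LinearMap.BilinForm ℝ V)
    (hB : ∀ X Y, B X Y = B Y X) (hpos : ∀ X, X ≠ 0 → 0 < B X X)
    (hJB : ∀ X Y, B (J X) (J Y) = B X Y) :
    ∃ (n : ℕ) (Φ : V ≃ₗ[ℝ] EuclideanSpace ℂ (Fin (n + 1))),
      (∀ X, Φ (J X) = Complex.I • Φ X) ∧ ∀ X, ‖Φ X‖ ^ 2 = B X X := by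
  have hskew (X Y : V) : B X (J Y) = -B (J X) Y := by
    rw [← hJB X (J Y), hJ, map_neg]
  let iM : Module ℂ V := Module.compHom V
    (Complex.lift ⟨(J : Module.End ℝ V), by ext X; exact hJ X⟩ : ℂ →ₐ[ℝ] Module.End ℝ V).toRingHom
  have hsmul (z : ℂ) (X : V) : z • X = z.re • X + z.im • J X := by
    change (Complex.lift ⟨(J : Module.End ℝ V), _⟩ : ℂ →ₐ[ℝ] Module.End ℝ V) z X = _
    rw [Complex.lift_apply, Complex.liftAux_apply]
    simp
  have hI (X : V) : Complex.I • X = J X := by rw [hsmul]; simp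
  have hre (r : ℝ) (X : V) : (r : ℂ) • X = r • X := by rw [hsmul]; simp
  -- The Hermitian form is `B(X, Y) + √-1 B(JX, Y)`, conjugate linear in the first variable.
  let core : InnerProductSpace.Core ℂ V :=
    { inner := fun X Y => ⟨B X Y, B (J X) Y⟩
      conj_inner_symm := fun X Y => by
        apply Complex.ext
        · exact hB Y X
        · change -B (J Y) X = B (J X) Y
          rw [hB (J Y), hskew, neg_neg]
      re_inner_nonneg := fun X => by
        change 0 ≤ B X X
        rcases eq_or_ne X 0 with rfl | hX
        · simp
        · exact (hpos X hX).le
      add_left := fun X Y Z => by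
        apply Complex.ext
        · change B (X + Y) Z = B X Z + B Y Z
          simp
        · change B (J (X + Y)) Z = B (J X) Z + B (J Y) Z
          simp
      smul_left := fun X Y z => by
        rw [hsmul]
        apply Complex.ext
        · simp
        · simp [hJ]
      definite := fun X hX => by
        by_contra h0
        exact (hpos X h0).ne' (congrArg Complex.re hX) }
  let iN : NormedAddCommGroup V := core.toNormedAddCommGroup
  let iI : InnerProductSpace ℂ V := InnerProductSpace.ofCore core.toCore
  have : IsScalarTower ℝ ℂ V := ⟨fun r z X => by
    rw [hsmul, hsmul z, smul_add, smul_smul, smul_smul]; simp⟩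
  have : FiniteDimensional ℂ V := FiniteDimensional.right ℝ ℂ V
  obtain ⟨n, hn⟩ : ∃ n, Module.finrank ℂ V = n + 1 :=
    Nat.exists_eq_succ_of_ne_zero (Module.finrank_pos (R := ℂ) (M := V)).ne'
  let e : V ≃ₗᵢ[ℂ] EuclideanSpace ℂ (Fin (n + 1)) :=
    ((stdOrthonormalBasis ℂ V).reindex (finCongr hn)).repr
  refine ⟨n, { e.toLinearEquiv.toAddEquiv with map_smul' := fun r X => ?_ }, fun X => ?_, fun X => ?_⟩
  · change e (r • X) = r • e X
    rw [← hre, map_smul]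
    ext j
    simp
  · change e (J X) = Complex.I • e X
    rw [← hI, map_smul]
  · change ‖e X‖ ^ 2 = B X X
    rw [e.norm_map, ← inner_self_eq_norm_sq (𝕜 := ℂ)]
    rfl

end HermitianVectorSpace

/-! ### `K` as a compact group of unitary transformations -/

section IsotropyUnitary

open Filter Topology CPn

variable {E : Type*} [NormedAddCommGroup E] [NormedSpace ℝ E] {n : ℕ}

local notation "𝓥" => EuclideanSpace ℂ (Fin (n + 1))

namespace OrthogonalSymmetricData

/-- A parametrization of the `(-1)`-eigenspace by the Hermitian vector space `ℂⁿ⁺¹` for which `K`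
acts by complex linear isometries. -/
structure HermitianParam (D : OrthogonalSymmetricData E) (n : ℕ) where
  ι : EuclideanSpace ℂ (Fin (n + 1)) →ₗ[ℝ] E
  mem_range : ∀ X, D.θ X = -X → ∃ v, ι v = X
  θ_ι : ∀ v, D.θ (ι v) = -ι v
  B_ι : ∀ v w, D.B (ι v) (ι w) = (inner ℂ v w).re
  I_comm : ∀ A ∈ D.K, ∀ v w, ι w = A (ι v) → ι (Complex.I • w) = A (ι (Complex.I • v))

variable {D : OrthogonalSymmetricData E} (p : D.HermitianParam n)

namespace HermitianParam

theorem injective : Function.Injective p.ι := by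
  refine (injective_iff_map_eq_zero _).2 fun v hv => ?_
  have h := p.B_ι v v
  rw [hv, map_zero] at h
  refine inner_self_eq_zero (𝕜 := ℂ).1 ?_
  apply Complex.ext
  · exact h.symm
  · exact inner_self_im (𝕜 := ℂ) v

/-- The left inverse of the parametrization. -/
noncomputable def π : E →ₗ[ℝ] 𝓥 :=
  (p.ι.exists_leftInverse_of_injective (LinearMap.ker_eq_bot.2 p.injective)).choose

theorem π_ι (v : 𝓥) : p.π (p.ι v) = v :=
  DFunLike.congr_fun
    (p.ι.exists_leftInverse_of_injective (LinearMap.ker_eq_bot.2 p.injective)).choose_spec v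

theorem ι_π {X : E} (hX : D.θ X = -X) : p.ι (p.π X) = X := by
  obtain ⟨v, rfl⟩ := p.mem_range X hX
  rw [p.π_ι]

theorem ι_π_apply {A : E →L[ℝ] E} (hA : A ∈ D.K) (v : 𝓥) : p.ι (p.π (A (p.ι v))) = A (p.ι v) :=
  p.ι_π (by rw [← D.K_θ A hA, p.θ_ι, map_neg])

/-- The unitary transformation defined by an element of `K`. -/
noncomputable def unitary {A : E →L[ℝ] E} (hA : A ∈ D.K) : 𝓥 ≃ₗᵢ[ℂ] 𝓥 :=
  LinearIsometry.toLinearIsometryEquiv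
    { toFun := fun v => p.π (A (p.ι v))
      map_add' := fun v w => by simp
      map_smul' := fun z v => by
        have h1 : ∀ (r : ℝ) (w : 𝓥), (r : ℂ) • w = r • w := fun r w => by ext j; simp
        have h2 : z • v = z.re • v + z.im • (Complex.I • v) := by
          rw [← h1, ← h1, smul_smul, ← add_smul, Complex.re_add_im]
        -- Commuting with multiplication by `√-1` upgrades real linearity to complex linearity.
        have h3 := p.I_comm A hA v _ (p.ι_π_apply hA v)
        have h4 : p.π (A (p.ι (Complex.I • v))) = Complex.I • p.π (A (p.ι v)) := by
          rw [← h3, p.π_ι]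
        rw [RingHom.id_apply, h2, map_add, map_smul, map_smul, map_add, map_smul, map_smul,
          map_add, map_smul, map_smul, h4, ← h1, ← h1, smul_smul, ← add_smul, Complex.re_add_im]
      norm_map' := fun v => by
        have h1 : ∀ w : 𝓥, D.B (p.ι w) (p.ι w) = ‖w‖ ^ 2 := fun w => by
          rw [p.B_ι]; exact inner_self_eq_norm_sq (𝕜 := ℂ) w
        have h2 : ‖p.π (A (p.ι v))‖ ^ 2 = ‖v‖ ^ 2 := by
          rw [← h1, ← h1, p.ι_π_apply hA, D.K_B A hA]
        exact (sq_eq_sq₀ (norm_nonneg _) (norm_nonneg _)).1 h2 } rfl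

theorem unitary_apply {A : E →L[ℝ] E} (hA : A ∈ D.K) (v : 𝓥) :
    p.unitary hA v = p.π (A (p.ι v)) := rfl

theorem ι_unitary {A : E →L[ℝ] E} (hA : A ∈ D.K) (v : 𝓥) :
    p.ι (p.unitary hA v) = A (p.ι v) := p.ι_π_apply hA v

/-- The group of unitary transformations defined by `K`. -/
noncomputable def unitaryGroup : Subgroup (EuclideanSpace ℂ (Fin (n + 1)) ≃ₗᵢ[ℂ]
    EuclideanSpace ℂ (Fin (n + 1))) where
  carrier := {U | ∃ A ∈ D.K, ∀ v, p.ι (U v) = A (p.ι v)}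
  mul_mem' := by
    rintro U V ⟨A, hA, hU⟩ ⟨A', hA', hV⟩
    exact ⟨A * A', D.K.mul_mem hA hA', fun v => by
      rw [LinearIsometryEquiv.coe_mul, Function.comp_apply, hU, hV, mul_apply_eq_comp]⟩
  one_mem' := ⟨1, D.K.one_mem, fun v => rfl⟩
  inv_mem' := by
    rintro U ⟨A, hA, hU⟩
    obtain ⟨A', hA', hl, -⟩ := D.exists_inverse hA
    refine ⟨A', hA', fun v => ?_⟩
    have h := hU (U⁻¹ v)
    have h2 : U (U⁻¹ v) = v := U.apply_symm_apply v
    rw [h2] at h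
    rw [h, hl]

theorem unitary_mem {A : E →L[ℝ] E} (hA : A ∈ D.K) : p.unitary hA ∈ p.unitaryGroup :=
  ⟨A, hA, p.ι_unitary hA⟩

variable [FiniteDimensional ℝ E]

theorem continuous_π : Continuous p.π := LinearMap.continuous_of_finiteDimensional _

/-- The group is the continuous image of the compact group `D.K`. -/
theorem isCompact_unitaryGroup :
    IsCompact (clm '' (p.unitaryGroup : Set (𝓥 ≃ₗᵢ[ℂ] 𝓥))) := by
  have : CompactSpace D.K := isCompact_iff_compactSpace.1 D.isCompact_K
  have hc : Continuous fun A : D.K => clm (p.unitary A.2) := by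
    rw [continuous_clm_apply]
    intro v
    exact p.continuous_π.comp
      ((ContinuousLinearMap.apply ℝ E (p.ι v)).continuous.comp continuous_subtype_val)
  convert isCompact_range hc using 1
  ext T
  constructor
  · rintro ⟨U, ⟨A, hA, hU⟩, rfl⟩
    refine ⟨⟨A, hA⟩, congrArg clm (LinearIsometryEquiv.ext fun v => p.injective ?_)⟩
    rw [p.ι_unitary, hU]
  · rintro ⟨A, rfl⟩
    exact ⟨_, p.unitary_mem A.2, rfl⟩

/-- The orbit of a restricted root is weakly reflective. -/
theorem isWeaklyReflective_orbit {𝔞 : Submodule ℝ E} (h𝔞 : Maximal D.IsAbelian 𝔞)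
    (v : {v : 𝓥 // v ≠ 0}) (hv : D.IsRestrictedRoot 𝔞 (p.ι v)) :
    IsWeaklyReflective (fubiniStudy n) {q | ∃ U ∈ p.unitaryGroup, q = act U (proj v)} := by
  have : CompleteSpace E := FiniteDimensional.complete ℝ E
  refine CPn.isWeaklyReflective_orbit p.isCompact_unitaryGroup v ?_
  rintro W ⟨A, hA, hW⟩ ζ hζ hnormal
  have hβ : D.θ (A (p.ι v)) = -A (p.ι v) := by rw [← hW, p.θ_ι]
  -- Normality is tested on the curves `exp(t ad X)` with `θX = X`, which lie in `K`; the velocities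
  -- at the base point are `[X, β]`.
  have had : D.ad (p.ι ζ) (A (p.ι v)) = 0 := by
    refine D.ad_eq_zero_of_normal hβ (p.θ_ι ζ) fun X hX => ?_
    have hXβ : D.θ (D.ad X (A (p.ι v))) = -D.ad X (A (p.ι v)) := by
      rw [D.θ_ad, hX, hβ, map_neg]
    have h0 := hnormal (fun t => p.unitary (D.exp_smul_mem hX t)) (p.π (D.ad X (A (p.ι v)))) ?_
      (fun t => p.unitary_mem _) ?_
    · rw [← p.ι_π hXβ, p.B_ι, h0]
    · ext1 w
      rw [p.unitary_apply]
      simp [p.π_ι]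
    · have h1 : HasDerivAt (fun t : ℝ => NormedSpace.exp (t • D.ad X) (A (p.ι v)))
          (D.ad X (A (p.ι v))) 0 := by
        simpa using (hasDerivAt_exp_smul_const (D.ad X) (0 : ℝ)).clm_apply
          (hasDerivAt_const 0 (A (p.ι v)))
      have h2 := (LinearMap.toContinuousLinearMap p.π).hasFDerivAt.comp_hasDerivAt (0 : ℝ) h1
      refine h2.congr_of_eventuallyEq (Eventually.of_forall fun t => ?_)
      change p.unitary _ (W v.1) = _
      rw [p.unitary_apply, hW]
      rfl
  have hB : D.B (A (p.ι v)) (p.ι ζ) = 0 := by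
    rw [← hW, p.B_ι, hζ, Complex.zero_re]
  obtain ⟨k, hk, hk1, hk2⟩ := D.exists_neg_fix h𝔞 hv hA (p.θ_ι ζ) had hB
  refine ⟨p.unitary hk, p.unitary_mem hk, p.injective ?_, p.injective ?_⟩
  · rw [p.ι_unitary, hW, hk1, map_neg, hW]
  · rw [p.ι_unitary, hk2]

end HermitianParam

end OrthogonalSymmetricData

end IsotropyUnitary

/-! ### Transfer to the Hermitian symmetric pair -/

section HermitianPair

set_option linter.unusedSectionVars false

open CPn

variable {E : Type*} [NormedAddCommGroup E] [NormedSpace ℝ E] [FiniteDimensional ℝ E]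
  {G : Type*} [TopologicalSpace G] [ChartedSpace E G] [Group G] [LieGroup 𝓘(ℝ, E) ∞ G]
  [T2Space G] [CompactSpace G] {P : SymmetricPair E G} {B : P.InvariantInner}
  {J : P.HermitianStructure B} {n : ℕ}

namespace SymmetricPair

/-- Polarization of `norm_sq`. -/
theorem HermitianIso.form_eq (Φ : P.HermitianIso J n) (X Y : P.𝔪) :
    B.form X Y = (inner ℂ (Φ.Φ X) (Φ.Φ Y)).re := by
  have h1 := Φ.norm_sq (X + Y)
  have h2 := norm_add_sq (𝕜 := ℂ) (Φ.Φ X) (Φ.Φ Y)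
  rw [map_add, h2, Φ.norm_sq, Φ.norm_sq] at h1
  have h3 : B.form (X + Y : P.𝔪) (X + Y : P.𝔪) =
      B.form X X + B.form X Y + (B.form Y X + B.form Y Y) := by
    simp [Submodule.coe_add]
  rw [h3, B.symm Y X] at h1
  have h4 : RCLike.re (inner ℂ (Φ.Φ X) (Φ.Φ Y)) = (inner ℂ (Φ.Φ X) (Φ.Φ Y)).re := rfl
  rw [h4] at h1
  linarith

/-- The parametrization of `𝔪` by `ℂⁿ⁺¹`. -/
noncomputable def HermitianIso.param (Φ : P.HermitianIso J n) : (P.data B).HermitianParam n where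
  ι := (P.𝔪.subtype ∘ₗ Φ.Φ.symm.toLinearMap : _ →ₗ[ℝ] GroupLieAlgebra 𝓘(ℝ, E) G)
  mem_range X hX := ⟨Φ.Φ ⟨X, hX⟩, congrArg Subtype.val (Φ.Φ.symm_apply_apply ⟨X, hX⟩)⟩
  θ_ι v := (Φ.Φ.symm v).2
  B_ι v w := by
    refine (Φ.form_eq (Φ.Φ.symm v) (Φ.Φ.symm w)).trans ?_
    rw [LinearEquiv.apply_symm_apply, LinearEquiv.apply_symm_apply]
  I_comm := by
    rintro _ ⟨k, hk, rfl⟩ v w h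
    have hJ (u : EuclideanSpace ℂ (Fin (n + 1))) :
        Φ.Φ.symm (Complex.I • u) = J.J (Φ.Φ.symm u) := by
      rw [LinearEquiv.symm_apply_eq, Φ.map_J, LinearEquiv.apply_symm_apply]
    have h1 := J.ad_comm k hk (Φ.Φ.symm v) (Φ.Φ.symm w) h
    rw [← hJ, ← hJ] at h1
    exact h1

theorem HermitianIso.param_ι (Φ : P.HermitianIso J n) (X : P.𝔪) : Φ.param.ι (Φ.Φ X) = X.1 :=
  congrArg Subtype.val (Φ.Φ.symm_apply_apply X)

theorem HermitianIso.projImage_orbit (Φ : P.HermitianIso J n) (X : P.𝔪) (hX : Φ.Φ X ≠ 0) :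
    Φ.projImage (P.orbit X) =
      {q | ∃ U ∈ Φ.param.unitaryGroup, q = act U (proj ⟨Φ.Φ X, hX⟩)} := by
  ext q
  constructor
  · rintro ⟨Y, ⟨k, hk, hY⟩, h, rfl⟩
    have hA : adRep E k ∈ (P.data B).K := ⟨k, hk, rfl⟩
    refine ⟨_, Φ.param.unitary_mem hA, ?_⟩
    rw [act_proj]
    congr 2
    refine Φ.param.injective ?_
    rw [Φ.param.ι_unitary, Φ.param_ι, Φ.param_ι]
    exact hY
  · rintro ⟨U, ⟨_, ⟨k, hk, rfl⟩, hU⟩, rfl⟩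
    have h1 := hU (Φ.Φ X)
    rw [Φ.param_ι] at h1
    refine ⟨Φ.Φ.symm (U (Φ.Φ X)), ⟨k, hk, h1⟩, by simpa using hX, ?_⟩
    rw [act_proj]
    congr 2
    rw [LinearEquiv.apply_symm_apply]

end SymmetricPair

end HermitianPair

/-! ### The main theorem -/

theorem mainTheorem9
    {E : Type*} [NormedAddCommGroup E] [NormedSpace ℝ E] [FiniteDimensional ℝ E]
    {G : Type*} [TopologicalSpace G] [ChartedSpace E G] [Group G] [LieGroup 𝓘(ℝ, E) ∞ G]
    [T2Space G] [CompactSpace G] [ConnectedSpace G]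
    (P : SymmetricPair E G) (hP : P.IsIrreducible)
    (B : P.InvariantInner) (J : P.HermitianStructure B)
    (𝔞 : Submodule ℝ (GroupLieAlgebra 𝓘(ℝ, E) G)) (h𝔞 : P.IsMaximalAbelian 𝔞)
    (α : GroupLieAlgebra 𝓘(ℝ, E) G) (hα : α ∈ P.restrictedRoots B 𝔞) :
    ∃ n : ℕ, Nonempty (P.HermitianIso J n) ∧
      ∀ Φ : P.HermitianIso J n,
        IsWeaklyReflective (CPn.fubiniStudy n) (Φ.projImage (P.orbit α)) := by
  have : FiniteDimensional ℝ (GroupLieAlgebra 𝓘(ℝ, E) G) := inferInstanceAs (FiniteDimensional ℝ E)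
  -- Since `𝔪 ≠ 0`, its complex dimension has the form `n + 1`.
  have : Nontrivial P.𝔪 := Submodule.nontrivial_iff_ne_bot.2 hP.1
  obtain ⟨n, Φ₀, h1, h2⟩ := exists_hermitian_equiv J.J J.sq
    (B.form.domRestrict₁₂ P.𝔪 P.𝔪) (fun X Y => B.symm X Y)
    (fun X hX => B.pos X (by simpa using hX)) J.isometry
  refine ⟨n, ⟨⟨Φ₀, h1, h2⟩⟩, fun Φ => ?_⟩
  have hroot := P.isRestrictedRoot_data hα
  have hα𝔪 : α ∈ P.𝔪 := h𝔞.1.1 hα.1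
  have hX : Φ.Φ ⟨α, hα𝔪⟩ ≠ 0 := by
    rw [Ne, LinearEquiv.map_eq_zero_iff, Submodule.mk_eq_zero]
    exact hα.2.1
  have hι : (P.data B).IsRestrictedRoot 𝔞 (Φ.param.ι (Φ.Φ ⟨α, hα𝔪⟩)) := by
    rw [Φ.param_ι]
    exact hroot
  have h3 := Φ.param.isWeaklyReflective_orbit h𝔞.data ⟨Φ.Φ ⟨α, hα𝔪⟩, hX⟩ hι
  rw [← Φ.projImage_orbit ⟨α, hα𝔪⟩ hX] at h3
  exact h3
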